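/- Let $c>0$, $T=\ln\sqrt3$, and let $M=(\Sigma_1,\Sigma_2,\Sigma_3;\Gamma)$ be the $Y$-catenoid of scale $c$: $\Sigma_1$ is the flat disk $X_1(t,\theta)=c\big(\tfrac{2t}{\sqrt3}\cos\theta,\tfrac{2t}{\sqrt3}\sin\theta,0\big)$, $0\le t\le1$, and $\Sigma_2,\Sigma_3$ are the catenoidal ends $X_{2,3}(t,\theta)=c\big(\cosh(t+T)\cos\theta,\cosh(t+T)\sin\theta,\pm t\big)$, $t\ge0$; the three faces meet at $120^\circ$ along the circle $\Gamma$ of radius $2c/\sqrt3$ in $\{x_3=0\}$. Let $L^2_*(M)$ be the $L^2$ space with weight $(1+|x|^2)^{-1}(\log(2+|x|))^{-2}$, and let $\mathcal D$ be the space of triples $u=(u_1,u_2,u_3)$ of functions $u_i\in L^2_*(\Sigma_i)$ with weak gradient $\nabla u_i\in L^2(\Sigma_i)$ whose traces on $\Gamma$ satisfy the compatibility condition $u_1+u_2+u_3=0$. On $\mathcal D$ consider the index form $$Q(u,v)=\sum_{i=1}^3\Big(\int_{\Sigma_i}\langle\nabla u_i,\nabla v_i\rangle-|A_i|^2u_iv_i\;-\int_\Gamma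 (\mathbf H_\Gamma\cdot\nu_i)\,u_iv_i\Big),$$ where $|A_i|$ is the norm of the second fundamental form of $\Sigma_i$, $\nu_i$ is its outward unit conormal along $\Gamma$ and $\mathbf H_\Gamma$ is the curvature vector of $\Gamma$. Then: 1. The Morse index is one: the maximal dimension of a subspace of $\mathcal D$ on which $Q$ is negative definite is $1$, and the same holds for the subspace of the compactly supported elements of $\mathcal D$. 2. The nullity is three: the null space $\{u\in\mathcal D: Q(u,v)=0\ \forall v\in\mathcal D\}$ has dimension $3$. 3. $Q(u,u)<0$ for $u=(0,\tanh(t+T),-\tanh(t+T))\in\mathcal D$. 4. The null space consists exactly of the elements $$\Big(-a,\ a\tanh(t+T)+\tfrac{b\cos\theta+d\sin\theta}{\cosh(t+T)},\ a\tanh(t+T)-\tfrac{b\cos\theta+d\sin\theta}{\cosh(t+T)}\Big),\qquad a,b,d\in\mathbb R.$$ -/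

import Mathlib

open MeasureTheory Set
open scoped ENNReal ContDiff Matrix

noncomputable section

namespace YSurface

/-- Euclidean three-space. -/
abbrev E3 : Type := EuclideanSpace ℝ (Fin 3)

/-- Partial derivative in the first variable `t`. -/
def pdt {E : Type*} [NormedAddCommGroup E] [NormedSpace ℝ E] (f : ℝ × ℝ → E) (p : ℝ × ℝ) : E :=
  deriv (fun s => f (s, p.2)) p.1

/-- Partial derivative in the second variable `θ`. -/
def pdθ {E : Type*} [NormedAddCommGroup E] [NormedSpace ℝ E] (f : ℝ × ℝ → E) (p : ℝ × ℝ) : E :=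
  deriv (fun s => f (p.1, s)) p.2

/-- The data of a parametrized annular face: `X (t, θ)` is meant to be `2π`-periodic in `θ` and a
smooth immersion for `t` in the open interval `J`, and the face is the part of the surface lying on one side of the closed
curve `t = bdry`.  The number `side` is `1` if `t` increases towards the curve from inside the face
and `-1` if it decreases. -/
structure Face where
  J : Set ℝ
  bdry : ℝ
  side : ℝ
  X : ℝ × ℝ → E3

namespace Face

variable (F : Face)

/-- The parameter interval of the face, including the boundary parameter. -/
def dom : Set ℝ := {t | t ∈ F.J ∧ F.side * t ≤ F.side * F.bdry}

/-- Lebesgue measure `dt dθ` on one period of the parameter domain. -/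
def param : Measure (ℝ × ℝ) := volume.restrict (F.dom ×ˢ Ioc 0 (2 * Real.pi))

/-- First fundamental form. -/
def firstFF (p : ℝ × ℝ) : Matrix (Fin 2) (Fin 2) ℝ :=
  !![inner ℝ (pdt F.X p) (pdt F.X p), inner ℝ (pdt F.X p) (pdθ F.X p);
     inner ℝ (pdθ F.X p) (pdt F.X p), inner ℝ (pdθ F.X p) (pdθ F.X p)]

/-- The vector `X_t × X_θ`. -/
def crossVec (p : ℝ × ℝ) : E3 :=
  WithLp.toLp 2 (crossProduct (WithLp.ofLp (pdt F.X p)) (WithLp.ofLp (pdθ F.X p)))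

/-- Unit normal. -/
def normal (p : ℝ × ℝ) : E3 := ‖F.crossVec p‖⁻¹ • F.crossVec p

/-- Second fundamental form. -/
def secondFF (p : ℝ × ℝ) : Matrix (Fin 2) (Fin 2) ℝ :=
  !![inner ℝ (pdt (pdt F.X) p) (F.normal p), inner ℝ (pdt (pdθ F.X) p) (F.normal p);
     inner ℝ (pdθ (pdt F.X) p) (F.normal p), inner ℝ (pdθ (pdθ F.X) p) (F.normal p)]

/-- Matrix of the shape operator. -/
def shape (p : ℝ × ℝ) : Matrix (Fin 2) (Fin 2) ℝ := (F.firstFF p)⁻¹ * F.secondFF p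

/-- The norm `|A|` of the second fundamental form, `|A|² = g^{ik} g^{jl} h_{ij} h_{kl}`. -/
def normA (p : ℝ × ℝ) : ℝ := Real.sqrt (Matrix.trace (F.shape p * F.shape p))

/-- The area measure of the face, read in the parameter domain. -/
def area : Measure (ℝ × ℝ) :=
  F.param.withDensity (fun p => ENNReal.ofReal (Real.sqrt (F.firstFF p).det))

/-- The weighted area measure `(1 + |x|²)⁻¹ (log (2 + |x|))⁻² dA` that defines `L²_*`. -/
def weighted : Measure (ℝ × ℝ) :=
  F.area.withDensity (fun p =>
    ENNReal.ofReal ((1 + ‖F.X p‖ ^ 2)⁻¹ * ((Real.log (2 + ‖F.X p‖)) ^ 2)⁻¹))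

/-- The boundary curve. -/
def curve (θ : ℝ) : E3 := F.X (F.bdry, θ)

/-- Lebesgue measure `dθ` on one period of the boundary curve. -/
def cparam : Measure ℝ := volume.restrict (Ioc 0 (2 * Real.pi))

/-- Arc length of the boundary curve. -/
def length : Measure ℝ :=
  cparam.withDensity (fun θ => ENNReal.ofReal ‖deriv F.curve θ‖)

/-- Curvature vector of the boundary curve: the component of `γ''` orthogonal to `γ'`, divided by
`|γ'|²`. -/
def curvVec (θ : ℝ) : E3 :=
  (‖deriv F.curve θ‖ ^ 2)⁻¹ •
    (deriv (deriv F.curve) θ -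
      (inner ℝ (deriv (deriv F.curve) θ) (deriv F.curve θ) / ‖deriv F.curve θ‖ ^ 2) •
        deriv F.curve θ)

/-- A tangent vector of the face, orthogonal to the boundary curve, pointing out of the face. -/
def conormalVec (θ : ℝ) : E3 :=
  F.side • (pdt F.X (F.bdry, θ) -
    (inner ℝ (pdt F.X (F.bdry, θ)) (deriv F.curve θ) / ‖deriv F.curve θ‖ ^ 2) • deriv F.curve θ)

/-- Outward unit conormal `ν` of the face along its boundary curve. -/
def conormal (θ : ℝ) : E3 := ‖F.conormalVec θ‖⁻¹ • F.conormalVec θ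

/-- The function `H_Γ · ν` on the boundary curve. -/
def curvNu (θ : ℝ) : ℝ := inner ℝ (F.curvVec θ) (F.conormal θ)

/-- Test functions on the face: smooth, `2π`-periodic in `θ`, compactly supported in the parameter
`t`.  They need not vanish on the boundary curve. -/
structure IsTest (φ : ℝ × ℝ → ℝ) : Prop where
  smooth : ContDiff ℝ ∞ φ
  periodic : ∀ t θ, φ (t, θ + 2 * Real.pi) = φ (t, θ)
  support : ∃ K, IsCompact K ∧ K ⊆ F.J ∧ ∀ t θ, t ∉ K → φ (t, θ) = 0

/-- `u` is a function on the face that lies in `L²_*`, whose weak gradient `V` (a tangential vector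
field with values in `ℝ³`) lies in `L²`, and `g` is the trace of `u` on the boundary curve.  Weak
gradient and trace are defined together by integration by parts against all test functions, and both
are uniquely determined by `u`.  The fields `finA`, `finK` say that the other two terms of the index
form are finite.  They and the local integrability conditions hold automatically where `|A|²` is
bounded by a multiple of the weight of `L²_*` and `X` is a smooth immersion. -/
structure IsSobolev (u : ℝ × ℝ → ℝ) (V : ℝ × ℝ → E3) (g : ℝ → ℝ) : Prop where
  memU : MemLp u 2 F.weighted
  memV : MemLp V 2 F.area
  memG : MemLp g 2 F.length
  finA : MemLp (fun p => F.normA p * u p) 2 F.area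
  finK : MemLp (fun θ => F.curvNu θ * g θ) 2 F.length
  tangent : ∀ᵐ p ∂F.param, inner ℝ (V p) (F.normal p) = 0
  locU : ∀ K, IsCompact K → K ⊆ F.J → IntegrableOn u (K ×ˢ univ) F.param
  locT : ∀ K, IsCompact K → K ⊆ F.J →
    IntegrableOn (fun p => inner ℝ (V p) (pdt F.X p)) (K ×ˢ univ) F.param
  locθ : ∀ K, IsCompact K → K ⊆ F.J →
    IntegrableOn (fun p => inner ℝ (V p) (pdθ F.X p)) (K ×ˢ univ) F.param
  locG : Integrable g cparam
  weakT : ∀ φ, F.IsTest φ →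
    ∫ p, u p * pdt φ p ∂F.param =
      -(∫ p, inner ℝ (V p) (pdt F.X p) * φ p ∂F.param) +
        F.side * ∫ θ, g θ * φ (F.bdry, θ) ∂cparam
  weakθ : ∀ φ, F.IsTest φ →
    ∫ p, u p * pdθ φ p ∂F.param = -(∫ p, inner ℝ (V p) (pdθ F.X p) * φ p ∂F.param)

variable {F}

theorem IsTest.pdt_eq {φ : ℝ × ℝ → ℝ} (h : F.IsTest φ) :
    pdt φ = fun p => fderiv ℝ φ p (1, 0) := by
  funext p
  have h1 : HasFDerivAt φ (fderiv ℝ φ p) (p.1, p.2) :=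
    ((h.smooth.differentiable (by simp)) p).hasFDerivAt
  have h2 : HasDerivAt (fun s : ℝ => (s, p.2)) ((1 : ℝ), (0 : ℝ)) p.1 :=
    (hasDerivAt_id p.1).prodMk (hasDerivAt_const p.1 p.2)
  exact (h1.comp_hasDerivAt p.1 h2).deriv

theorem IsTest.pdθ_eq {φ : ℝ × ℝ → ℝ} (h : F.IsTest φ) :
    pdθ φ = fun p => fderiv ℝ φ p (0, 1) := by
  funext p
  have h1 : HasFDerivAt φ (fderiv ℝ φ p) (p.1, p.2) :=
    ((h.smooth.differentiable (by simp)) p).hasFDerivAt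
  have h2 : HasDerivAt (fun s : ℝ => (p.1, s)) ((0 : ℝ), (1 : ℝ)) p.2 :=
    (hasDerivAt_const p.2 p.1).prodMk (hasDerivAt_id p.2)
  exact (h1.comp_hasDerivAt p.2 h2).deriv

theorem IsTest.cont_pdt {φ : ℝ × ℝ → ℝ} (h : F.IsTest φ) : Continuous (pdt φ) := by
  rw [h.pdt_eq]
  exact (h.smooth.continuous_fderiv (by simp)).clm_apply continuous_const

theorem IsTest.cont_pdθ {φ : ℝ × ℝ → ℝ} (h : F.IsTest φ) : Continuous (pdθ φ) := by
  rw [h.pdθ_eq]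
  exact (h.smooth.continuous_fderiv (by simp)).clm_apply continuous_const

theorem integrable_mul_of_support {f ψ : ℝ × ℝ → ℝ} {K : Set ℝ} (hK : IsCompact K)
    (hf : IntegrableOn f (K ×ˢ univ) F.param) (hψ : Continuous ψ)
    (h0 : ∀ t θ, t ∉ K → ψ (t, θ) = 0) : Integrable (fun p => f p * ψ p) F.param := by
  rw [← integrableOn_iff_integrable_of_support_subset (s := K ×ˢ (univ : Set ℝ))]
  · obtain ⟨C, hC⟩ := (hK.prod (isCompact_Icc (a := (0 : ℝ)) (b := 2 * Real.pi))).exists_bound_of_continuousOn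
      hψ.continuousOn
    refine Integrable.mul_bdd (c := C) hf hψ.aestronglyMeasurable ?_
    have hKm : MeasurableSet (K ×ˢ (univ : Set ℝ)) := hK.measurableSet.prod MeasurableSet.univ
    have h1 : ∀ᵐ p ∂(F.param.restrict (K ×ˢ univ)), p ∈ K ×ˢ (univ : Set ℝ) :=
      ae_restrict_mem hKm
    have h2 : ∀ᵐ p ∂(F.param.restrict (K ×ˢ univ)), p.2 ∈ Ioc 0 (2 * Real.pi) := by
      refine ae_restrict_of_ae ?_
      have hle : F.param ≤ volume.restrict ((univ : Set ℝ) ×ˢ Ioc 0 (2 * Real.pi)) :=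
        Measure.restrict_mono (prod_mono (subset_univ _) le_rfl) le_rfl
      refine hle.absolutelyContinuous.ae_le ?_
      filter_upwards [ae_restrict_mem (MeasurableSet.univ.prod measurableSet_Ioc)] with p hp
      exact hp.2
    filter_upwards [h1, h2] with p hp1 hp2
    exact hC p ⟨hp1.1, hp2.1.le, hp2.2⟩
  · intro p hp
    by_contra hc
    apply hp
    have : p.1 ∉ K := fun h => hc ⟨h, mem_univ _⟩
    have h3 : ψ p = 0 := h0 p.1 p.2 this
    simp [h3]

theorem IsTest.exists_support {φ : ℝ × ℝ → ℝ} (h : F.IsTest φ) :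
    ∃ K, IsCompact K ∧ K ⊆ F.J ∧ (∀ t θ, t ∉ K → φ (t, θ) = 0) ∧
      (∀ t θ, t ∉ K → pdt φ (t, θ) = 0) ∧ (∀ t θ, t ∉ K → pdθ φ (t, θ) = 0) := by
  obtain ⟨K, hK, hKJ, h0⟩ := h.support
  refine ⟨K, hK, hKJ, h0, ?_, ?_⟩
  · intro t θ ht
    have : (fun s => φ (s, θ)) =ᶠ[nhds t] fun _ => 0 := by
      filter_upwards [hK.isClosed.isOpen_compl.mem_nhds ht] with s hs
      exact h0 s θ hs
    simpa [pdt] using this.deriv_eq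
  · intro t θ ht
    have : (fun s => φ (t, s)) = fun _ => 0 := funext fun s => h0 t s ht
    simp [pdθ, this]

theorem IsSobolev.integrableU_t {u V g} (h : F.IsSobolev u V g) {φ} (hφ : F.IsTest φ) :
    Integrable (fun p => u p * pdt φ p) F.param := by
  obtain ⟨K, hK, hJ, -, h1, -⟩ := hφ.exists_support
  exact integrable_mul_of_support hK (h.locU K hK hJ) hφ.cont_pdt h1

theorem IsSobolev.integrableU_θ {u V g} (h : F.IsSobolev u V g) {φ} (hφ : F.IsTest φ) :
    Integrable (fun p => u p * pdθ φ p) F.param := by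
  obtain ⟨K, hK, hJ, -, -, h1⟩ := hφ.exists_support
  exact integrable_mul_of_support hK (h.locU K hK hJ) hφ.cont_pdθ h1

theorem IsSobolev.integrableV_t {u V g} (h : F.IsSobolev u V g) {φ} (hφ : F.IsTest φ) :
    Integrable (fun p => inner ℝ (V p) (pdt F.X p) * φ p) F.param := by
  obtain ⟨K, hK, hJ, h0, -, -⟩ := hφ.exists_support
  exact integrable_mul_of_support hK (h.locT K hK hJ) hφ.smooth.continuous h0

theorem IsSobolev.integrableV_θ {u V g} (h : F.IsSobolev u V g) {φ} (hφ : F.IsTest φ) :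
    Integrable (fun p => inner ℝ (V p) (pdθ F.X p) * φ p) F.param := by
  obtain ⟨K, hK, hJ, h0, -, -⟩ := hφ.exists_support
  exact integrable_mul_of_support hK (h.locθ K hK hJ) hφ.smooth.continuous h0

theorem IsSobolev.integrableG {u V g} (h : F.IsSobolev u V g) {φ} (hφ : F.IsTest φ) :
    Integrable (fun θ => g θ * φ (F.bdry, θ)) cparam := by
  have hc : Continuous fun θ => φ (F.bdry, θ) :=
    hφ.smooth.continuous.comp (by fun_prop)
  obtain ⟨C, hC⟩ := (isCompact_Icc (a := (0 : ℝ)) (b := 2 * Real.pi)).exists_bound_of_continuousOn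
    hc.continuousOn
  refine Integrable.mul_bdd (c := C) h.locG hc.aestronglyMeasurable ?_
  filter_upwards [ae_restrict_mem measurableSet_Ioc] with θ hθ
  exact hC θ ⟨hθ.1.le, hθ.2⟩

theorem IsSobolev.zero : F.IsSobolev 0 0 0 where
  memU := MemLp.zero
  memV := MemLp.zero
  memG := MemLp.zero
  finA := by simp
  finK := by simp
  tangent := by simp
  locU := fun K _ _ => integrableOn_zero
  locT := fun K _ _ => by simp
  locθ := fun K _ _ => by simp
  locG := integrable_zero _ _ _
  weakT := fun φ _ => by simp
  weakθ := fun φ _ => by simp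

theorem IsSobolev.add {u V g u' V' g'} (h : F.IsSobolev u V g) (h' : F.IsSobolev u' V' g') :
    F.IsSobolev (u + u') (V + V') (g + g') where
  memU := h.memU.add h'.memU
  memV := h.memV.add h'.memV
  memG := h.memG.add h'.memG
  finA := by
    convert h.finA.add h'.finA using 1
    funext p
    simp [mul_add]
  finK := by
    convert h.finK.add h'.finK using 1
    funext p
    simp [mul_add]
  tangent := by
    filter_upwards [h.tangent, h'.tangent] with p h1 h2
    simp [inner_add_left, h1, h2]
  locU := fun K hK hJ => (h.locU K hK hJ).add (h'.locU K hK hJ)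
  locT := fun K hK hJ => by
    simpa [inner_add_left] using! (h.locT K hK hJ).add (h'.locT K hK hJ)
  locθ := fun K hK hJ => by
    simpa [inner_add_left] using! (h.locθ K hK hJ).add (h'.locθ K hK hJ)
  locG := h.locG.add h'.locG
  weakT := fun φ hφ => by
    simp only [Pi.add_apply, inner_add_left, add_mul]
    rw [integral_add (h.integrableU_t hφ) (h'.integrableU_t hφ),
      integral_add (h.integrableV_t hφ) (h'.integrableV_t hφ),
      integral_add (h.integrableG hφ) (h'.integrableG hφ), h.weakT φ hφ, h'.weakT φ hφ]
    ring
  weakθ := fun φ hφ => by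
    simp only [Pi.add_apply, inner_add_left, add_mul]
    rw [integral_add (h.integrableU_θ hφ) (h'.integrableU_θ hφ),
      integral_add (h.integrableV_θ hφ) (h'.integrableV_θ hφ), h.weakθ φ hφ, h'.weakθ φ hφ]
    ring

theorem IsSobolev.smul {u V g} (a : ℝ) (h : F.IsSobolev u V g) :
    F.IsSobolev (a • u) (a • V) (a • g) where
  memU := h.memU.const_smul a
  memV := h.memV.const_smul a
  memG := h.memG.const_smul a
  finA := by
    convert h.finA.const_smul a using 1
    funext p
    simp [mul_left_comm]
  finK := by
    convert h.finK.const_smul a using 1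
    funext p
    simp [mul_left_comm]
  tangent := by
    filter_upwards [h.tangent] with p h1
    simp [inner_smul_left, h1]
  locU := fun K hK hJ => (h.locU K hK hJ).smul a
  locT := fun K hK hJ => by
    simpa [inner_smul_left] using! (h.locT K hK hJ).smul a
  locθ := fun K hK hJ => by
    simpa [inner_smul_left] using! (h.locθ K hK hJ).smul a
  locG := h.locG.smul a
  weakT := fun φ hφ => by
    simp only [Pi.smul_apply, inner_smul_left, smul_eq_mul, mul_assoc, integral_const_mul,
      h.weakT φ hφ, RCLike.conj_to_real]
    ring
  weakθ := fun φ hφ => by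
    simp only [Pi.smul_apply, inner_smul_left, smul_eq_mul, mul_assoc, integral_const_mul,
      h.weakθ φ hφ, RCLike.conj_to_real]
    ring

theorem area_ac : F.area ≪ F.param := withDensity_absolutelyContinuous _ _

theorem weighted_ac : F.weighted ≪ F.param :=
  (withDensity_absolutelyContinuous _ _).trans area_ac

theorem length_ac : F.length ≪ cparam := withDensity_absolutelyContinuous _ _

theorem IsSobolev.congr {u V g u' V' g'} (h : F.IsSobolev u V g) (hu : u =ᵐ[F.param] u')
    (hV : V =ᵐ[F.param] V') (hg : g =ᵐ[cparam] g') : F.IsSobolev u' V' g' where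
  memU := h.memU.ae_eq (weighted_ac.ae_le hu)
  memV := h.memV.ae_eq (area_ac.ae_le hV)
  memG := h.memG.ae_eq (length_ac.ae_le hg)
  finA := h.finA.ae_eq (by filter_upwards [area_ac.ae_le hu] with p hp; rw [hp])
  finK := h.finK.ae_eq (by filter_upwards [length_ac.ae_le hg] with p hp; rw [hp])
  tangent := by
    filter_upwards [h.tangent, hV] with p h1 h2
    rwa [← h2]
  locU := fun K hK hJ => (h.locU K hK hJ).congr (ae_restrict_of_ae hu)
  locT := fun K hK hJ => (h.locT K hK hJ).congr (ae_restrict_of_ae (by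
    filter_upwards [hV] with p hp; rw [hp]))
  locθ := fun K hK hJ => (h.locθ K hK hJ).congr (ae_restrict_of_ae (by
    filter_upwards [hV] with p hp; rw [hp]))
  locG := h.locG.congr hg
  weakT := fun φ hφ => by
    have e1 : ∫ p, u p * pdt φ p ∂F.param = ∫ p, u' p * pdt φ p ∂F.param :=
      integral_congr_ae (by filter_upwards [hu] with p hp; rw [hp])
    have e2 : ∫ p, inner ℝ (V p) (pdt F.X p) * φ p ∂F.param =
        ∫ p, inner ℝ (V' p) (pdt F.X p) * φ p ∂F.param :=
      integral_congr_ae (by filter_upwards [hV] with p hp; rw [hp])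
    have e3 : ∫ θ, g θ * φ (F.bdry, θ) ∂cparam = ∫ θ, g' θ * φ (F.bdry, θ) ∂cparam :=
      integral_congr_ae (by filter_upwards [hg] with p hp; rw [hp])
    rw [← e1, ← e2, ← e3]
    exact h.weakT φ hφ
  weakθ := fun φ hφ => by
    have e1 : ∫ p, u p * pdθ φ p ∂F.param = ∫ p, u' p * pdθ φ p ∂F.param :=
      integral_congr_ae (by filter_upwards [hu] with p hp; rw [hp])
    have e2 : ∫ p, inner ℝ (V p) (pdθ F.X p) * φ p ∂F.param =
        ∫ p, inner ℝ (V' p) (pdθ F.X p) * φ p ∂F.param :=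
      integral_congr_ae (by filter_upwards [hV] with p hp; rw [hp])
    rw [← e1, ← e2]
    exact h.weakθ φ hφ

variable (F)

/-- Triples (function, vector field, function on the boundary curve), up to almost everywhere
equality. -/
abbrev Data : Type :=
  ((ℝ × ℝ) →ₘ[F.param] ℝ) × ((ℝ × ℝ) →ₘ[F.param] E3) × (ℝ →ₘ[cparam] ℝ)

/-- The space `W^{1,2} ∩ L²_*` of the face: an element is a function `u` in `L²_*` with weak gradient
in `L²`, recorded together with its weak gradient and its trace on the boundary curve. -/
def sobolev : Submodule ℝ F.Data where
  carrier := {U | F.IsSobolev U.1 U.2.1 U.2.2}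
  zero_mem' := IsSobolev.zero.congr AEEqFun.coeFn_zero.symm AEEqFun.coeFn_zero.symm
    AEEqFun.coeFn_zero.symm
  add_mem' := fun h h' => (IsSobolev.add h h').congr (AEEqFun.coeFn_add _ _).symm
    (AEEqFun.coeFn_add _ _).symm (AEEqFun.coeFn_add _ _).symm
  smul_mem' := fun a _ h => (IsSobolev.smul a h).congr (AEEqFun.coeFn_smul _ _).symm
    (AEEqFun.coeFn_smul _ _).symm (AEEqFun.coeFn_smul _ _).symm

/-- The contribution of a face to the index form:
`∫ ⟨∇u, ∇v⟩ - |A|² u v dA - ∫_Γ (H_Γ · ν) u v ds`. -/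
def form (U U' : F.sobolev) : ℝ :=
  (∫ p, inner ℝ (U.1.2.1 p) (U'.1.2.1 p) - F.normA p ^ 2 * (U.1.1 p * U'.1.1 p) ∂F.area) -
    ∫ θ, F.curvNu θ * (U.1.2.2 θ * U'.1.2.2 θ) ∂F.length

variable {F}

theorem integrable_form (U U' : F.sobolev) :
    Integrable (fun p => inner ℝ (U.1.2.1 p) (U'.1.2.1 p) -
      F.normA p ^ 2 * (U.1.1 p * U'.1.1 p)) F.area := by
  refine Integrable.sub ?_ ?_
  · have h1 : MemLp (fun p => ‖U.1.2.1 p‖) 2 F.area := U.2.memV.norm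
    have h2 : MemLp (fun p => ‖U'.1.2.1 p‖) 2 F.area := U'.2.memV.norm
    refine (h1.integrable_mul h2).mono'
      (U.2.memV.aestronglyMeasurable.inner U'.2.memV.aestronglyMeasurable) ?_
    exact Filter.Eventually.of_forall fun p => norm_inner_le_norm _ _
  · convert (U.2.finA.integrable_mul U'.2.finA) using 1
    funext p
    simp only [Pi.mul_apply]
    ring

theorem integrable_form_curve (U U' : F.sobolev) :
    Integrable (fun θ => F.curvNu θ * (U.1.2.2 θ * U'.1.2.2 θ)) F.length := by
  convert (U.2.finK.integrable_mul U'.2.memG) using 1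
  funext p
  simp only [Pi.mul_apply]
  ring

theorem form_comm (U U' : F.sobolev) : F.form U U' = F.form U' U := by
  simp only [form, real_inner_comm, mul_comm]

theorem form_add (U U' W : F.sobolev) : F.form (U + U') W = F.form U W + F.form U' W := by
  have e1 : ∀ᵐ p ∂F.area, (U + U').1.1 p = U.1.1 p + U'.1.1 p :=
    area_ac.ae_le (AEEqFun.coeFn_add U.1.1 U'.1.1)
  have e2 : ∀ᵐ p ∂F.area, (U + U').1.2.1 p = U.1.2.1 p + U'.1.2.1 p :=
    area_ac.ae_le (AEEqFun.coeFn_add U.1.2.1 U'.1.2.1)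
  have e3 : ∀ᵐ p ∂F.length, (U + U').1.2.2 p = U.1.2.2 p + U'.1.2.2 p :=
    length_ac.ae_le (AEEqFun.coeFn_add U.1.2.2 U'.1.2.2)
  have a1 := integral_add (integrable_form U W) (integrable_form U' W)
  have a2 := integral_add (integrable_form_curve U W) (integrable_form_curve U' W)
  unfold form
  have b1 : ∫ p, inner ℝ ((U + U').1.2.1 p) (W.1.2.1 p) -
      F.normA p ^ 2 * ((U + U').1.1 p * W.1.1 p) ∂F.area = _ :=
    (integral_congr_ae (by
      filter_upwards [e1, e2] with p h1 h2
      rw [h1, h2, inner_add_left]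
      ring)).trans a1
  have b2 : ∫ θ, F.curvNu θ * ((U + U').1.2.2 θ * W.1.2.2 θ) ∂F.length = _ :=
    (integral_congr_ae (by
      filter_upwards [e3] with p h3
      rw [h3]
      ring)).trans a2
  rw [b1, b2]
  ring

theorem form_smul (a : ℝ) (U W : F.sobolev) : F.form (a • U) W = a * F.form U W := by
  have e1 : ∀ᵐ p ∂F.area, (a • U).1.1 p = a * U.1.1 p :=
    area_ac.ae_le (AEEqFun.coeFn_smul a U.1.1)
  have e2 : ∀ᵐ p ∂F.area, (a • U).1.2.1 p = a • U.1.2.1 p :=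
    area_ac.ae_le (AEEqFun.coeFn_smul a U.1.2.1)
  have e3 : ∀ᵐ p ∂F.length, (a • U).1.2.2 p = a * U.1.2.2 p :=
    length_ac.ae_le (AEEqFun.coeFn_smul a U.1.2.2)
  unfold form
  rw [mul_sub, ← integral_const_mul, ← integral_const_mul]
  congr 1
  · refine integral_congr_ae ?_
    filter_upwards [e1, e2] with p h1 h2
    rw [h1, h2, real_inner_smul_left]
    ring
  · refine integral_congr_ae ?_
    filter_upwards [e3] with p h3
    rw [h3]
    ring

/-- `form` as a bilinear form. -/
def bilin (F : Face) : LinearMap.BilinForm ℝ F.sobolev :=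
  LinearMap.mk₂ ℝ F.form form_add form_smul
    (fun U W W' => by rw [form_comm, form_add, form_comm W, form_comm W'])
    (fun a U W => by rw [form_comm, form_smul, form_comm W, smul_eq_mul])

end Face

/-- A triple junction of parametrized annular faces: the three boundary curves are glued along the
common parameter `θ`. -/
abbrev TripleJunction : Type := Fin 3 → Face

namespace TripleJunction

variable (M : TripleJunction)

/-- The space `W^{1,2}_Δ(M) ∩ L²_*(M)`: the three traces on the common boundary curve sum to zero. -/
def formDomain : Submodule ℝ ((i : Fin 3) → (M i).sobolev) where
  carrier := {U | ∑ i, (U i).1.2.2 = 0}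
  zero_mem' := by simp
  add_mem' := fun {U U'} h h' => by
    have h1 : ∑ i, (U i).1.2.2 = 0 := h
    have h2 : ∑ i, (U' i).1.2.2 = 0 := h'
    simp [Finset.sum_add_distrib, h1, h2]
  smul_mem' := fun a U h => by
    have h1 : ∑ i, (U i).1.2.2 = 0 := h
    simp [← Finset.smul_sum, h1]

/-- The function on the `i`-th face underlying an element of the domain. -/
def fn {M : TripleJunction} (U : M.formDomain) (i : Fin 3) : (ℝ × ℝ) →ₘ[(M i).param] ℝ :=
  (U.1 i).1.1

/-- The index form `Q(u, v)` of the triple junction. -/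
def indexForm : LinearMap.BilinForm ℝ M.formDomain :=
  ∑ i, (M i).bilin.compl₁₂ ((LinearMap.proj i).comp M.formDomain.subtype)
    ((LinearMap.proj i).comp M.formDomain.subtype)

/-- Elements of the domain with bounded support in `ℝ³`: the space `W^{1,2}_{Δ,c}(M)` when `M` is
a closed subset of `ℝ³`. -/
def compactDomain : Submodule ℝ M.formDomain where
  carrier := {U | ∃ R : ℝ, ∀ i, ∀ᵐ p ∂(M i).param, R < ‖(M i).X p‖ → fn U i p = 0}
  zero_mem' := ⟨0, fun i => by
    filter_upwards [AEEqFun.coeFn_zero (α := ℝ × ℝ) (μ := (M i).param) (β := ℝ)] with p hp _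
    exact hp⟩
  add_mem' := by
    rintro U U' ⟨R, h⟩ ⟨R', h'⟩
    refine ⟨max R R', fun i => ?_⟩
    filter_upwards [h i, h' i, AEEqFun.coeFn_add (fn U i) (fn U' i)] with p h1 h2 h3 hp
    have h4 : fn (U + U') i p = fn U i p + fn U' i p := h3
    rw [h4, h1 ((le_max_left _ _).trans_lt hp), h2 ((le_max_right _ _).trans_lt hp), add_zero]
  smul_mem' := by
    rintro a U ⟨R, h⟩
    refine ⟨R, fun i => ?_⟩
    filter_upwards [h i, AEEqFun.coeFn_smul a (fn U i)] with p h1 h3 hp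
    have h4 : fn (a • U) i p = a * fn U i p := h3
    rw [h4, h1 hp, mul_zero]

end TripleJunction

/-- Index of a symmetric bilinear form: the maximal dimension of a subspace on which it is negative
definite. -/
def index {V : Type*} [AddCommMonoid V] [Module ℝ V] (B : LinearMap.BilinForm ℝ V) : ℕ∞ :=
  ⨆ W : {W : Submodule ℝ V // ∀ w ∈ W, w ≠ 0 → B w w < 0}, Cardinal.toENat (Module.rank ℝ W.1)

/-- Nullity of a symmetric bilinear form: the dimension of its null space. -/
def nullity {V : Type*} [AddCommMonoid V] [Module ℝ V] (B : LinearMap.BilinForm ℝ V) : ℕ∞ :=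
  Cardinal.toENat (Module.rank ℝ (LinearMap.ker B))

/-- The parameter shift `log √3`, for which the outward conormal of the catenoidal end along its
boundary circle makes an angle of `120°` with that of the flat disk. -/
def T₀ : ℝ := Real.log (Real.sqrt 3)

/-- The flat disk of radius `2c/√3` in the plane `x₃ = 0`, in polar coordinates, `0 < t ≤ 1`.
(The center is a single point, which is removable for functions with square integrable gradient.) -/
def diskFace (c : ℝ) : Face where
  J := Ioi 0
  bdry := 1
  side := 1
  X := fun p => c • !₂[2 * p.1 / Real.sqrt 3 * Real.cos p.2, 2 * p.1 / Real.sqrt 3 * Real.sin p.2, 0]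

/-- A catenoidal end with neck radius `c`, `t ≥ 0`; `ε = 1` is the upper one, `ε = -1` the lower. -/
def catFace (c ε : ℝ) : Face where
  J := univ
  bdry := 0
  side := -1
  X := fun p => c • !₂[Real.cosh (p.1 + T₀) * Real.cos p.2, Real.cosh (p.1 + T₀) * Real.sin p.2,
    ε * p.1]

/-- The `Y`-catenoid of scale `c`. -/
def yCatenoid (c : ℝ) : TripleJunction := ![diskFace c, catFace c 1, catFace c (-1)]

end YSurface

end

/-! Conformal coordinates separate the variables. On a catenoidal end the metric is (c cosh(t+T))²
(dt² + dθ²), so the Dirichlet integral is the flat one on a half-cylinder, |A|² dA becomes 2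
sech²(t+T) dt dθ, and the boundary term becomes -½ ∫ g² dθ for the trace g (`catFace_form`). On the
disk only the Dirichlet integral and + ∫ g² dθ remain (`diskFace_form`). The trace condition turns
the disk trace into -(g₂ + g₃), hence Q(u,u) = ∫ |∇u₁|² + ∫ (g₂ + g₃)² + E(u₂) + E(u₃), where E is
the energy of an end (`indexForm_self`).

Expand the two ends into trigonometric modes in θ, and for each frequency k let s and d be half the
sum and half the difference of the two modes. The k-th contribution of the last three terms is
2(E_k(s) + 2 s(0)²) + 2 E_k(d), up to the Parseval factor. Each part is a sum of squares, obtained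
from a positive Jacobi field by the Riccati substitution: E_k(s) + 2 s(0)² = ∫ (s' - (sech²/tanh)
s)² + k² ∫ s² with the dilation field tanh (`integral_square_tanh`); E_k(d) = ∫ (d' + tanh · d)² +
(k² - 1) ∫ d² for k ≠ 0 with the rotation field sech (`integral_square_sech`). The constants at t =
0 match because tanh T = 1/2, which is the 120° condition. Only the antisymmetric mode k = 0 can be
negative, and it too is nonnegative when d(0) = 0. No decay at infinity has to be assumed: the
boundary quantity is integrable and convergent, so its limit is zero (`integral_Ioi_eq_neg`).

Index: tanh solves the Jacobi equation but misses the natural boundary condition, and for P = (0,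
tanh, -tanh) the pairing Q(P,u) is exactly the difference of the zeroth trace coefficients of the
two ends (`exists_pair_tanh`). So Q ≥ 0 on the hyperplane Q(P,·) = 0, which bounds the index by one,
while Q(P,P) < 0. With compact supports a cutoff profile replaces P as the negative direction
(`exists_compact_neg`).

Nullity: (-1, tanh, tanh) and (0, v, -v), with v = sech · cos θ or sech · sin θ, are null by direct
pairing (`exists_null_tanh`, `exists_null_sech`). Conversely, a null vector is orthogonal to P, so
its zeroth trace coefficients on the two ends agree. Subtracting a combination of the three fields
makes these coefficients vanish and makes those of frequency ±1 agree on the two ends. Now every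
square above vanishes, and the resulting first-order equations with zero initial value leave only
zero (`eq_zero_of_indexForm`, `null_space_of_coefficients`). -/

noncomputable section

namespace YSurface

/-! ### Absolutely continuous functions on the half-line. -/

/-- The function with value `w₀` at `0` and derivative `z`. -/
def prim (w₀ : ℝ) (z : ℝ → ℝ) (t : ℝ) : ℝ := w₀ + ∫ s in (0 : ℝ)..t, z s

/-- Integrability on all intervals `[0, R]`. -/
def LocInt (z : ℝ → ℝ) : Prop := ∀ R, 0 ≤ R → IntervalIntegrable z volume 0 R

theorem LocInt.integrableOn_Ioc {z : ℝ → ℝ} (hz : LocInt z) (R : ℝ) : IntegrableOn z (Ioc 0 R) := by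
  rcases le_or_gt 0 R with h | h
  · exact (intervalIntegrable_iff_integrableOn_Ioc_of_le h).1 (hz R h)
  · rw [Ioc_eq_empty (by linarith)]; simp

theorem locInt_of_integrableOn {z : ℝ → ℝ} (h : ∀ R, 0 ≤ R → IntegrableOn z (Ioc 0 R)) :
    LocInt z := fun R hR =>
  (intervalIntegrable_iff_integrableOn_Ioc_of_le hR).2 (h R hR)

theorem LocInt.of_memLp {z : ℝ → ℝ} (h : MemLp z 2 (volume.restrict (Ioi 0))) : LocInt z := by
  refine locInt_of_integrableOn fun R _ => ?_
  have h1 : MemLp z 2 (volume.restrict (Ioc 0 R)) :=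
    h.mono_measure (Measure.restrict_mono Ioc_subset_Ioi_self le_rfl)
  exact h1.integrable (by norm_num)

theorem LocInt.of_continuousOn {z : ℝ → ℝ} (h : ContinuousOn z (Ici 0)) : LocInt z := fun R hR =>
  (h.mono (by rw [uIcc_of_le hR]; exact Icc_subset_Ici_self)).intervalIntegrable

theorem LocInt.add {z y : ℝ → ℝ} (hz : LocInt z) (hy : LocInt y) : LocInt (fun t => z t + y t) :=
  fun R hR => (hz R hR).add (hy R hR)

theorem prim_zero (w₀ : ℝ) (z : ℝ → ℝ) : prim w₀ z 0 = w₀ := by simp [prim]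

theorem LocInt.absolutelyContinuous {z : ℝ → ℝ} (hz : LocInt z) (w₀ : ℝ) {R : ℝ} (hR : 0 ≤ R) :
    AbsolutelyContinuousOnInterval (prim w₀ z) 0 R := by
  have h1 := (hz R hR).absolutelyContinuousOnInterval_intervalIntegral (c := 0) (by simp)
  have h2 : AbsolutelyContinuousOnInterval (fun _ : ℝ => w₀) 0 R :=
    (contDiff_const.contDiffOn (n := 1)).absolutelyContinuousOnInterval
  exact h2.add h1

theorem LocInt.continuousOn {z : ℝ → ℝ} (hz : LocInt z) (w₀ : ℝ) :
    ContinuousOn (prim w₀ z) (Ici 0) := by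
  intro t ht
  have h1 := (hz.absolutelyContinuous w₀ (R := t + 1) (by simp at ht; linarith)).continuousOn
  rw [uIcc_of_le (by simp at ht; linarith)] at h1
  refine (h1 t ⟨ht, by linarith⟩).mono_of_mem_nhdsWithin ?_
  rw [← Ici_inter_Iic]
  exact Filter.inter_mem self_mem_nhdsWithin (mem_nhdsWithin_of_mem_nhds (Iic_mem_nhds (by linarith)))

theorem LocInt.continuousOn_mul {z a : ℝ → ℝ} (hz : LocInt z) (ha : ContinuousOn a (Ici 0)) :
    LocInt (fun t => a t * z t) := fun R hR =>
  (hz R hR).continuousOn_mul (ha.mono (by rw [uIcc_of_le hR]; exact Icc_subset_Ici_self))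

theorem LocInt.ae_deriv {z : ℝ → ℝ} (hz : LocInt z) (w₀ : ℝ) {R : ℝ} (hR : 0 ≤ R) :
    ∀ᵐ t, t ∈ uIoc 0 R → deriv (prim w₀ z) t = z t := by
  filter_upwards [(hz R hR).ae_hasDerivAt_integral] with t h ht
  exact ((h (uIoc_subset_uIcc ht) 0 (by simp)).const_add w₀).deriv

/-- Product rule for absolutely continuous functions. -/
theorem prim_mul_prim {z y : ℝ → ℝ} (hz : LocInt z) (hy : LocInt y) (w v : ℝ) {R : ℝ}
    (hR : 0 ≤ R) :
    prim w z R * prim v y R =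
      prim (w * v) (fun t => z t * prim v y t + prim w z t * y t) R := by
  have h := AbsolutelyContinuousOnInterval.integral_deriv_mul_eq_sub
    (hz.absolutelyContinuous w hR) (hy.absolutelyContinuous v hR)
  have h2 : ∫ t in (0 : ℝ)..R, deriv (prim w z) t * prim v y t + prim w z t * deriv (prim v y) t =
      ∫ t in (0 : ℝ)..R, z t * prim v y t + prim w z t * y t := by
    refine intervalIntegral.integral_congr_ae ?_
    filter_upwards [hz.ae_deriv w hR, hy.ae_deriv v hR] with t h1 h2 ht
    rw [h1 ht, h2 ht]
  rw [h2, prim_zero, prim_zero] at h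
  simp only [prim] at h ⊢
  linarith

theorem prim_of_hasDerivAt {a a' : ℝ → ℝ} (h : ∀ t, 0 ≤ t → HasDerivAt a (a' t) t)
    (hc : ContinuousOn a' (Ici 0)) {R : ℝ} (hR : 0 ≤ R) : prim (a 0) a' R = a R := by
  have := intervalIntegral.integral_eq_sub_of_hasDerivAt (f := a) (f' := a') (a := 0) (b := R)
    (fun t ht => h t (by rw [uIcc_of_le hR] at ht; exact ht.1))
    ((LocInt.of_continuousOn hc) R hR)
  rw [prim, this]; ring

theorem prim_congr {w : ℝ} {z y : ℝ → ℝ} (h : ∀ᵐ t ∂volume.restrict (Ioi 0), z t = y t) {R : ℝ}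
    (hR : 0 ≤ R) : prim w z R = prim w y R := by
  unfold prim
  congr 1
  refine intervalIntegral.integral_congr_ae ?_
  rw [ae_restrict_iff' measurableSet_Ioi] at h
  filter_upwards [h] with t ht h1
  rw [uIoc_of_le hR] at h1
  exact ht h1.1

/-- Product rule for a smooth and an absolutely continuous function. -/
theorem mul_prim {a a' z : ℝ → ℝ} (h : ∀ t, 0 ≤ t → HasDerivAt a (a' t) t)
    (hc : ContinuousOn a' (Ici 0)) (hz : LocInt z) (w : ℝ) {R : ℝ} (hR : 0 ≤ R) :
    a R * prim w z R = prim (a 0 * w) (fun t => a' t * prim w z t + a t * z t) R := by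
  rw [← prim_of_hasDerivAt h hc hR, prim_mul_prim (LocInt.of_continuousOn hc) hz _ _ hR]
  refine prim_congr ?_ hR
  filter_upwards [ae_restrict_mem measurableSet_Ioi] with t ht
  rw [prim_of_hasDerivAt h hc (le_of_lt ht)]

theorem mul_prim_sq {a a' z : ℝ → ℝ} (h : ∀ t, 0 ≤ t → HasDerivAt a (a' t) t)
    (hc : ContinuousOn a' (Ici 0)) (hz : LocInt z) (w : ℝ) {R : ℝ} (hR : 0 ≤ R) :
    a R * prim w z R ^ 2 =
      prim (a 0 * w ^ 2) (fun t => a' t * prim w z t ^ 2 + 2 * a t * (prim w z t * z t)) R := by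
  have hac : ContinuousOn a (Ici 0) := fun t ht => (h t ht).continuousAt.continuousWithinAt
  have hy : LocInt (fun t => a' t * prim w z t + a t * z t) :=
    (LocInt.of_continuousOn (hc.mul (hz.continuousOn w))).add (hz.continuousOn_mul hac)
  calc a R * prim w z R ^ 2 = (a R * prim w z R) * prim w z R := by ring
    _ = _ := by
      rw [mul_prim h hc hz w hR, prim_mul_prim hy hz _ _ hR]
      rw [show a 0 * w * w = a 0 * w ^ 2 by ring]
      refine prim_congr ?_ hR
      filter_upwards [ae_restrict_mem measurableSet_Ioi] with t ht
      rw [← mul_prim h hc hz w (le_of_lt ht)]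
      ring

/-- The multiplier `a` is an integrating factor: the equation says that `a` times the primitive has
zero derivative, and it starts at zero. -/
theorem prim_eq_zero_of_ode {w : ℝ} {z a a' : ℝ → ℝ} (hz : LocInt z)
    (h : ∀ t, 0 ≤ t → HasDerivAt a (a' t) t) (hc : ContinuousOn a' (Ici 0))
    (ha : ∀ t, 0 ≤ t → a t ≠ 0) (hw : w = 0)
    (hode : ∀ᵐ t ∂volume.restrict (Ioi 0), a' t * prim w z t + a t * z t = 0) {R : ℝ}
    (hR : 0 ≤ R) : prim w z R = 0 := by
  have h1 := mul_prim h hc hz w hR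
  rw [prim_congr (y := fun _ => 0) hode hR] at h1
  simpa [prim, hw, ha R hR] using h1

/-- An integrable function on `(0, ∞)` with integrable derivative tends to zero at infinity. -/
theorem integral_Ioi_eq_neg {F f : ℝ → ℝ} {F₀ : ℝ} (hf : IntegrableOn f (Ioi 0))
    (hF : IntegrableOn F (Ioi 0)) (h : ∀ R, 0 ≤ R → F R = prim F₀ f R) :
    ∫ t in Ioi 0, f t = -F₀ := by
  have h1 := intervalIntegral_tendsto_integral_Ioi (0 : ℝ) hf Filter.tendsto_id
  have h2 : Filter.Tendsto F Filter.atTop (nhds (F₀ + ∫ t in Ioi 0, f t)) := by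
    refine (h1.const_add F₀).congr' ?_
    filter_upwards [Filter.eventually_ge_atTop 0] with R hR
    rw [h R hR]; rfl
  have h3 : IntegrableAtFilter F Filter.atTop := ⟨Ioi 0, Filter.Ioi_mem_atTop _, hF⟩
  -- Integrability of the derivative gives a limit at infinity. A nonzero limit would contradict the
  -- integrability of `F`, since neighbourhoods of infinity have infinite measure.
  have := h3.eq_zero_of_tendsto (fun s hs => by
    rcases Filter.mem_atTop_sets.1 hs with ⟨b, hb⟩
    rw [← top_le_iff, ← Real.volume_Ici (a := b)]
    exact measure_mono hb) h2
  linarith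

/-- A function on the half-line with a weak derivative is absolutely continuous. -/
theorem ae_eq_prim_of_weak {w z : ℝ → ℝ} {w₀ : ℝ} (hw : LocInt w) (hz : LocInt z)
    (H : ∀ η : ℝ → ℝ, ContDiff ℝ ∞ η → HasCompactSupport η →
      ∫ t in Ioi 0, w t * deriv η t = -(∫ t in Ioi 0, z t * η t) - w₀ * η 0) :
    ∀ᵐ t ∂volume.restrict (Ioi 0), w t = prim w₀ z t := by
  have hpc := hz.continuousOn w₀
  suffices h : ∀ᵐ t, t ∈ Ioi (0 : ℝ) → w t - prim w₀ z t = 0 by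
    rw [ae_restrict_iff' measurableSet_Ioi]
    filter_upwards [h] with t h1 h2
    exact sub_eq_zero.1 (h1 h2)
  have hloc : LocInt (fun t => w t - prim w₀ z t) := fun R hR =>
    (hw R hR).sub (LocInt.of_continuousOn hpc R hR)
  refine isOpen_Ioi.ae_eq_zero_of_integral_contDiff_smul_eq_zero ?_ ?_
  · intro t ht
    refine ⟨Ioc 0 (t + 1), ?_, hloc.integrableOn_Ioc _⟩
    rw [← Ioi_inter_Iic]
    exact Filter.inter_mem self_mem_nhdsWithin (mem_nhdsWithin_of_mem_nhds (Iic_mem_nhds (by linarith)))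
  intro ρ hρ hcs hsub
  obtain ⟨R, hR0, hR⟩ : ∃ R, 0 ≤ R ∧ ∀ t, R ≤ t → ρ t = 0 := by
    obtain ⟨R, hR⟩ := hcs.isCompact.bddAbove
    refine ⟨max R 0 + 1, by positivity, fun t ht => ?_⟩
    by_contra hne
    have := hR (subset_tsupport ρ hne)
    have := le_max_left R 0
    linarith
  have hρ0 : ∀ t, t ≤ 0 → ρ t = 0 := fun t ht => by
    by_contra hne
    exact absurd (hsub (subset_tsupport ρ hne)) (not_lt.2 ht)
  -- The primitive is based at `R` so that it vanishes beyond the support of `ρ`. It need not vanish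
  -- at `0`, and this is how the initial value `w₀` enters.
  set P : ℝ → ℝ := fun t => ∫ s in R..t, ρ s with hP
  have hPd : ∀ t, HasDerivAt P (ρ t) t := fun t =>
    intervalIntegral.integral_hasDerivAt_right (hρ.continuous.intervalIntegrable _ _)
      (hρ.continuous.stronglyMeasurableAtFilter _ _) hρ.continuous.continuousAt
  have hPR : ∀ t, R ≤ t → P t = 0 := fun t ht => by
    simp only [hP]
    rw [intervalIntegral.integral_of_le ht]
    exact setIntegral_eq_zero_of_forall_eq_zero fun s hs => hR s hs.1.le
  have hPs : ContDiff ℝ ∞ P := by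
    rw [contDiff_infty_iff_deriv]
    refine ⟨fun t => (hPd t).differentiableAt, ?_⟩
    rwa [show deriv P = ρ from funext fun t => (hPd t).deriv]
  -- `P` does not have compact support towards the left. The factor is 1 for t ≥ -1 and 0 for t ≤
  -- -2, so nothing changes on the half-line of integration.
  set η : ℝ → ℝ := fun t => Real.smoothTransition (t + 2) * P t with hη
  have hηP : ∀ t, -1 ≤ t → η t = P t := fun t ht => by
    simp [hη, Real.smoothTransition.one_of_one_le (show 1 ≤ t + 2 by linarith)]
  have hηs : ContDiff ℝ ∞ η :=
    (Real.smoothTransition.contDiff.comp (contDiff_id.add contDiff_const)).mul hPs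
  have hηd : ∀ t, 0 < t → deriv η t = ρ t := fun t ht => by
    rw [← (hPd t).deriv]
    refine Filter.EventuallyEq.deriv_eq ?_
    filter_upwards [lt_mem_nhds ht] with s hs
    exact hηP s (by linarith)
  have hηc : HasCompactSupport η := by
    refine HasCompactSupport.intro (isCompact_Icc (a := -2) (b := R)) fun t ht => ?_
    rcases lt_or_ge t (-2) with h | h
    · simp [hη, Real.smoothTransition.zero_of_nonpos (show t + 2 ≤ 0 by linarith)]
    · have : R < t := by
        by_contra h2
        exact ht ⟨h, not_lt.1 h2⟩
      rw [hηP t (by linarith), hPR t this.le]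
  have h1 := H η hηs hηc
  have e0 : ∀ f : ℝ → ℝ, (∀ t, R ≤ t → f t = 0) → ∫ t in Ioi 0, f t = ∫ t in (0 : ℝ)..R, f t := by
    intro f hf
    rw [intervalIntegral.integral_of_le hR0]
    refine (setIntegral_eq_of_subset_of_forall_sdiff_eq_zero measurableSet_Ioi Ioc_subset_Ioi_self
      fun t ht => hf t ?_)
    by_contra h2
    exact ht.2 ⟨ht.1, (not_le.1 h2).le⟩
  have e1 : ∫ t in Ioi 0, w t * deriv η t = ∫ t in (0 : ℝ)..R, w t * ρ t := by
    rw [← e0 _ fun t ht => by rw [hR t ht, mul_zero]]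
    exact setIntegral_congr_fun measurableSet_Ioi fun t ht => by simp only [hηd t ht]
  have e2 : ∫ t in Ioi 0, z t * η t = ∫ t in (0 : ℝ)..R, z t * P t := by
    rw [← e0 _ fun t ht => by rw [hPR t ht, mul_zero]]
    exact setIntegral_congr_fun measurableSet_Ioi fun t (ht : 0 < t) => by
      simp only [hηP t (by linarith)]
  have hPc : ContinuousOn P (Ici 0) := hPs.continuous.continuousOn
  -- The product rule for `P * prim w₀ z` on [0, R] gives for the primitive the same identity that
  -- `H` gives for `w`. Comparing the two shows that the difference integrates to zero against `ρ`.
  have h3 := mul_prim (fun t _ => hPd t) hρ.continuous.continuousOn hz w₀ hR0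
  rw [hPR R le_rfl, zero_mul] at h3
  unfold prim at h3
  rw [intervalIntegral.integral_add] at h3
  · have h4 : ∫ t in (0 : ℝ)..R, P t * z t = ∫ t in (0 : ℝ)..R, z t * P t := by simp only [mul_comm]
    rw [h4] at h3
    have h5 : ∫ t in (0 : ℝ)..R, w t * ρ t = ∫ t in (0 : ℝ)..R, ρ t * prim w₀ z t := by
      rw [← e1, h1, e2, hηP 0 (by norm_num)]
      unfold prim
      linarith
    have h6 : ∀ t, ρ t • (w t - prim w₀ z t) = (Ioi 0).indicator
        (fun t => ρ t * (w t - prim w₀ z t)) t := fun t => by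
      by_cases ht : t ∈ Ioi (0 : ℝ)
      · simp [ht]
      · simp [ht, hρ0 t (not_lt.1 ht)]
    simp_rw [h6]
    rw [integral_indicator measurableSet_Ioi, e0 _ fun t ht => by rw [hR t ht, zero_mul]]
    simp_rw [mul_sub]
    rw [intervalIntegral.integral_sub, ← h5]
    · simp_rw [mul_comm (ρ _)]; ring
    · exact hw.continuousOn_mul hρ.continuous.continuousOn R hR0
    · exact LocInt.of_continuousOn (hρ.continuous.continuousOn.mul hpc) R hR0
  · exact LocInt.of_continuousOn (hρ.continuous.continuousOn.mul hpc) R hR0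
  · exact hz.continuousOn_mul hPc R hR0

/-! ### The profiles sech and tanh, shifted by `T₀`. -/

/-- `1 / cosh (t + T₀)`. -/
def sech (t : ℝ) : ℝ := (Real.cosh (t + T₀))⁻¹

/-- `tanh (t + T₀)`. -/
def th (t : ℝ) : ℝ := Real.tanh (t + T₀)

theorem exp_T₀ : Real.exp T₀ = Real.sqrt 3 := Real.exp_log (by positivity)

theorem T₀_pos : 0 < T₀ := Real.log_pos (by
  rw [Real.lt_sqrt (by norm_num)]; norm_num)

theorem cosh_T₀ : Real.cosh T₀ = 2 / Real.sqrt 3 := by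
  rw [Real.cosh_eq, Real.exp_neg, exp_T₀]
  have : Real.sqrt 3 ^ 2 = 3 := Real.sq_sqrt (by norm_num)
  field_simp
  linarith

theorem sinh_T₀ : Real.sinh T₀ = 1 / Real.sqrt 3 := by
  rw [Real.sinh_eq, Real.exp_neg, exp_T₀]
  have : Real.sqrt 3 ^ 2 = 3 := Real.sq_sqrt (by norm_num)
  field_simp
  linarith

/-- The 120° condition in analytic form. Together with `sech_sq_zero` it produces the boundary
constants 3/2 and 1/2 of the two square identities. -/
theorem th_zero : th 0 = 1 / 2 := by
  rw [th, zero_add, Real.tanh_eq_sinh_div_cosh, sinh_T₀, cosh_T₀]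
  field_simp

theorem sech_zero : sech 0 = Real.sqrt 3 / 2 := by
  rw [sech, zero_add, cosh_T₀]
  field_simp

theorem sech_pos (t : ℝ) : 0 < sech t := inv_pos.2 (Real.cosh_pos _)

theorem sech_le_one (t : ℝ) : sech t ≤ 1 := inv_le_one_of_one_le₀ (Real.one_le_cosh _)

theorem th_sq (t : ℝ) : th t ^ 2 = 1 - sech t ^ 2 := by
  have := Real.cosh_sq (t + T₀)
  have := Real.cosh_pos (t + T₀)
  rw [th, sech, Real.tanh_eq_sinh_div_cosh]
  field_simp
  linarith

theorem sech_sq_zero : sech 0 ^ 2 = 3 / 4 := by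
  rw [sech_zero, div_pow, Real.sq_sqrt (by norm_num)]; norm_num

theorem half_le_th {t : ℝ} (ht : 0 ≤ t) : 1 / 2 ≤ th t := by
  rw [← th_zero, th, th, zero_add, Real.tanh_eq_sinh_div_cosh, Real.tanh_eq_sinh_div_cosh,
    div_le_div_iff₀ (Real.cosh_pos _) (Real.cosh_pos _)]
  have : 0 ≤ Real.sinh (t + T₀ - T₀) := Real.sinh_nonneg_iff.2 (by linarith)
  rw [Real.sinh_sub] at this
  linarith

theorem abs_th_le_one (t : ℝ) : |th t| ≤ 1 := by
  rw [abs_le_one_iff_mul_self_le_one, ← pow_two, th_sq]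
  nlinarith [sq_nonneg (sech t)]

theorem hasDerivAt_sech (t : ℝ) : HasDerivAt sech (-(th t * sech t)) t := by
  have h := (((Real.hasDerivAt_cosh (t + T₀)).comp_add_const t T₀).inv (Real.cosh_pos _).ne')
  convert! h using 1
  rw [th, sech, Real.tanh_eq_sinh_div_cosh]
  have := Real.cosh_pos (t + T₀)
  field_simp

theorem hasDerivAt_th (t : ℝ) : HasDerivAt th (sech t ^ 2) t := by
  have h := ((Real.hasDerivAt_sinh (t + T₀)).comp_add_const t T₀).div
    ((Real.hasDerivAt_cosh (t + T₀)).comp_add_const t T₀) (Real.cosh_pos _).ne'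
  have e : th = (fun t => Real.sinh (t + T₀)) / (fun t => Real.cosh (t + T₀)) := by
    funext x; simp [th, Real.tanh_eq_sinh_div_cosh]
  rw [e]
  convert! h using 1
  rw [sech]
  have := Real.cosh_pos (t + T₀)
  have := Real.cosh_sq (t + T₀)
  field_simp
  linarith

theorem continuous_sech : Continuous sech :=
  continuous_iff_continuousAt.2 fun t => (hasDerivAt_sech t).continuousAt

theorem continuous_th : Continuous th :=
  continuous_iff_continuousAt.2 fun t => (hasDerivAt_th t).continuousAt

theorem sech_le_exp (t : ℝ) : sech t ≤ 2 * Real.exp (-t) := by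
  have h1 : Real.exp t ≤ Real.exp (t + T₀) := Real.exp_le_exp.2 (by linarith [T₀_pos])
  have h2 := Real.exp_pos t
  have h3 := Real.exp_pos (-(t + T₀))
  rw [sech, Real.cosh_eq, Real.exp_neg t]
  rw [inv_le_comm₀ (by positivity) (by positivity)]
  rw [mul_inv, inv_inv]
  linarith

theorem memLp_sech : MemLp sech 2 (volume.restrict (Ioi 0)) := by
  have h : Integrable (fun t => sech t ^ 2) (volume.restrict (Ioi 0)) := by
    refine Integrable.mono' ((integrableOn_exp_neg_Ioi 0).const_mul 2)
      (continuous_sech.pow 2).aestronglyMeasurable (ae_of_all _ fun t => ?_)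
    rw [Real.norm_of_nonneg (sq_nonneg _)]
    nlinarith [sech_le_one t, sech_pos t, sech_le_exp t]
  exact (memLp_two_iff_integrable_sq continuous_sech.aestronglyMeasurable).2 h

theorem memLp_bdd_mul {f a : ℝ → ℝ} {C : ℝ} (hf : MemLp f 2 (volume.restrict (Ioi 0)))
    (ha : ContinuousOn a (Ioi 0)) (hb : ∀ t, 0 < t → |a t| ≤ C) :
    MemLp (fun t => a t * f t) 2 (volume.restrict (Ioi 0)) := by
  refine MemLp.of_le_mul (c := C) hf
    ((ha.aestronglyMeasurable measurableSet_Ioi).mul hf.aestronglyMeasurable) ?_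
  filter_upwards [ae_restrict_mem measurableSet_Ioi] with t ht
  rw [norm_mul]
  exact mul_le_mul_of_nonneg_right (hb t ht) (norm_nonneg _)

/-! ### One-dimensional square identities and weak Jacobi equations. -/

section Identities

variable {z : ℝ → ℝ} {w₀ : ℝ}

/-- Since tanh'' = -2 sech² tanh, the logarithmic derivative φ = sech²/tanh of this Jacobi field
obeys the Riccati equation φ' = -2 sech² - φ². The bound tanh ≥ 1/2 for t ≥ 0 excludes a pole. -/
theorem hasDerivAt_sech_sq_div_th {t : ℝ} (ht : 0 ≤ t) :
    HasDerivAt (fun t => sech t ^ 2 / th t) (-2 * sech t ^ 2 - (sech t ^ 2 / th t) ^ 2) t := by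
  have h0 : th t ≠ 0 := by have := half_le_th ht; linarith
  convert! ((hasDerivAt_sech t).pow 2).div (hasDerivAt_th t) h0 using 1
  simp only [Pi.pow_apply]
  field_simp
  ring

theorem continuousOn_sech_sq_div_th : ContinuousOn (fun t => sech t ^ 2 / th t) (Ici 0) :=
  fun _ ht => (hasDerivAt_sech_sq_div_th ht).continuousAt.continuousWithinAt

/-- Completing the square with the Jacobi field `tanh`. -/
theorem integral_square_tanh (hz : MemLp z 2 (volume.restrict (Ioi 0)))
    (hw : MemLp (fun t => sech t * prim w₀ z t) 2 (volume.restrict (Ioi 0))) :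
    Integrable (fun t => (z t - sech t ^ 2 / th t * prim w₀ z t) ^ 2) (volume.restrict (Ioi 0)) ∧
    (∫ t in Ioi 0, z t ^ 2) - 2 * (∫ t in Ioi 0, (sech t * prim w₀ z t) ^ 2) + 3 / 2 * w₀ ^ 2 =
      ∫ t in Ioi 0, (z t - sech t ^ 2 / th t * prim w₀ z t) ^ 2 := by
  have hPc := continuousOn_sech_sq_div_th
  have hq : ∀ t, 0 < t → |sech t / th t| ≤ 2 := fun t ht => by
    have h1 := half_le_th ht.le
    rw [abs_of_nonneg (div_nonneg (sech_pos t).le (by linarith)), div_le_iff₀ (by linarith)]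
    linarith [sech_le_one t]
  have hqc : ContinuousOn (fun t => sech t / th t) (Ioi 0) :=
    continuous_sech.continuousOn.div continuous_th.continuousOn fun t (ht : 0 < t) => by
      have := half_le_th ht.le
      linarith
  have hPw : MemLp (fun t => sech t ^ 2 / th t * prim w₀ z t) 2 (volume.restrict (Ioi 0)) := by
    refine (memLp_bdd_mul hw hqc hq).congr_norm ?_ (ae_of_all _ fun t => ?_)
    · exact ((hPc.mul ((LocInt.of_memLp hz).continuousOn w₀)).mono
        Ioi_subset_Ici_self).aestronglyMeasurable measurableSet_Ioi
    · congr 1; ring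
  have i1 := hz.integrable_sq
  have i2 := hw.integrable_sq
  have i3 := (hz.sub hPw).integrable_sq
  refine ⟨i3, ?_⟩
  -- By the Riccati equation (φ w²)' = z² - 2 sech² w² - (z - φ w)², with φ = sech²/tanh. The
  -- boundary term at 0 is φ(0) w₀² with φ(0) = (3/4)/(1/2) = 3/2.
  have hF := integral_Ioi_eq_neg (F := fun t => sech t ^ 2 / th t * prim w₀ z t ^ 2)
    (F₀ := sech 0 ^ 2 / th 0 * w₀ ^ 2)
    (f := fun t => (-2 * sech t ^ 2 - (sech t ^ 2 / th t) ^ 2) * prim w₀ z t ^ 2 +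
      2 * (sech t ^ 2 / th t) * (prim w₀ z t * z t)) ?_ ?_ ?_
  · have e : ∫ t in Ioi 0, ((-2 * sech t ^ 2 - (sech t ^ 2 / th t) ^ 2) * prim w₀ z t ^ 2 +
        2 * (sech t ^ 2 / th t) * (prim w₀ z t * z t)) =
        ∫ t in Ioi 0, (z t ^ 2 - 2 * (sech t * prim w₀ z t) ^ 2 -
          (z t - sech t ^ 2 / th t * prim w₀ z t) ^ 2) :=
      integral_congr_ae (ae_of_all _ fun t => by ring)
    rw [e, integral_sub, integral_sub, integral_const_mul] at hF
    · rw [sech_sq_zero, th_zero] at hF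
      linarith
    · exact i1
    · exact i2.const_mul 2
    · exact i1.sub (i2.const_mul 2)
    · exact i3
  · refine ((i1.sub (i2.const_mul 2)).sub i3).congr (ae_of_all _ fun t => ?_)
    simp only [Pi.sub_apply]
    ring
  · have hi : ∀ t, 0 < t → |(th t)⁻¹| ≤ 2 := fun t ht => by
      have h1 := half_le_th ht.le
      rw [abs_of_nonneg (inv_nonneg.2 (by linarith)), inv_le_comm₀ (by linarith) (by norm_num)]
      linarith
    have hic : ContinuousOn (fun t => (th t)⁻¹) (Ioi 0) :=
      continuous_th.continuousOn.inv₀ fun t (ht : 0 < t) => by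
        have := half_le_th ht.le
        linarith
    refine (hw.integrable_mul (memLp_bdd_mul hw hic hi)).congr (ae_of_all _ fun t => ?_)
    simp only [Pi.mul_apply]
    ring
  · intro R hR
    refine mul_prim_sq (fun t ht => hasDerivAt_sech_sq_div_th ht) ?_ (LocInt.of_memLp hz) w₀ hR
    exact (continuous_const.mul (continuous_sech.pow 2)).continuousOn.sub (hPc.pow 2)

/-- Completing the square with the Jacobi field `cos θ / cosh`. -/
theorem integral_square_sech (hz : MemLp z 2 (volume.restrict (Ioi 0)))
    (hw : MemLp (prim w₀ z) 2 (volume.restrict (Ioi 0))) :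
    Integrable (fun t => (z t + th t * prim w₀ z t) ^ 2) (volume.restrict (Ioi 0)) ∧
    (∫ t in Ioi 0, z t ^ 2) + (∫ t in Ioi 0, prim w₀ z t ^ 2) -
      2 * (∫ t in Ioi 0, (sech t * prim w₀ z t) ^ 2) - 1 / 2 * w₀ ^ 2 =
      ∫ t in Ioi 0, (z t + th t * prim w₀ z t) ^ 2 := by
  have hsw := memLp_bdd_mul (C := 1) hw continuous_sech.continuousOn fun t _ => by
    rw [abs_of_pos (sech_pos t)]; exact sech_le_one t
  have htw := memLp_bdd_mul (C := 1) hw continuous_th.continuousOn fun t _ => abs_th_le_one t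
  have i1 := hz.integrable_sq
  have i2 := hw.integrable_sq
  have i3 := (hz.add htw).integrable_sq
  have i4 := hsw.integrable_sq
  refine ⟨i3, ?_⟩
  -- The logarithmic derivative of sech is -tanh, and (tanh · w²)' = (z + tanh · w)² - (z² + w² - 2
  -- sech² w²). Here `w` itself is square integrable, so no weight is needed for the vanishing at
  -- infinity.
  have hF := integral_Ioi_eq_neg (F := fun t => th t * prim w₀ z t ^ 2) (F₀ := th 0 * w₀ ^ 2)
    (f := fun t => sech t ^ 2 * prim w₀ z t ^ 2 + 2 * th t * (prim w₀ z t * z t)) ?_ ?_ ?_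
  · have e : ∫ t in Ioi 0, (sech t ^ 2 * prim w₀ z t ^ 2 + 2 * th t * (prim w₀ z t * z t)) =
        ∫ t in Ioi 0, ((z t + th t * prim w₀ z t) ^ 2 - (z t ^ 2 + prim w₀ z t ^ 2 -
          2 * (sech t * prim w₀ z t) ^ 2)) :=
      integral_congr_ae (ae_of_all _ fun t => by linear_combination -prim w₀ z t ^ 2 * th_sq t)
    rw [e, integral_sub, integral_sub, integral_add, integral_const_mul] at hF
    · rw [th_zero] at hF
      linarith
    · exact i1
    · exact i2
    · exact i1.add i2
    · exact i4.const_mul 2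
    · exact i3
    · exact (i1.add i2).sub (i4.const_mul 2)
  · refine (i3.sub ((i1.add i2).sub (i4.const_mul 2))).congr (ae_of_all _ fun t => ?_)
    simp only [Pi.sub_apply, Pi.add_apply]
    linear_combination prim w₀ z t ^ 2 * th_sq t
  · refine (hw.integrable_mul htw).congr (ae_of_all _ fun t => ?_)
    simp only [Pi.mul_apply]
    ring
  · intro R hR
    exact mul_prim_sq (fun t _ => hasDerivAt_th t) (continuous_sech.pow 2).continuousOn
      (LocInt.of_memLp hz) w₀ hR

/-- The solutions of w' = (sech²/tanh) w are the multiples of tanh, so the integrating factor is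
1/tanh. -/
theorem prim_eq_zero_of_tanh (hz : LocInt z) (hw : w₀ = 0)
    (h : ∀ᵐ t ∂volume.restrict (Ioi 0), z t - sech t ^ 2 / th t * prim w₀ z t = 0) {R : ℝ}
    (hR : 0 ≤ R) : prim w₀ z R = 0 := by
  have h0 : ∀ t, 0 ≤ t → th t ≠ 0 := fun t ht => by have := half_le_th ht; linarith
  refine prim_eq_zero_of_ode (a := fun t => (th t)⁻¹) (a' := fun t => -sech t ^ 2 / th t ^ 2) hz
    (fun t ht => (hasDerivAt_th t).inv (h0 t ht)) ?_ (fun t ht => inv_ne_zero (h0 t ht)) hw ?_ hR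
  · exact (continuous_sech.pow 2).neg.continuousOn.div (continuous_th.pow 2).continuousOn
      fun t ht => pow_ne_zero 2 (h0 t ht)
  · filter_upwards [h, ae_restrict_mem measurableSet_Ioi] with t h1 ht
    have := h0 t (le_of_lt ht)
    rw [sub_eq_zero.1 h1]
    field_simp
    ring

theorem prim_eq_zero_of_sech (hz : LocInt z) (hw : w₀ = 0)
    (h : ∀ᵐ t ∂volume.restrict (Ioi 0), z t + th t * prim w₀ z t = 0) {R : ℝ}
    (hR : 0 ≤ R) : prim w₀ z R = 0 := by
  refine prim_eq_zero_of_ode (a := fun t => Real.cosh (t + T₀))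
    (a' := fun t => Real.sinh (t + T₀)) hz
    (fun t ht => (Real.hasDerivAt_cosh (t + T₀)).comp_add_const t T₀) (by fun_prop)
    (fun t ht => (Real.cosh_pos _).ne') hw ?_ hR
  filter_upwards [h] with t h1
  rw [eq_neg_of_add_eq_zero_left h1, th, Real.tanh_eq_sinh_div_cosh]
  have := Real.cosh_pos (t + T₀)
  field_simp
  ring

/-- The integrand is the derivative of tanh' · w, because tanh'' = -2 sech² tanh. What remains is
-tanh'(0) w₀. -/
theorem integral_jacobi_tanh (hz : MemLp z 2 (volume.restrict (Ioi 0)))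
    (hw : MemLp (fun t => sech t * prim w₀ z t) 2 (volume.restrict (Ioi 0))) :
    ∫ t in Ioi 0, (sech t ^ 2 * z t - 2 * sech t ^ 2 * (th t * prim w₀ z t)) = -(3 / 4) * w₀ := by
  have h1 := memLp_bdd_mul (C := 1) hz continuous_sech.continuousOn fun t _ => by
    rw [abs_of_pos (sech_pos t)]; exact sech_le_one t
  have h2 := memLp_bdd_mul (C := 1) hw continuous_th.continuousOn fun t _ => abs_th_le_one t
  have hF := integral_Ioi_eq_neg (F := fun t => sech t ^ 2 * prim w₀ z t)
    (F₀ := sech 0 ^ 2 * w₀)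
    (f := fun t => 2 * sech t * (-(th t * sech t)) * prim w₀ z t + sech t ^ 2 * z t) ?_ ?_ ?_
  · rw [sech_sq_zero] at hF
    rw [neg_mul, ← hF]
    exact integral_congr_ae (ae_of_all _ fun t => by ring)
  · refine ((memLp_sech.integrable_mul h1).sub
      ((memLp_sech.integrable_mul h2).const_mul 2)).congr (ae_of_all _ fun t => ?_)
    simp only [Pi.mul_apply, Pi.sub_apply]
    ring
  · refine (memLp_sech.integrable_mul hw).congr (ae_of_all _ fun t => ?_)
    simp only [Pi.mul_apply]
    ring
  · intro R hR
    refine mul_prim (a := fun t => sech t ^ 2) (fun t _ => ?_) ?_ (LocInt.of_memLp hz) w₀ hR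
    · simpa using! (hasDerivAt_sech t).pow 2
    · exact ((continuous_const.mul continuous_sech).mul
        (continuous_th.mul continuous_sech).neg).continuousOn

/-- The integrand is the derivative of sech' · w, because sech'' = sech - 2 sech³. What remains is
-sech'(0) w₀ = tanh(T₀) sech(0) w₀, the exact amount that the boundary term of the index form
cancels later. -/
theorem integral_jacobi_sech (hz : MemLp z 2 (volume.restrict (Ioi 0)))
    (hw : MemLp (prim w₀ z) 2 (volume.restrict (Ioi 0))) :
    ∫ t in Ioi 0, (-(th t * sech t) * z t + sech t * prim w₀ z t -
      2 * sech t ^ 2 * (sech t * prim w₀ z t)) = 1 / 2 * (sech 0 * w₀) := by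
  have h1 := memLp_bdd_mul (C := 1) hz continuous_th.continuousOn fun t _ => abs_th_le_one t
  have h2 := memLp_bdd_mul (C := 1) hw continuous_th.continuousOn fun t _ => abs_th_le_one t
  have hs1 : ∀ t, |sech t ^ 2| ≤ 1 := fun t => by
    rw [abs_of_nonneg (sq_nonneg _)]
    nlinarith [sech_pos t, sech_le_one t]
  have h3 := memLp_bdd_mul (C := 1) hw (continuous_sech.pow 2).continuousOn fun t _ => hs1 t
  have hF := integral_Ioi_eq_neg (F := fun t => th t * sech t * prim w₀ z t)
    (F₀ := th 0 * sech 0 * w₀)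
    (f := fun t => (sech t ^ 2 * sech t + th t * -(th t * sech t)) * prim w₀ z t +
      th t * sech t * z t) ?_ ?_ ?_
  · rw [th_zero] at hF
    rw [← mul_assoc, ← neg_neg (1 / 2 * sech 0 * w₀), ← hF, ← integral_neg]
    exact integral_congr_ae (ae_of_all _ fun t => by
      linear_combination -sech t * prim w₀ z t * th_sq t)
  · refine (((memLp_sech.integrable_mul h3).const_mul 2).sub (memLp_sech.integrable_mul hw)).add
      (memLp_sech.integrable_mul h1) |>.congr (ae_of_all _ fun t => ?_)
    simp only [Pi.mul_apply, Pi.sub_apply, Pi.add_apply, Pi.pow_apply]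
    linear_combination sech t * prim w₀ z t * th_sq t
  · refine (memLp_sech.integrable_mul h2).congr (ae_of_all _ fun t => ?_)
    simp only [Pi.mul_apply]
    ring
  · intro R hR
    refine mul_prim (a := fun t => th t * sech t) (fun t _ => ?_) ?_ (LocInt.of_memLp hz) w₀ hR
    · exact (hasDerivAt_th t).mul (hasDerivAt_sech t)
    · exact (((continuous_sech.pow 2).mul continuous_sech).add
        (continuous_th.mul (continuous_th.mul continuous_sech).neg)).continuousOn

end Identities

/-! ### Fourier analysis with a real trigonometric system. -/

/-- The real trigonometric system `cos (k θ) + sin (k θ)`, `k ∈ ℤ`. -/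
def cas (k : ℤ) (θ : ℝ) : ℝ := Real.cos (k * θ) + Real.sin (k * θ)

/-- Trigonometric coefficient of a function on the circle. -/
def coef (g : ℝ → ℝ) (k : ℤ) : ℝ := ∫ θ, g θ * cas k θ ∂Face.cparam

/-- Trigonometric coefficients in the second variable. -/
def mode (f : ℝ × ℝ → ℝ) (k : ℤ) (t : ℝ) : ℝ := coef (fun θ => f (t, θ)) k

instance : IsFiniteMeasure Face.cparam := by unfold Face.cparam; infer_instance

theorem contDiff_cas (k : ℤ) : ContDiff ℝ ∞ (cas k) := by unfold cas; fun_prop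

theorem abs_cas_le (k : ℤ) (θ : ℝ) : |cas k θ| ≤ 2 :=
  (abs_add_le _ _).trans (by linarith [Real.abs_cos_le_one (k * θ), Real.abs_sin_le_one (k * θ)])

theorem cas_zero (θ : ℝ) : cas 0 θ = 1 := by simp [cas]

theorem cas_periodic (k : ℤ) (θ : ℝ) : cas k (θ + 2 * Real.pi) = cas k θ := by
  have h : (k : ℝ) * (θ + 2 * Real.pi) = k * θ + k * (2 * Real.pi) := by ring
  rw [cas, cas, h, Real.cos_add_int_mul_two_pi, Real.sin_add_int_mul_two_pi]

/-- Differentiation reflects the frequency. This is the price of a single real family indexed by ℤ,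
and the reason why the angular derivative is always read at `-k`. -/
theorem hasDerivAt_cas (k : ℤ) (θ : ℝ) : HasDerivAt (cas k) (k * cas (-k) θ) θ := by
  have h1 : HasDerivAt (fun θ : ℝ => (k : ℝ) * θ) k θ := by
    simpa using (hasDerivAt_id θ).const_mul (k : ℝ)
  convert! h1.cos.add h1.sin using 1
  simp only [cas, Int.cast_neg, neg_mul, Real.cos_neg, Real.sin_neg]
  ring

theorem memLp_cas_mul {g : ℝ → ℝ} {p : ℝ≥0∞} (hg : MemLp g p Face.cparam) (k : ℤ) :
    MemLp (fun θ => g θ * cas k θ) p Face.cparam := by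
  refine MemLp.of_le_mul (c := 2) hg (hg.aestronglyMeasurable.mul
    (contDiff_cas k).continuous.aestronglyMeasurable) (ae_of_all _ fun θ => ?_)
  rw [norm_mul, mul_comm]
  exact mul_le_mul_of_nonneg_right (abs_cas_le k θ) (norm_nonneg _)

theorem fourierCoeffOn_two_pi {g : ℝ → ℝ} (hg : Integrable g Face.cparam) (k : ℤ) :
    fourierCoeffOn (f := fun θ => (g θ : ℂ)) Real.two_pi_pos k =
      ((2 * Real.pi)⁻¹ : ℝ) * (((∫ θ, g θ * Real.cos (k * θ) ∂Face.cparam : ℝ) : ℂ) -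
        ((∫ θ, g θ * Real.sin (k * θ) ∂Face.cparam : ℝ) : ℂ) * Complex.I) := by
  rw [fourierCoeffOn_eq_integral, intervalIntegral.integral_of_le Real.two_pi_pos.le]
  have h : ∀ θ : ℝ, fourier (-k) (θ : AddCircle (2 * Real.pi - 0)) • (g θ : ℂ) =
      ((g θ * Real.cos (k * θ) : ℝ) : ℂ) - ((g θ * Real.sin (k * θ) : ℝ) : ℂ) * Complex.I := by
    intro θ
    rw [fourier_coe_apply, smul_eq_mul]
    have e : 2 * (Real.pi : ℂ) * Complex.I * ((-k : ℤ) : ℂ) * θ / ((2 * Real.pi - 0 : ℝ) : ℂ) =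
        ((-(k * θ) : ℝ) : ℂ) * Complex.I := by
      have : (Real.pi : ℂ) ≠ 0 := by exact_mod_cast Real.pi_ne_zero
      push_cast
      field_simp
      ring
    rw [e, Complex.exp_mul_I, ← Complex.ofReal_cos, ← Complex.ofReal_sin, Real.cos_neg,
      Real.sin_neg]
    push_cast
    ring
  simp_rw [h]
  have ic : Integrable (fun θ => g θ * Real.cos (k * θ)) Face.cparam :=
    hg.mul_bdd (c := 1) (by fun_prop) (ae_of_all _ fun θ => Real.abs_cos_le_one _)
  have is : Integrable (fun θ => g θ * Real.sin (k * θ)) Face.cparam :=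
    hg.mul_bdd (c := 1) (by fun_prop) (ae_of_all _ fun θ => Real.abs_sin_le_one _)
  rw [integral_sub (Integrable.ofReal ic) ((Integrable.ofReal is).mul_const _),
    integral_mul_const, integral_complex_ofReal, integral_complex_ofReal]
  rw [Complex.real_smul]
  simp [Face.cparam]

/-- Parseval's identity for the system `cas`. -/
theorem hasSum_coef_sq {g : ℝ → ℝ} (hg : MemLp g 2 Face.cparam) :
    HasSum (fun k => coef g k ^ 2) (2 * Real.pi * ∫ θ, g θ ^ 2 ∂Face.cparam) := by
  have hgi : Integrable g Face.cparam := hg.integrable (by norm_num)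
  have h := hasSum_sq_fourierCoeffOn Real.two_pi_pos (f := fun θ => (g θ : ℂ)) hg.ofReal
  set C : ℤ → ℝ := fun k => ∫ θ, g θ * Real.cos (k * θ) ∂Face.cparam with hC
  set S : ℤ → ℝ := fun k => ∫ θ, g θ * Real.sin (k * θ) ∂Face.cparam with hS
  have e1 : ∀ k, ‖fourierCoeffOn (f := fun θ => (g θ : ℂ)) Real.two_pi_pos k‖ ^ 2 =
      ((2 * Real.pi)⁻¹) ^ 2 * (C k ^ 2 + S k ^ 2) := fun k => by
    rw [fourierCoeffOn_two_pi hgi, norm_mul, mul_pow, Complex.norm_real, Real.norm_eq_abs, sq_abs,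
      sub_eq_add_neg, ← neg_mul, ← Complex.ofReal_neg, Complex.sq_norm, Complex.normSq_add_mul_I,
      neg_sq]
  simp_rw [e1] at h
  have hπ := Real.two_pi_pos
  have h1 : HasSum (fun k => C k ^ 2 + S k ^ 2) (2 * Real.pi * ∫ θ, g θ ^ 2 ∂Face.cparam) := by
    convert! h.mul_left ((2 * Real.pi) ^ 2) using 1
    · funext k; field_simp
    · rw [intervalIntegral.integral_of_le hπ.le]
      simp only [sub_zero, smul_eq_mul, Complex.norm_real, Real.norm_eq_abs, sq_abs, Face.cparam]
      field_simp
  -- The coefficient for `cas` is C + S, and (C + S)² = (C² + S²) + 2CS. The cross term is odd in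
  -- `k`, so it sums to zero over ℤ, and the complex Parseval identity supplies the rest.
  have hodd : HasSum (fun k => 2 * (C k * S k)) 0 := by
    have hs : Summable (fun k => 2 * (C k * S k)) :=
      Summable.of_norm_bounded h1.summable fun k => by
        rw [Real.norm_eq_abs, abs_le]
        constructor <;> nlinarith [sq_nonneg (C k + S k), sq_nonneg (C k - S k)]
    have h2 := (Equiv.neg ℤ).hasSum_iff.2 hs.hasSum
    have h3 : (fun k => 2 * (C k * S k)) ∘ (Equiv.neg ℤ) = fun k => -(2 * (C k * S k)) := by
      funext k
      simp only [hC, hS, Function.comp, Equiv.neg_apply, Int.cast_neg, neg_mul, Real.cos_neg,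
        Real.sin_neg, mul_neg, integral_neg]
    rw [h3] at h2
    have h4 := h2.unique hs.hasSum.neg
    have : ∑' k, 2 * (C k * S k) = 0 := by linarith
    rw [← this]
    exact hs.hasSum
  convert! h1.add hodd using 1
  · funext k
    have : coef g k = C k + S k := by
      simp only [coef, cas, mul_add, hC, hS]
      exact integral_add (hgi.mul_bdd (c := 1) (by fun_prop) (ae_of_all _ fun θ =>
        Real.abs_cos_le_one _)) (hgi.mul_bdd (c := 1) (by fun_prop) (ae_of_all _ fun θ =>
        Real.abs_sin_le_one _))
    rw [this]
    ring
  · ring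

theorem memLp_two_iff {α : Type*} {m : MeasurableSpace α} {μ : Measure α} {f : α → ℝ}
    (hf : AEStronglyMeasurable f μ) : MemLp f 2 μ ↔ Integrable (fun x => f x ^ 2) μ :=
  memLp_two_iff_integrable_sq hf

theorem aestronglyMeasurable_mode {ν : Measure ℝ} {f : ℝ × ℝ → ℝ}
    (hf : AEStronglyMeasurable f (ν.prod Face.cparam)) (k : ℤ) :
    AEStronglyMeasurable (mode f k) ν := by
  have : AEStronglyMeasurable (fun p : ℝ × ℝ => f p * cas k p.2) (ν.prod Face.cparam) :=
    hf.mul ((contDiff_cas k).continuous.comp continuous_snd).aestronglyMeasurable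
  exact this.integral_prod_right'

section Mode

variable {ν : Measure ℝ} [SFinite ν] {f : ℝ × ℝ → ℝ}

theorem ae_memLp_slice (hf : MemLp f 2 (ν.prod Face.cparam)) :
    ∀ᵐ t ∂ν, MemLp (fun θ => f (t, θ)) 2 Face.cparam := by
  filter_upwards [hf.integrable_sq.prod_right_ae, hf.aestronglyMeasurable.prodMk_left] with t h1 h2
  exact (memLp_two_iff h2).2 h1

theorem ae_mode_sq_le (hf : MemLp f 2 (ν.prod Face.cparam)) (k : ℤ) :
    ∀ᵐ t ∂ν, mode f k t ^ 2 ≤ 2 * Real.pi * ∫ θ, f (t, θ) ^ 2 ∂Face.cparam := by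
  filter_upwards [ae_memLp_slice hf] with t ht
  exact le_hasSum (hasSum_coef_sq ht) k fun j _ => sq_nonneg _

theorem memLp_mode (hf : MemLp f 2 (ν.prod Face.cparam)) (k : ℤ) : MemLp (mode f k) 2 ν := by
  refine (memLp_two_iff (aestronglyMeasurable_mode hf.aestronglyMeasurable k)).2 ?_
  refine Integrable.mono' (hf.integrable_sq.integral_prod_left.const_mul (2 * Real.pi))
    ((aestronglyMeasurable_mode hf.aestronglyMeasurable k).pow 2) ?_
  filter_upwards [ae_mode_sq_le hf k] with t ht
  rwa [Real.norm_of_nonneg (sq_nonneg _)]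

/-- Parseval's identity on a product. -/
theorem hasSum_mode_sq (hf : MemLp f 2 (ν.prod Face.cparam)) :
    HasSum (fun k => ∫ t, mode f k t ^ 2 ∂ν)
      (2 * Real.pi * ∫ p, f p ^ 2 ∂(ν.prod Face.cparam)) := by
  have h1 : ∀ᵐ t ∂ν, HasSum (fun k => mode f k t ^ 2)
      (2 * Real.pi * ∫ θ, f (t, θ) ^ 2 ∂Face.cparam) := by
    filter_upwards [ae_memLp_slice hf] with t ht
    exact hasSum_coef_sq ht
  rw [integral_prod _ hf.integrable_sq, ← integral_const_mul]
  -- The terms are nonnegative, so each serves as its own bound. The sum of these bounds is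
  -- integrable by Parseval on almost every circle.
  refine hasSum_integral_of_dominated_convergence (fun k t => mode f k t ^ 2)
    (fun k => (aestronglyMeasurable_mode hf.aestronglyMeasurable k).pow 2)
    (fun k => ae_of_all _ fun t => (Real.norm_of_nonneg (sq_nonneg _)).le) ?_ ?_ h1
  · filter_upwards [h1] with t ht using ht.summable
  · refine (hf.integrable_sq.integral_prod_left.const_mul (2 * Real.pi)).congr ?_
    filter_upwards [h1] with t ht using ht.tsum_eq.symm

theorem ae_eq_zero_of_mode (hf : MemLp f 2 (ν.prod Face.cparam))
    (h : ∀ k, ∀ᵐ t ∂ν, mode f k t = 0) : ∀ᵐ p ∂(ν.prod Face.cparam), f p = 0 := by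
  have h1 := hasSum_mode_sq hf
  have h2 : (fun k => ∫ t, mode f k t ^ 2 ∂ν) = fun _ => 0 := by
    funext k
    refine integral_eq_zero_of_ae ?_
    filter_upwards [h k] with t ht
    simp [ht]
  rw [h2] at h1
  have h3 := h1.unique hasSum_zero
  have h4 : ∫ p, f p ^ 2 ∂(ν.prod Face.cparam) = 0 := by
    have := Real.two_pi_pos
    rcases mul_eq_zero.1 h3 with h | h
    · linarith
    · exact h
  rw [integral_eq_zero_iff_of_nonneg (fun _ => sq_nonneg _) hf.integrable_sq] at h4
  filter_upwards [h4] with p hp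
  simpa using hp

theorem ae_eq_zero_of_coef {g : ℝ → ℝ} (hg : MemLp g 2 Face.cparam) (h : ∀ k, coef g k = 0) :
    ∀ᵐ θ ∂Face.cparam, g θ = 0 := by
  have h1 := hasSum_coef_sq hg
  have h2 : (fun k => coef g k ^ 2) = fun _ => 0 := funext fun k => by simp [h k]
  rw [h2] at h1
  have h3 := h1.unique hasSum_zero
  have h4 : ∫ θ, g θ ^ 2 ∂Face.cparam = 0 := by
    have := Real.two_pi_pos
    rcases mul_eq_zero.1 h3 with h | h
    · linarith
    · exact h
  rw [integral_eq_zero_iff_of_nonneg (fun _ => sq_nonneg _) hg.integrable_sq] at h4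
  filter_upwards [h4] with p hp
  simpa using hp

/-- Fubini for a product of a function of `t` and a trigonometric function. -/
theorem integral_mul_cas (a : ℝ → ℝ) (k : ℤ)
    (h : Integrable (fun p : ℝ × ℝ => f p * (a p.1 * cas k p.2)) (ν.prod Face.cparam)) :
    ∫ p, f p * (a p.1 * cas k p.2) ∂(ν.prod Face.cparam) = ∫ t, a t * mode f k t ∂ν := by
  rw [integral_prod _ h]
  congr 1
  funext t
  rw [mode, coef, ← integral_const_mul]
  congr 1
  funext θ
  ring

end Mode

/-! ### Functions on the half-cylinder and their modes. -/

/-- The flat half-cylinder `(0, ∞) × S¹`. -/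
def cylinder : Measure (ℝ × ℝ) := (volume.restrict (Ioi 0)).prod Face.cparam

/-- `u` is a function on the half-cylinder with derivatives `p` and `q` and trace `g`, tested against
products of functions of `t` and trigonometric functions. -/
structure CylSobolev (u p q : ℝ × ℝ → ℝ) (g : ℝ → ℝ) : Prop where
  memU : MemLp (fun x => sech x.1 * u x) 2 cylinder
  memP : MemLp p 2 cylinder
  memQ : MemLp q 2 cylinder
  memG : MemLp g 2 Face.cparam
  weakT : ∀ (k : ℤ) (η : ℝ → ℝ), ContDiff ℝ ∞ η → HasCompactSupport η →
    ∫ x, u x * (deriv η x.1 * cas k x.2) ∂cylinder =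
      -(∫ x, p x * (η x.1 * cas k x.2) ∂cylinder) - ∫ θ, g θ * (η 0 * cas k θ) ∂Face.cparam
  weakθ : ∀ (k : ℤ) (η : ℝ → ℝ), ContDiff ℝ ∞ η → HasCompactSupport η →
    ∫ x, u x * (η x.1 * (k * cas (-k) x.2)) ∂cylinder =
      -(∫ x, q x * (η x.1 * cas k x.2) ∂cylinder)

theorem memLp_mul_snd {ν : Measure ℝ} [SFinite ν] {a b : ℝ → ℝ} (ha : MemLp a 2 ν)
    (hb : MemLp b 2 Face.cparam) :
    MemLp (fun x : ℝ × ℝ => a x.1 * b x.2) 2 (ν.prod Face.cparam) := by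
  refine (memLp_two_iff (ha.aestronglyMeasurable.comp_fst.mul
    hb.aestronglyMeasurable.comp_snd)).2 ?_
  refine (ha.integrable_sq.mul_prod hb.integrable_sq).congr (ae_of_all _ fun x => ?_)
  simp only [Pi.mul_apply]
  ring

theorem memLp_cas (k : ℤ) : MemLp (cas k) 2 Face.cparam :=
  MemLp.of_bound (contDiff_cas k).continuous.aestronglyMeasurable 2
    (ae_of_all _ fun θ => abs_cas_le k θ)

theorem memLp_of_hasCompactSupport {a : ℝ → ℝ} (h : Continuous a) (hs : HasCompactSupport a)
    (s : Set ℝ) : MemLp a 2 (volume.restrict s) :=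
  (h.memLp_of_hasCompactSupport hs).restrict s

namespace CylSobolev

variable {u p q : ℝ × ℝ → ℝ} {g : ℝ → ℝ} (h : CylSobolev u p q g)
include h

theorem integrable_u {a : ℝ → ℝ} (ha : Continuous a) (hs : HasCompactSupport a) (k : ℤ) :
    Integrable (fun x => u x * (a x.1 * cas k x.2)) cylinder := by
  -- Only sech · u is known to be square integrable. The compact support of `a` absorbs the
  -- compensating cosh.
  have h1 : MemLp (fun t => Real.cosh (t + T₀) * a t) 2 (volume.restrict (Ioi 0)) :=
    memLp_of_hasCompactSupport (by fun_prop) hs.mul_left _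
  refine (h.memU.integrable_mul (memLp_mul_snd h1 (memLp_cas k))).congr (ae_of_all _ fun x => ?_)
  simp only [Pi.mul_apply, sech]
  have := Real.cosh_pos (x.1 + T₀)
  field_simp

theorem integrable_p {a : ℝ → ℝ} (ha : Continuous a) (hs : HasCompactSupport a) (k : ℤ) :
    Integrable (fun x => p x * (a x.1 * cas k x.2)) cylinder :=
  h.memP.integrable_mul (memLp_mul_snd (memLp_of_hasCompactSupport ha hs _) (memLp_cas k))

theorem integrable_q {a : ℝ → ℝ} (ha : Continuous a) (hs : HasCompactSupport a) (k : ℤ) :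
    Integrable (fun x => q x * (a x.1 * cas k x.2)) cylinder :=
  h.memQ.integrable_mul (memLp_mul_snd (memLp_of_hasCompactSupport ha hs _) (memLp_cas k))

theorem memLp_sech_mode (k : ℤ) :
    MemLp (fun t => sech t * mode u k t) 2 (volume.restrict (Ioi 0)) := by
  refine (memLp_mode h.memU k).ae_eq (ae_of_all _ fun t => ?_)
  simp only [mode, coef]
  rw [← integral_const_mul]
  congr 1
  funext θ
  ring

theorem locInt_mode_u (k : ℤ) : LocInt (mode u k) := by
  have h1 := (LocInt.of_memLp (h.memLp_sech_mode k)).continuousOn_mul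
    (a := fun t => Real.cosh (t + T₀)) (by fun_prop)
  refine fun R hR => (h1 R hR).congr fun t _ => ?_
  simp only [sech]
  have := Real.cosh_pos (t + T₀)
  field_simp

theorem locInt_mode_p (k : ℤ) : LocInt (mode p k) := LocInt.of_memLp (memLp_mode h.memP k)

/-- Testing with η(t) cas k(θ) turns the weak `t`-derivative and the trace into a one-dimensional
weak derivative with an initial value. -/
theorem ae_mode_u (k : ℤ) :
    ∀ᵐ t ∂volume.restrict (Ioi 0), mode u k t = prim (coef g k) (mode p k) t := by
  refine ae_eq_prim_of_weak (h.locInt_mode_u k) (h.locInt_mode_p k) fun η hη hs => ?_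
  have h1 := h.weakT k η hη hs
  have hd : Continuous (deriv η) := hη.continuous_deriv (by simp)
  have e1 := integral_mul_cas (ν := volume.restrict (Ioi 0)) (deriv η) k
    (h.integrable_u hd hs.deriv k)
  have e2 := integral_mul_cas (ν := volume.restrict (Ioi 0)) η k
    (h.integrable_p hη.continuous hs k)
  have e3 : ∫ θ, g θ * (η 0 * cas k θ) ∂Face.cparam = coef g k * η 0 := by
    rw [coef, ← integral_mul_const]
    congr 1; funext θ; ring
  rw [cylinder] at h1
  rw [e1, e2, e3] at h1
  simp_rw [mul_comm (mode _ k _)]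
  exact h1

/-- Testing with η(t) cas k(θ) moves the angular derivative onto `cas k`, which becomes k times `cas
(-k)`. The fundamental lemma in `t` does the rest. -/
theorem ae_mode_q (k : ℤ) :
    ∀ᵐ t ∂volume.restrict (Ioi 0), mode q k t = -k * mode u (-k) t := by
  have hq := LocInt.of_memLp (memLp_mode h.memQ k)
  have hu : LocInt fun t => (k : ℝ) * mode u (-k) t :=
    (h.locInt_mode_u (-k)).continuousOn_mul continuousOn_const
  have hl := hq.add hu
  rw [ae_restrict_iff' measurableSet_Ioi]
  suffices hh : ∀ᵐ t, t ∈ Ioi (0 : ℝ) → mode q k t + k * mode u (-k) t = 0 by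
    filter_upwards [hh] with t h1 h2
    linarith [h1 h2]
  refine isOpen_Ioi.ae_eq_zero_of_integral_contDiff_smul_eq_zero ?_ fun η hη hs hsub => ?_
  · intro t ht
    refine ⟨Ioc 0 (t + 1), ?_, hl.integrableOn_Ioc _⟩
    rw [← Ioi_inter_Iic]
    exact Filter.inter_mem self_mem_nhdsWithin
      (mem_nhdsWithin_of_mem_nhds (Iic_mem_nhds (by linarith)))
  have h1 := h.weakθ k η hη hs
  have e0 : ∀ x : ℝ × ℝ, u x * (η x.1 * (k * cas (-k) x.2)) =
      u x * ((k * η x.1) * cas (-k) x.2) := fun x => by ring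
  simp_rw [e0] at h1
  have hk : HasCompactSupport fun t => (k : ℝ) * η t := hs.mul_left
  have i1 := h.integrable_u (a := fun t => k * η t) (continuous_const.mul hη.continuous) hk (-k)
  have i2 := h.integrable_q hη.continuous hs k
  have e1 := integral_mul_cas (ν := volume.restrict (Ioi 0)) (fun t => k * η t) (-k) i1
  have e2 := integral_mul_cas (ν := volume.restrict (Ioi 0)) η k i2
  rw [cylinder] at h1
  rw [e1, e2] at h1
  have h0 : ∀ t, t ∉ Ioi (0 : ℝ) → η t • (mode q k t + k * mode u (-k) t) = 0 := fun t ht => by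
    have : η t = 0 := by
      by_contra hne
      exact ht (hsub (subset_tsupport η hne))
    simp [this]
  rw [← setIntegral_eq_integral_of_forall_compl_eq_zero h0]
  have h3 : ∫ t in Ioi 0, η t • (mode q k t + k * mode u (-k) t) =
      ∫ t in Ioi 0, (η t * mode q k t + k * η t * mode u (-k) t) :=
    integral_congr_ae (ae_of_all _ fun t => by simp only [smul_eq_mul]; ring)
  rw [h3, integral_add, h1]
  · ring
  · exact (memLp_of_hasCompactSupport hη.continuous hs _).integrable_mul (memLp_mode h.memQ k)
  · have h4 : MemLp (fun t => Real.cosh (t + T₀) * (k * η t)) 2 (volume.restrict (Ioi 0)) :=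
      memLp_of_hasCompactSupport
        ((Real.continuous_cosh.comp (by fun_prop)).mul (continuous_const.mul hη.continuous))
        hk.mul_left _
    refine ((h.memLp_sech_mode (-k)).integrable_mul h4).congr (ae_of_all _ fun t => ?_)
    simp only [Pi.mul_apply, sech]
    have := Real.cosh_pos (t + T₀)
    field_simp

theorem memLp_sech_prim (k : ℤ) :
    MemLp (fun t => sech t * prim (coef g k) (mode p k) t) 2 (volume.restrict (Ioi 0)) :=
  (h.memLp_sech_mode k).ae_eq (by
    filter_upwards [h.ae_mode_u k] with t ht
    rw [ht])

/-- For nonzero frequency the angular derivative controls the mode itself, after division by `k`.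
For frequency zero only the sech-weighted bound is available; tanh is an example. -/
theorem memLp_prim {k : ℤ} (hk : k ≠ 0) :
    MemLp (prim (coef g k) (mode p k)) 2 (volume.restrict (Ioi 0)) := by
  refine ((memLp_mode h.memQ (-k)).const_mul (k : ℝ)⁻¹).ae_eq ?_
  filter_upwards [h.ae_mode_u k, h.ae_mode_q (-k)] with t h1 h2
  have hk' : (k : ℝ) ≠ 0 := by exact_mod_cast hk
  rw [h2, neg_neg, h1, Int.cast_neg, neg_neg]
  field_simp

end CylSobolev

/-! ### Energy of a single mode. -/

/-- The index form of a catenoidal end in the flat coordinates. -/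
def cylEnergy (u p q : ℝ × ℝ → ℝ) (g : ℝ → ℝ) : ℝ :=
  (∫ x, p x ^ 2 ∂cylinder) + (∫ x, q x ^ 2 ∂cylinder) -
    2 * (∫ x, (sech x.1 * u x) ^ 2 ∂cylinder) - 1 / 2 * ∫ θ, g θ ^ 2 ∂Face.cparam

/-- The index form of the `k`-th mode on a catenoidal end. -/
def modeEnergy (k : ℤ) (w₀ : ℝ) (z : ℝ → ℝ) : ℝ :=
  (∫ t in Ioi 0, z t ^ 2) + k ^ 2 * (∫ t in Ioi 0, prim w₀ z t ^ 2) -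
    2 * (∫ t in Ioi 0, (sech t * prim w₀ z t) ^ 2) - 1 / 2 * w₀ ^ 2

/-- Parseval is applied to each of the four terms. The sum for the angular derivative is first
reindexed by k ↦ -k, so that it contributes k² w² to the mode `k`. -/
theorem CylSobolev.hasSum_modeEnergy {u p q : ℝ × ℝ → ℝ} {g : ℝ → ℝ} (h : CylSobolev u p q g) :
    HasSum (fun k => modeEnergy k (coef g k) (mode p k)) (2 * Real.pi * cylEnergy u p q g) := by
  have h1 := hasSum_mode_sq h.memP
  have h2 := (Equiv.neg ℤ).hasSum_iff.2 (hasSum_mode_sq h.memQ)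
  have h3 := hasSum_mode_sq h.memU
  have h4 := hasSum_coef_sq h.memG
  convert! ((h1.add h2).sub (h3.mul_left 2)).sub (h4.mul_left (1 / 2)) using 1
  · funext k
    have e2 : ∫ t in Ioi 0, mode q (-k) t ^ 2 =
        k ^ 2 * ∫ t in Ioi 0, prim (coef g k) (mode p k) t ^ 2 := by
      rw [← integral_const_mul]
      refine integral_congr_ae ?_
      filter_upwards [h.ae_mode_u k, h.ae_mode_q (-k)] with t h1 h2
      rw [h2, neg_neg, h1]
      push_cast
      ring
    have e3 : ∫ t in Ioi 0, mode (fun x => sech x.1 * u x) k t ^ 2 =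
        ∫ t in Ioi 0, (sech t * prim (coef g k) (mode p k) t) ^ 2 := by
      refine integral_congr_ae ?_
      filter_upwards [h.ae_mode_u k] with t h1
      rw [← h1, mode, mode, coef, coef, ← integral_const_mul]
      congr 2
      funext θ
      ring
    simp only [Function.comp, Equiv.neg_apply]
    rw [e2, e3, modeEnergy]
  · rw [cylEnergy, cylinder]
    ring

theorem integral_parallelogram {α : Type*} {m : MeasurableSpace α} {μ : Measure α} {f g : α → ℝ}
    (hf : MemLp f 2 μ) (hg : MemLp g 2 μ) :
    (∫ x, f x ^ 2 ∂μ) + ∫ x, g x ^ 2 ∂μ =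
      2 * (∫ x, ((f x + g x) / 2) ^ 2 ∂μ) + 2 * ∫ x, ((f x - g x) / 2) ^ 2 ∂μ := by
  have i1 : Integrable (fun x => ((f x + g x) / 2) ^ 2) μ := by
    refine ((hf.add hg).integrable_sq.div_const 4).congr (ae_of_all _ fun x => ?_)
    simp only [Pi.add_apply]
    ring
  have i2 : Integrable (fun x => ((f x - g x) / 2) ^ 2) μ := by
    refine ((hf.sub hg).integrable_sq.div_const 4).congr (ae_of_all _ fun x => ?_)
    simp only [Pi.sub_apply]
    ring
  rw [← integral_const_mul, ← integral_const_mul, ← integral_add (i1.const_mul 2) (i2.const_mul 2),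
    ← integral_add hf.integrable_sq hg.integrable_sq]
  exact integral_congr_ae (ae_of_all _ fun x => by ring)

theorem prim_half_add {z y : ℝ → ℝ} (hz : LocInt z) (hy : LocInt y) (w v : ℝ) {R : ℝ}
    (hR : 0 ≤ R) :
    prim ((w + v) / 2) (fun t => (z t + y t) / 2) R = (prim w z R + prim v y R) / 2 := by
  simp only [prim, intervalIntegral.integral_div, intervalIntegral.integral_add (hz R hR) (hy R hR)]
  ring

theorem prim_half_sub {z y : ℝ → ℝ} (hz : LocInt z) (hy : LocInt y) (w v : ℝ) {R : ℝ}
    (hR : 0 ≤ R) :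
    prim ((w - v) / 2) (fun t => (z t - y t) / 2) R = (prim w z R - prim v y R) / 2 := by
  simp only [prim, intervalIntegral.integral_div, intervalIntegral.integral_sub (hz R hR) (hy R hR)]
  ring

/-- A mode of finite energy: initial value and derivative. -/
structure FiniteMode (k : ℤ) (w : ℝ) (z : ℝ → ℝ) : Prop where
  memZ : MemLp z 2 (volume.restrict (Ioi 0))
  memSech : MemLp (fun t => sech t * prim w z t) 2 (volume.restrict (Ioi 0))
  memPrim : k ≠ 0 → MemLp (prim w z) 2 (volume.restrict (Ioi 0))

theorem CylSobolev.finiteMode {u p q : ℝ × ℝ → ℝ} {g : ℝ → ℝ} (h : CylSobolev u p q g) (k : ℤ) :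
    FiniteMode k (coef g k) (mode p k) :=
  ⟨memLp_mode h.memP k, h.memLp_sech_prim k, fun hk => h.memLp_prim hk⟩

namespace FiniteMode

variable {k : ℤ} {w v : ℝ} {z y : ℝ → ℝ}

theorem locInt (h : FiniteMode k w z) : LocInt z := LocInt.of_memLp h.memZ

theorem halfAdd (h : FiniteMode k w z) (h' : FiniteMode k v y) :
    FiniteMode k ((w + v) / 2) (fun t => (z t + y t) / 2) where
  memZ := ((h.memZ.add h'.memZ).const_mul (1 / 2)).ae_eq
    (ae_of_all _ fun t => by simp only [Pi.add_apply]; ring)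
  memSech := ((h.memSech.add h'.memSech).const_mul (1 / 2)).ae_eq (by
    filter_upwards [ae_restrict_mem measurableSet_Ioi] with t ht
    rw [prim_half_add h.locInt h'.locInt w v (le_of_lt ht)]
    simp only [Pi.add_apply]; ring)
  memPrim hk := (((h.memPrim hk).add (h'.memPrim hk)).const_mul (1 / 2)).ae_eq (by
    filter_upwards [ae_restrict_mem measurableSet_Ioi] with t ht
    rw [prim_half_add h.locInt h'.locInt w v (le_of_lt ht)]
    simp only [Pi.add_apply]; ring)

theorem halfSub (h : FiniteMode k w z) (h' : FiniteMode k v y) :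
    FiniteMode k ((w - v) / 2) (fun t => (z t - y t) / 2) where
  memZ := ((h.memZ.sub h'.memZ).const_mul (1 / 2)).ae_eq
    (ae_of_all _ fun t => by simp only [Pi.sub_apply]; ring)
  memSech := ((h.memSech.sub h'.memSech).const_mul (1 / 2)).ae_eq (by
    filter_upwards [ae_restrict_mem measurableSet_Ioi] with t ht
    rw [prim_half_sub h.locInt h'.locInt w v (le_of_lt ht)]
    simp only [Pi.sub_apply]; ring)
  memPrim hk := (((h.memPrim hk).sub (h'.memPrim hk)).const_mul (1 / 2)).ae_eq (by
    filter_upwards [ae_restrict_mem measurableSet_Ioi] with t ht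
    rw [prim_half_sub h.locInt h'.locInt w v (le_of_lt ht)]
    simp only [Pi.sub_apply]; ring)

/-- Splitting of the energy into the parts symmetric and antisymmetric under the reflection. -/
theorem energy_add (h : FiniteMode k w z) (h' : FiniteMode k v y) :
    modeEnergy k w z + modeEnergy k v y =
      2 * modeEnergy k ((w + v) / 2) (fun t => (z t + y t) / 2) +
        2 * modeEnergy k ((w - v) / 2) (fun t => (z t - y t) / 2) := by
  have e1 := integral_parallelogram h.memZ h'.memZ
  have e2 := integral_parallelogram h.memSech h'.memSech
  have e3 : (k : ℝ) ^ 2 * ((∫ t in Ioi 0, prim w z t ^ 2) + ∫ t in Ioi 0, prim v y t ^ 2) =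
      k ^ 2 * (2 * (∫ t in Ioi 0, ((prim w z t + prim v y t) / 2) ^ 2) +
        2 * ∫ t in Ioi 0, ((prim w z t - prim v y t) / 2) ^ 2) := by
    -- For k = 0 the primitives need not be square integrable, but the factor k² removes the term.
    rcases eq_or_ne k 0 with hk | hk
    · simp [hk]
    · rw [integral_parallelogram (h.memPrim hk) (h'.memPrim hk)]
  have a1 : ∀ t ∈ Ioi (0 : ℝ), prim ((w + v) / 2) (fun t => (z t + y t) / 2) t =
      (prim w z t + prim v y t) / 2 := fun t ht =>
    prim_half_add h.locInt h'.locInt w v (le_of_lt ht)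
  have a2 : ∀ t ∈ Ioi (0 : ℝ), prim ((w - v) / 2) (fun t => (z t - y t) / 2) t =
      (prim w z t - prim v y t) / 2 := fun t ht =>
    prim_half_sub h.locInt h'.locInt w v (le_of_lt ht)
  have b1 : ∫ t in Ioi 0, prim ((w + v) / 2) (fun t => (z t + y t) / 2) t ^ 2 =
      ∫ t in Ioi 0, ((prim w z t + prim v y t) / 2) ^ 2 :=
    setIntegral_congr_fun measurableSet_Ioi fun t ht => by simp only [a1 t ht]
  have b2 : ∫ t in Ioi 0, prim ((w - v) / 2) (fun t => (z t - y t) / 2) t ^ 2 =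
      ∫ t in Ioi 0, ((prim w z t - prim v y t) / 2) ^ 2 :=
    setIntegral_congr_fun measurableSet_Ioi fun t ht => by simp only [a2 t ht]
  have c1 : ∫ t in Ioi 0, (sech t * prim ((w + v) / 2) (fun t => (z t + y t) / 2) t) ^ 2 =
      ∫ t in Ioi 0, ((sech t * prim w z t + sech t * prim v y t) / 2) ^ 2 :=
    setIntegral_congr_fun measurableSet_Ioi fun t ht => by simp only [a1 t ht]; ring
  have c2 : ∫ t in Ioi 0, (sech t * prim ((w - v) / 2) (fun t => (z t - y t) / 2) t) ^ 2 =
      ∫ t in Ioi 0, ((sech t * prim w z t - sech t * prim v y t) / 2) ^ 2 :=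
    setIntegral_congr_fun measurableSet_Ioi fun t ht => by simp only [a2 t ht]; ring
  simp only [modeEnergy]
  rw [b1, b2, c1, c2]
  linear_combination e1 + e3 - 2 * e2

/-- With the boundary term of the disk, the symmetric modes are stable. -/
theorem energy_sym (h : FiniteMode k w z) :
    modeEnergy k w z + 2 * w ^ 2 =
      (∫ t in Ioi 0, (z t - sech t ^ 2 / th t * prim w z t) ^ 2) +
        k ^ 2 * ∫ t in Ioi 0, prim w z t ^ 2 := by
  have := (integral_square_tanh h.memZ h.memSech).2
  rw [modeEnergy]
  linarith

theorem energy_sech (h : FiniteMode k w z) (hk : k ≠ 0) :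
    modeEnergy k w z = (∫ t in Ioi 0, (z t + th t * prim w z t) ^ 2) +
        ((k : ℝ) ^ 2 - 1) * ∫ t in Ioi 0, prim w z t ^ 2 := by
  have := (integral_square_sech h.memZ (h.memPrim hk)).2
  rw [modeEnergy]
  linarith

theorem one_le_sq (hk : k ≠ 0) : (1 : ℝ) ≤ (k : ℝ) ^ 2 := by
  have : 1 ≤ k ^ 2 := by nlinarith [sq_abs k, Int.one_le_abs hk]
  exact_mod_cast this

theorem energy_sym_nonneg (h : FiniteMode k w z) : 0 ≤ modeEnergy k w z + 2 * w ^ 2 := by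
  rw [h.energy_sym]
  have h1 : 0 ≤ ∫ t in Ioi 0, prim w z t ^ 2 := integral_nonneg fun t => sq_nonneg _
  have h2 : 0 ≤ ∫ t in Ioi 0, (z t - sech t ^ 2 / th t * prim w z t) ^ 2 :=
    integral_nonneg fun t => sq_nonneg _
  positivity

/-- For k ≠ 0 the sech identity suffices, as k² ≥ 1. For k = 0 a zero initial value removes the
extra 2w² from the tanh identity. -/
theorem energy_nonneg (h : FiniteMode k w z) (h0 : k = 0 → w = 0) : 0 ≤ modeEnergy k w z := by
  rcases eq_or_ne k 0 with hk | hk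
  · have := h.energy_sym_nonneg
    rw [h0 hk] at this ⊢
    linarith
  · rw [h.energy_sech hk]
    have h1 : 0 ≤ ∫ t in Ioi 0, prim w z t ^ 2 := integral_nonneg fun t => sq_nonneg _
    have h2 : 0 ≤ ∫ t in Ioi 0, (z t + th t * prim w z t) ^ 2 :=
      integral_nonneg fun t => sq_nonneg _
    have h3 := one_le_sq hk
    have := mul_nonneg (sub_nonneg.2 h3) h1
    linarith

theorem ae_zero_of_integral_sq {f : ℝ → ℝ}
    (hf : Integrable (fun t => f t ^ 2) (volume.restrict (Ioi 0)))
    (h : ∫ t in Ioi 0, f t ^ 2 = 0) : ∀ᵐ t ∂volume.restrict (Ioi 0), f t = 0 := by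
  rw [integral_eq_zero_iff_of_nonneg (fun _ => sq_nonneg _) hf] at h
  filter_upwards [h] with t ht
  simpa using ht

/-- For k ≠ 0 the term k² ∫ w² already forces vanishing. For k = 0 the mode would be a multiple of
tanh, excluded by its initial value. -/
theorem eq_zero_of_energy_sym (h : FiniteMode k w z) (h0 : k = 0 → w = 0)
    (he : modeEnergy k w z + 2 * w ^ 2 = 0) :
    ∀ᵐ t ∂volume.restrict (Ioi 0), prim w z t = 0 := by
  rw [h.energy_sym] at he
  have h1 : 0 ≤ ∫ t in Ioi 0, prim w z t ^ 2 := integral_nonneg fun t => sq_nonneg _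
  have h2 : 0 ≤ ∫ t in Ioi 0, (z t - sech t ^ 2 / th t * prim w z t) ^ 2 :=
    integral_nonneg fun t => sq_nonneg _
  rcases eq_or_ne k 0 with hk | hk
  · have h3 : ∫ t in Ioi 0, (z t - sech t ^ 2 / th t * prim w z t) ^ 2 = 0 := by
      simpa [hk] using he
    have h4 := ae_zero_of_integral_sq (integral_square_tanh h.memZ h.memSech).1 h3
    filter_upwards [ae_restrict_mem measurableSet_Ioi] with t ht
    exact prim_eq_zero_of_tanh h.locInt (h0 hk) h4 (le_of_lt ht)
  · refine ae_zero_of_integral_sq (h.memPrim hk).integrable_sq ?_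
    nlinarith [one_le_sq hk]

/-- For |k| ≥ 2 the surplus (k² - 1) ∫ w² is decisive. For |k| = 1 it vanishes and the kernel
consists of multiples of sech, for k = 0 of multiples of tanh. Hence an initial condition is needed
exactly for |k| ≤ 1. -/
theorem eq_zero_of_energy (h : FiniteMode k w z) (h0 : |k| ≤ 1 → w = 0)
    (he : modeEnergy k w z = 0) :
    ∀ᵐ t ∂volume.restrict (Ioi 0), prim w z t = 0 := by
  rcases eq_or_ne k 0 with hk | hk
  · have hw := h0 (by simp [hk])
    exact h.eq_zero_of_energy_sym (fun _ => hw) (by rw [he, hw]; simp)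
  rw [h.energy_sech hk] at he
  have h1 : 0 ≤ ∫ t in Ioi 0, prim w z t ^ 2 := integral_nonneg fun t => sq_nonneg _
  have h2 : 0 ≤ ∫ t in Ioi 0, (z t + th t * prim w z t) ^ 2 :=
    integral_nonneg fun t => sq_nonneg _
  have h3 := mul_nonneg (sub_nonneg.2 (one_le_sq hk)) h1
  by_cases hk1 : |k| ≤ 1
  · have h4 := ae_zero_of_integral_sq (integral_square_sech h.memZ (h.memPrim hk)).1
      (by linarith)
    filter_upwards [ae_restrict_mem measurableSet_Ioi] with t ht
    exact prim_eq_zero_of_sech h.locInt (h0 hk1) h4 (le_of_lt ht)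
  · refine ae_zero_of_integral_sq (h.memPrim hk).integrable_sq ?_
    have h4 : (2 : ℤ) ≤ k ^ 2 := by nlinarith [sq_abs k]
    have h5 : (2 : ℝ) ≤ (k : ℝ) ^ 2 := by exact_mod_cast h4
    nlinarith

/-- With s₀ = (w + v)/2 one has (w + v)² = 2 · 2s₀², so the coupling term is precisely what the
symmetric part needs. The hypothesis at k = 0 gives the antisymmetric part zero initial value. -/
theorem pair_nonneg (h : FiniteMode k w z) (h' : FiniteMode k v y) (h0 : k = 0 → w = v) :
    0 ≤ (w + v) ^ 2 + modeEnergy k w z + modeEnergy k v y := by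
  have h1 := (h.halfAdd h').energy_sym_nonneg
  have h2 := (h.halfSub h').energy_nonneg fun hk => by rw [h0 hk]; ring
  have := h.energy_add h'
  linarith

theorem pair_eq_zero (h : FiniteMode k w z) (h' : FiniteMode k v y) (h0 : |k| ≤ 1 → w = v)
    (h0' : k = 0 → w + v = 0) (he : (w + v) ^ 2 + modeEnergy k w z + modeEnergy k v y = 0) :
    ∀ᵐ t ∂volume.restrict (Ioi 0), prim w z t = 0 ∧ prim v y t = 0 := by
  have h1 := (h.halfAdd h').energy_sym_nonneg
  have h2 := (h.halfSub h').energy_nonneg fun hk => by rw [h0 (by simp [hk])]; ring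
  have h3 := h.energy_add h'
  have h4 := (h.halfAdd h').eq_zero_of_energy_sym (fun hk => by rw [h0' hk]; ring) (by linarith)
  have h5 := (h.halfSub h').eq_zero_of_energy (fun hk => by rw [h0 hk]; ring) (by linarith)
  filter_upwards [h4, h5, ae_restrict_mem measurableSet_Ioi] with t h6 h7 ht
  rw [prim_half_add h.locInt h'.locInt w v (le_of_lt ht)] at h6
  rw [prim_half_sub h.locInt h'.locInt w v (le_of_lt ht)] at h7
  constructor <;> linarith

end FiniteMode

/-! ### Summation over all modes of the two ends. -/

namespace CylSobolev

variable {u p q u' p' q' : ℝ × ℝ → ℝ} {g g' : ℝ → ℝ}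

theorem coef_add (hg : MemLp g 2 Face.cparam) (hg' : MemLp g' 2 Face.cparam) (k : ℤ) :
    coef (fun θ => g θ + g' θ) k = coef g k + coef g' k := by
  simp only [coef, add_mul]
  exact integral_add ((memLp_cas_mul hg k).integrable (by norm_num))
    ((memLp_cas_mul hg' k).integrable (by norm_num))

theorem hasSum_pair (h : CylSobolev u p q g) (h' : CylSobolev u' p' q' g') :
    HasSum (fun k => (coef g k + coef g' k) ^ 2 + modeEnergy k (coef g k) (mode p k) +
        modeEnergy k (coef g' k) (mode p' k))
      (2 * Real.pi * ((∫ θ, (g θ + g' θ) ^ 2 ∂Face.cparam) + cylEnergy u p q g +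
        cylEnergy u' p' q' g')) := by
  have h1 := hasSum_coef_sq (h.memG.add h'.memG)
  have h2 : ∀ k, coef (g + g') k = coef g k + coef g' k := coef_add h.memG h'.memG
  simp only [h2] at h1
  convert! (h1.add h.hasSum_modeEnergy).add h'.hasSum_modeEnergy using 1
  simp only [Pi.add_apply]
  ring

/-- Stability of the two ends together with the boundary term of the disk on functions whose traces
have equal means. -/
theorem pair_nonneg (h : CylSobolev u p q g) (h' : CylSobolev u' p' q' g')
    (h0 : coef g 0 = coef g' 0) :
    0 ≤ (∫ θ, (g θ + g' θ) ^ 2 ∂Face.cparam) + cylEnergy u p q g + cylEnergy u' p' q' g' := by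
  have h1 := (h.hasSum_pair h').nonneg fun k =>
    (h.finiteMode k).pair_nonneg (h'.finiteMode k) fun hk => by rw [hk, h0]
  exact nonneg_of_mul_nonneg_right h1 Real.two_pi_pos

theorem ae_eq_zero_of_prim (h : CylSobolev u p q g)
    (h0 : ∀ k, ∀ᵐ t ∂volume.restrict (Ioi 0), prim (coef g k) (mode p k) t = 0) :
    ∀ᵐ x ∂cylinder, u x = 0 := by
  have h1 := ae_eq_zero_of_mode (ν := volume.restrict (Ioi 0)) h.memU fun k => by
    filter_upwards [h0 k, h.ae_mode_u k] with t h1 h2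
    rw [h1] at h2
    have : mode (fun x => sech x.1 * u x) k t = sech t * mode u k t := by
      simp only [mode, coef]
      rw [← integral_const_mul]
      congr 1
      funext θ
      ring
    rw [this, h2, mul_zero]
  filter_upwards [h1] with x hx
  exact (mul_eq_zero.1 hx).resolve_left (sech_pos _).ne'

theorem pair_eq_zero (h : CylSobolev u p q g) (h' : CylSobolev u' p' q' g')
    (h0 : ∀ k : ℤ, |k| ≤ 1 → coef g k = coef g' k) (h0' : coef g 0 + coef g' 0 = 0)
    (he : (∫ θ, (g θ + g' θ) ^ 2 ∂Face.cparam) + cylEnergy u p q g +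
      cylEnergy u' p' q' g' = 0) :
    (∀ᵐ x ∂cylinder, u x = 0) ∧ ∀ᵐ x ∂cylinder, u' x = 0 := by
  have hs := h.hasSum_pair h'
  rw [he, mul_zero] at hs
  -- A sum of nonnegative mode contributions that equals zero has only zero terms, so each frequency
  -- can be treated alone.
  have h1 := (hasSum_zero_iff_of_nonneg fun k =>
    (h.finiteMode k).pair_nonneg (h'.finiteMode k) fun hk => h0 k (by simp [hk])).1 hs
  have h2 : ∀ k, _ := fun k => (h.finiteMode k).pair_eq_zero (h'.finiteMode k) (h0 k)
    (fun hk => by rw [hk, h0']) (congrFun h1 k)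
  exact ⟨h.ae_eq_zero_of_prim fun k => (h2 k).mono fun _ ht => ht.1,
    h'.ae_eq_zero_of_prim fun k => (h2 k).mono fun _ ht => ht.2⟩

end CylSobolev

/-! ### Vector calculus in coordinates and the geometry of the catenoidal ends. -/

theorem hasDerivAt_vec {f g h : ℝ → ℝ} {f' g' h' t : ℝ} (c : ℝ) (hf : HasDerivAt f f' t)
    (hg : HasDerivAt g g' t) (hh : HasDerivAt h h' t) :
    HasDerivAt (fun s => (c • !₂[f s, g s, h s] : E3)) (c • !₂[f', g', h']) t := by
  have h1 : HasDerivAt (fun s => (![f s, g s, h s] : Fin 3 → ℝ)) ![f', g', h'] t := by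
    rw [hasDerivAt_pi]
    intro i
    fin_cases i <;> simpa
  have h2 := ((EuclideanSpace.equiv (Fin 3) ℝ).symm.hasFDerivAt
    (x := ![f t, g t, h t])).comp_hasDerivAt t h1
  exact h2.const_smul c

theorem inner_vec (a₁ a₂ a₃ b₁ b₂ b₃ : ℝ) :
    inner ℝ (!₂[a₁, a₂, a₃] : E3) !₂[b₁, b₂, b₃] = a₁ * b₁ + a₂ * b₂ + a₃ * b₃ := by
  simp [PiLp.inner_apply, Fin.sum_univ_three]
  ring

theorem inner_vec_right (V : E3) (b₁ b₂ b₃ : ℝ) :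
    inner ℝ V !₂[b₁, b₂, b₃] = V 0 * b₁ + V 1 * b₂ + V 2 * b₃ := by
  simp [PiLp.inner_apply, Fin.sum_univ_three]
  ring

theorem norm_vec (a₁ a₂ a₃ : ℝ) : ‖(!₂[a₁, a₂, a₃] : E3)‖ = Real.sqrt (a₁ ^ 2 + a₂ ^ 2 + a₃ ^ 2) := by
  rw [EuclideanSpace.norm_eq]
  simp [Fin.sum_univ_three]

theorem norm_vec_eq {a₁ a₂ a₃ r : ℝ} (hr : 0 ≤ r) (h : a₁ ^ 2 + a₂ ^ 2 + a₃ ^ 2 = r ^ 2) :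
    ‖(!₂[a₁, a₂, a₃] : E3)‖ = r := by
  rw [norm_vec, h, Real.sqrt_sq hr]

theorem smul_vec (c a₁ a₂ a₃ : ℝ) : c • (!₂[a₁, a₂, a₃] : E3) = !₂[c * a₁, c * a₂, c * a₃] := by
  ext i; fin_cases i <;> simp

theorem sub_vec (a₁ a₂ a₃ b₁ b₂ b₃ : ℝ) :
    (!₂[a₁, a₂, a₃] : E3) - !₂[b₁, b₂, b₃] = !₂[a₁ - b₁, a₂ - b₂, a₃ - b₃] := by
  ext i; fin_cases i <;> simp

theorem cross_vec (a₁ a₂ a₃ b₁ b₂ b₃ : ℝ) :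
    (WithLp.toLp 2 (crossProduct (WithLp.ofLp (!₂[a₁, a₂, a₃] : E3))
      (WithLp.ofLp (!₂[b₁, b₂, b₃] : E3))) : E3) =
      !₂[a₂ * b₃ - a₃ * b₂, a₃ * b₁ - a₁ * b₃, a₁ * b₂ - a₂ * b₁] := by
  ext i; fin_cases i <;> simp [cross_apply]

section Catenoid

variable (c ε : ℝ)

theorem catFace_pdt (p : ℝ × ℝ) : pdt (catFace c ε).X p =
    c • !₂[Real.sinh (p.1 + T₀) * Real.cos p.2, Real.sinh (p.1 + T₀) * Real.sin p.2, ε] := by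
  have h := (Real.hasDerivAt_cosh (p.1 + T₀)).comp_add_const p.1 T₀
  have h3 : HasDerivAt (fun s : ℝ => ε * s) ε p.1 := by simpa using (hasDerivAt_id p.1).const_mul ε
  exact (hasDerivAt_vec c (h.mul_const (Real.cos p.2)) (h.mul_const (Real.sin p.2)) h3).deriv

theorem catFace_pdθ (p : ℝ × ℝ) : pdθ (catFace c ε).X p =
    c • !₂[Real.cosh (p.1 + T₀) * -Real.sin p.2, Real.cosh (p.1 + T₀) * Real.cos p.2, 0] :=
  (hasDerivAt_vec c ((Real.hasDerivAt_cos p.2).const_mul (Real.cosh (p.1 + T₀))) ((Real.hasDerivAt_sin p.2).const_mul (Real.cosh (p.1 + T₀)))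
    (hasDerivAt_const p.2 (ε * p.1))).deriv

theorem catFace_pdt_pdt (p : ℝ × ℝ) : pdt (pdt (catFace c ε).X) p =
    c • !₂[Real.cosh (p.1 + T₀) * Real.cos p.2, Real.cosh (p.1 + T₀) * Real.sin p.2, 0] := by
  rw [show pdt (catFace c ε).X = _ from funext (catFace_pdt c ε)]
  have h := (Real.hasDerivAt_sinh (p.1 + T₀)).comp_add_const p.1 T₀
  exact (hasDerivAt_vec c (h.mul_const (Real.cos p.2)) (h.mul_const (Real.sin p.2)) (hasDerivAt_const p.1 ε)).deriv

theorem catFace_pdt_pdθ (p : ℝ × ℝ) : pdt (pdθ (catFace c ε).X) p =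
    c • !₂[Real.sinh (p.1 + T₀) * -Real.sin p.2, Real.sinh (p.1 + T₀) * Real.cos p.2, 0] := by
  rw [show pdθ (catFace c ε).X = _ from funext (catFace_pdθ c ε)]
  have h := (Real.hasDerivAt_cosh (p.1 + T₀)).comp_add_const p.1 T₀
  exact (hasDerivAt_vec c (h.mul_const (-Real.sin p.2)) (h.mul_const (Real.cos p.2)) (hasDerivAt_const p.1 (0 : ℝ))).deriv

theorem catFace_pdθ_pdt (p : ℝ × ℝ) : pdθ (pdt (catFace c ε).X) p =
    c • !₂[Real.sinh (p.1 + T₀) * -Real.sin p.2, Real.sinh (p.1 + T₀) * Real.cos p.2, 0] := by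
  rw [show pdt (catFace c ε).X = _ from funext (catFace_pdt c ε)]
  exact (hasDerivAt_vec c ((Real.hasDerivAt_cos p.2).const_mul (Real.sinh (p.1 + T₀)))
    ((Real.hasDerivAt_sin p.2).const_mul (Real.sinh (p.1 + T₀))) (hasDerivAt_const p.2 ε)).deriv

theorem catFace_pdθ_pdθ (p : ℝ × ℝ) : pdθ (pdθ (catFace c ε).X) p =
    c • !₂[Real.cosh (p.1 + T₀) * -Real.cos p.2, Real.cosh (p.1 + T₀) * -Real.sin p.2, 0] := by
  rw [show pdθ (catFace c ε).X = _ from funext (catFace_pdθ c ε)]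
  exact (hasDerivAt_vec c ((Real.hasDerivAt_sin p.2).neg.const_mul (Real.cosh (p.1 + T₀)))
    ((Real.hasDerivAt_cos p.2).const_mul (Real.cosh (p.1 + T₀))) (hasDerivAt_const p.2 (0 : ℝ))).deriv

variable {c ε}

theorem catFace_normal (hc : 0 < c) (hε : ε ^ 2 = 1) (p : ℝ × ℝ) : (catFace c ε).normal p =
    !₂[-ε * Real.cos p.2 / Real.cosh (p.1 + T₀), -ε * Real.sin p.2 / Real.cosh (p.1 + T₀),
      Real.sinh (p.1 + T₀) / Real.cosh (p.1 + T₀)] := by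
  have hch := Real.cosh_pos (p.1 + T₀)
  have hsq := Real.cosh_sq (p.1 + T₀)
  have htr := Real.sin_sq_add_cos_sq p.2
  rw [Face.normal, Face.crossVec, catFace_pdt, catFace_pdθ, smul_vec, smul_vec, cross_vec,
    norm_vec_eq (r := c ^ 2 * Real.cosh (p.1 + T₀) ^ 2) (by positivity), smul_vec]
  · congr 1
    ext i; fin_cases i
    · simp; field_simp
    · simp; field_simp
    · simp; field_simp
      linear_combination Real.sinh (p.1 + T₀) * htr
  · linear_combination c ^ 4 * Real.cosh (p.1 + T₀) ^ 2 * (ε ^ 2 + Real.sinh (p.1 + T₀) ^ 2 *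
      (Real.sin p.2 ^ 2 + Real.cos p.2 ^ 2 + 1)) * htr +
      c ^ 4 * Real.cosh (p.1 + T₀) ^ 2 * hε - c ^ 4 * Real.cosh (p.1 + T₀) ^ 2 * hsq

theorem catFace_firstFF (hε : ε ^ 2 = 1) (p : ℝ × ℝ) : (catFace c ε).firstFF p =
    !![(c * Real.cosh (p.1 + T₀)) ^ 2, 0; 0, (c * Real.cosh (p.1 + T₀)) ^ 2] := by
  have hsq := Real.cosh_sq (p.1 + T₀)
  have htr := Real.sin_sq_add_cos_sq p.2
  rw [Face.firstFF, catFace_pdt, catFace_pdθ]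
  simp only [smul_vec, inner_vec]
  congr 1
  ext i j
  fin_cases i <;> fin_cases j <;> simp <;> try ring1
  · linear_combination c ^ 2 * Real.sinh (p.1 + T₀) ^ 2 * htr + c ^ 2 * hε - c ^ 2 * hsq
  · linear_combination c ^ 2 * Real.cosh (p.1 + T₀) ^ 2 * htr

theorem catFace_secondFF (hc : 0 < c) (hε : ε ^ 2 = 1) (p : ℝ × ℝ) : (catFace c ε).secondFF p =
    !![-(ε * c), 0; 0, ε * c] := by
  have hch := Real.cosh_pos (p.1 + T₀)
  have htr := Real.sin_sq_add_cos_sq p.2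
  rw [Face.secondFF, catFace_pdt_pdt, catFace_pdt_pdθ, catFace_pdθ_pdt, catFace_pdθ_pdθ,
    catFace_normal hc hε]
  simp only [smul_vec, inner_vec]
  congr 1
  ext i j
  fin_cases i <;> fin_cases j <;> simp <;> field_simp <;> try ring1
  · linear_combination -ε * htr
  · linear_combination ε * htr

/-- The principal curvatures are ± 1/(c cosh²). Squared, summed and multiplied by the area density
(c cosh)², they give the potential 2 sech², independent of the scale. -/
theorem catFace_normA (hc : 0 < c) (hε : ε ^ 2 = 1) (p : ℝ × ℝ) : (catFace c ε).normA p =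
    Real.sqrt 2 * sech p.1 ^ 2 / c := by
  have hch := Real.cosh_pos (p.1 + T₀)
  have hinv : ((catFace c ε).firstFF p)⁻¹ =
      !![((c * Real.cosh (p.1 + T₀)) ^ 2)⁻¹, 0; 0, ((c * Real.cosh (p.1 + T₀)) ^ 2)⁻¹] := by
    rw [catFace_firstFF hε]
    refine Matrix.inv_eq_left_inv ?_
    ext i j
    have : (c * Real.cosh (p.1 + T₀)) ^ 2 ≠ 0 := by positivity
    fin_cases i <;> fin_cases j <;> simp [Matrix.mul_apply] <;> field_simp
  rw [Face.normA, Face.shape, hinv, catFace_secondFF hc hε]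
  rw [Real.sqrt_eq_iff_mul_self_eq]
  · simp [Matrix.trace, Fin.sum_univ_two, sech]
    have h2 : Real.sqrt 2 ^ 2 = 2 := Real.sq_sqrt (by norm_num)
    field_simp
    rw [h2, hε]
    norm_num
  · simp [Matrix.trace, Fin.sum_univ_two]
    nlinarith [mul_self_nonneg (((c * Real.cosh (p.1 + T₀)) ^ 2)⁻¹ * (ε * c))]
  · positivity

theorem catFace_sqrt_det (hε : ε ^ 2 = 1) (p : ℝ × ℝ) :
    Real.sqrt ((catFace c ε).firstFF p).det = (c * Real.cosh (p.1 + T₀)) ^ 2 := by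
  rw [catFace_firstFF hε, Matrix.det_fin_two_of, mul_zero, sub_zero, Real.sqrt_mul_self (sq_nonneg _)]

theorem restrict_prod_cparam (s : Set ℝ) :
    (volume : Measure (ℝ × ℝ)).restrict (s ×ˢ Ioc 0 (2 * Real.pi)) =
      (volume.restrict s).prod Face.cparam := by
  rw [Face.cparam, Measure.prod_restrict, Measure.volume_eq_prod]

theorem catFace_dom : (catFace c ε).dom = Ici 0 := by
  ext t; simp [Face.dom, catFace]

theorem catFace_param : (catFace c ε).param = cylinder := by
  rw [Face.param, restrict_prod_cparam, catFace_dom, cylinder, restrict_Ioi_eq_restrict_Ici]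

theorem catFace_area (hε : ε ^ 2 = 1) : (catFace c ε).area =
    cylinder.withDensity fun p => ENNReal.ofReal ((c * Real.cosh (p.1 + T₀)) ^ 2) := by
  rw [Face.area, catFace_param]
  simp only [catFace_sqrt_det hε]

theorem catFace_deriv_curve (θ : ℝ) : deriv (catFace c ε).curve θ =
    c • !₂[Real.cosh T₀ * -Real.sin θ, Real.cosh T₀ * Real.cos θ, 0] := by
  have := catFace_pdθ c ε (0, θ)
  rw [zero_add] at this
  exact this

theorem catFace_deriv_deriv_curve (θ : ℝ) : deriv (deriv (catFace c ε).curve) θ =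
    c • !₂[Real.cosh T₀ * -Real.cos θ, Real.cosh T₀ * -Real.sin θ, 0] := by
  rw [show deriv (catFace c ε).curve = _ from funext catFace_deriv_curve]
  exact (hasDerivAt_vec c ((Real.hasDerivAt_sin θ).neg.const_mul _)
    ((Real.hasDerivAt_cos θ).const_mul _) (hasDerivAt_const θ (0 : ℝ))).deriv

theorem norm_circle {r : ℝ} (hr : 0 ≤ r) (θ : ℝ) :
    ‖(!₂[r * -Real.sin θ, r * Real.cos θ, 0] : E3)‖ = r :=
  norm_vec_eq hr (by linear_combination r ^ 2 * Real.sin_sq_add_cos_sq θ)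

theorem catFace_norm_deriv_curve (hc : 0 < c) (θ : ℝ) :
    ‖deriv (catFace c ε).curve θ‖ = c * Real.cosh T₀ := by
  have := Real.cosh_pos T₀
  rw [catFace_deriv_curve, norm_smul, norm_circle this.le, Real.norm_of_nonneg hc.le]

/-- The curvature vector points to the axis with length 1/r, where r = c cosh T₀, and the outward
conormal has radial component -tanh T₀ = -1/2. Against ds = r dθ this leaves the constant 1/2. -/
theorem catFace_curvNu (hc : 0 < c) (hε : ε ^ 2 = 1) (θ : ℝ) :
    (catFace c ε).curvNu θ = 1 / 2 * (c * Real.cosh T₀)⁻¹ := by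
  have hch := Real.cosh_pos T₀
  have hsh : Real.sinh T₀ = 1 / 2 * Real.cosh T₀ := by rw [sinh_T₀, cosh_T₀]; ring
  have htr := Real.sin_sq_add_cos_sq θ
  have hsq := Real.cosh_sq T₀
  have hX : pdt (catFace c ε).X ((catFace c ε).bdry, θ) =
      c • !₂[Real.sinh T₀ * Real.cos θ, Real.sinh T₀ * Real.sin θ, ε] := by
    rw [catFace_pdt]
    simp [catFace]
  have e1 : (catFace c ε).conormalVec θ =
      !₂[-(c * Real.sinh T₀ * Real.cos θ), -(c * Real.sinh T₀ * Real.sin θ), -(c * ε)] := by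
    rw [Face.conormalVec, hX, catFace_deriv_curve, show (catFace c ε).side = -1 from rfl]
    simp only [smul_vec, inner_vec]
    rw [show c * (Real.sinh T₀ * Real.cos θ) * (c * (Real.cosh T₀ * -Real.sin θ)) +
      c * (Real.sinh T₀ * Real.sin θ) * (c * (Real.cosh T₀ * Real.cos θ)) + c * ε * (c * 0) = 0 by
        ring]
    simp only [zero_div, zero_mul, sub_vec, smul_vec]
    congr 1
    ext i; fin_cases i <;> simp <;> ring
  have e2 : ‖(catFace c ε).conormalVec θ‖ = c * Real.cosh T₀ := by
    rw [e1]
    refine norm_vec_eq (by positivity) ?_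
    linear_combination c ^ 2 * Real.sinh T₀ ^ 2 * htr + c ^ 2 * hε - c ^ 2 * hsq
  have e3 : (catFace c ε).curvVec θ = (c * Real.cosh T₀)⁻¹ • !₂[-Real.cos θ, -Real.sin θ, 0] := by
    rw [Face.curvVec, catFace_norm_deriv_curve hc, catFace_deriv_deriv_curve, catFace_deriv_curve]
    simp only [smul_vec, inner_vec]
    rw [show c * (Real.cosh T₀ * -Real.cos θ) * (c * (Real.cosh T₀ * -Real.sin θ)) +
      c * (Real.cosh T₀ * -Real.sin θ) * (c * (Real.cosh T₀ * Real.cos θ)) + c * 0 * (c * 0) = 0 by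
        ring]
    simp only [zero_div, zero_mul, sub_vec, smul_vec]
    congr 1
    ext i; fin_cases i <;> simp <;> field_simp
  rw [Face.curvNu, Face.conormal, e2, e1, e3, smul_vec, smul_vec, inner_vec, hsh]
  field_simp
  linear_combination Real.cosh T₀ * htr

theorem catFace_length (hc : 0 < c) : (catFace c ε).length =
    Face.cparam.withDensity fun _ => ENNReal.ofReal (c * Real.cosh T₀) := by
  simp only [Face.length, catFace_norm_deriv_curve hc]

/-- The tangential frame of the catenoid is conformal. -/
theorem catFace_inner (hc : 0 < c) (hε : ε ^ 2 = 1) (p : ℝ × ℝ) (V W : E3)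
    (hV : inner ℝ V ((catFace c ε).normal p) = 0) :
    (c * Real.cosh (p.1 + T₀)) ^ 2 * inner ℝ V W =
      inner ℝ V (pdt (catFace c ε).X p) * inner ℝ W (pdt (catFace c ε).X p) +
        inner ℝ V (pdθ (catFace c ε).X p) * inner ℝ W (pdθ (catFace c ε).X p) := by
  have hch := Real.cosh_pos (p.1 + T₀)
  have htr := Real.sin_sq_add_cos_sq p.2
  have hsq := Real.cosh_sq (p.1 + T₀)
  have hVW : inner ℝ V W = V 0 * W 0 + V 1 * W 1 + V 2 * W 2 := by
    simp [PiLp.inner_apply, Fin.sum_univ_three]; ring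
  rw [catFace_normal hc hε, inner_vec_right] at hV
  rw [catFace_pdt, catFace_pdθ, hVW]
  simp only [smul_vec, inner_vec_right]
  field_simp at hV
  generalize Real.cosh (p.1 + T₀) = ch at *
  generalize Real.sinh (p.1 + T₀) = sh at *
  generalize Real.cos p.2 = C at *
  generalize Real.sin p.2 = S at *
  generalize V 0 = a at *
  generalize V 1 = b at *
  generalize V 2 = d at *
  generalize W 0 = a' at *
  generalize W 1 = b' at *
  generalize W 2 = d' at *
  -- In the plane of the radial and the vertical direction, (sh, ε) and (-ε, sh) are orthogonal with
  -- squared length ch². The second is the normal direction, so its term disappears as soon as one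
  -- of the two vectors is tangent.
  have key : (sh * (a * C + b * S) + ε * d) * (sh * (a' * C + b' * S) + ε * d') +
      (-ε * (a * C + b * S) + sh * d) * (-ε * (a' * C + b' * S) + sh * d') =
      ch ^ 2 * ((a * C + b * S) * (a' * C + b' * S) + d * d') := by
    linear_combination ((a * C + b * S) * (a' * C + b' * S) + d * d') * (hε - hsq)
  have hV' : -ε * (a * C + b * S) + sh * d = 0 := by linear_combination hV
  rw [hV', zero_mul, add_zero] at key
  linear_combination -c ^ 2 * key - c ^ 2 * ch ^ 2 * (a * a' + b * b') * htr

end Catenoid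

/-! ### Geometry of the flat disk. -/

section Disk

variable (c : ℝ)

theorem diskFace_pdt (p : ℝ × ℝ) : pdt (diskFace c).X p =
    c • !₂[2 / Real.sqrt 3 * Real.cos p.2, 2 / Real.sqrt 3 * Real.sin p.2, 0] := by
  have h : HasDerivAt (fun s : ℝ => 2 * s / Real.sqrt 3) (2 / Real.sqrt 3) p.1 := by
    simpa using ((hasDerivAt_id p.1).const_mul 2).div_const (Real.sqrt 3)
  exact (hasDerivAt_vec c (h.mul_const (Real.cos p.2)) (h.mul_const (Real.sin p.2))
    (hasDerivAt_const p.1 (0 : ℝ))).deriv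

theorem diskFace_pdθ (p : ℝ × ℝ) : pdθ (diskFace c).X p =
    c • !₂[2 * p.1 / Real.sqrt 3 * -Real.sin p.2, 2 * p.1 / Real.sqrt 3 * Real.cos p.2, 0] :=
  (hasDerivAt_vec c ((Real.hasDerivAt_cos p.2).const_mul (2 * p.1 / Real.sqrt 3))
    ((Real.hasDerivAt_sin p.2).const_mul (2 * p.1 / Real.sqrt 3))
    (hasDerivAt_const p.2 (0 : ℝ))).deriv

theorem diskFace_pdt_pdt (p : ℝ × ℝ) : pdt (pdt (diskFace c).X) p = c • !₂[0, 0, 0] := by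
  rw [show pdt (diskFace c).X = _ from funext (diskFace_pdt c)]
  exact (hasDerivAt_vec c (hasDerivAt_const p.1 (2 / Real.sqrt 3 * Real.cos p.2))
    (hasDerivAt_const p.1 (2 / Real.sqrt 3 * Real.sin p.2)) (hasDerivAt_const p.1 (0 : ℝ))).deriv

theorem diskFace_pdt_pdθ (p : ℝ × ℝ) : pdt (pdθ (diskFace c).X) p =
    c • !₂[2 / Real.sqrt 3 * -Real.sin p.2, 2 / Real.sqrt 3 * Real.cos p.2, 0] := by
  rw [show pdθ (diskFace c).X = _ from funext (diskFace_pdθ c)]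
  have h : HasDerivAt (fun s : ℝ => 2 * s / Real.sqrt 3) (2 / Real.sqrt 3) p.1 := by
    simpa using ((hasDerivAt_id p.1).const_mul 2).div_const (Real.sqrt 3)
  exact (hasDerivAt_vec c (h.mul_const (-Real.sin p.2)) (h.mul_const (Real.cos p.2))
    (hasDerivAt_const p.1 (0 : ℝ))).deriv

theorem diskFace_pdθ_pdt (p : ℝ × ℝ) : pdθ (pdt (diskFace c).X) p =
    c • !₂[2 / Real.sqrt 3 * -Real.sin p.2, 2 / Real.sqrt 3 * Real.cos p.2, 0] := by
  rw [show pdt (diskFace c).X = _ from funext (diskFace_pdt c)]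
  exact (hasDerivAt_vec c ((Real.hasDerivAt_cos p.2).const_mul (2 / Real.sqrt 3))
    ((Real.hasDerivAt_sin p.2).const_mul (2 / Real.sqrt 3)) (hasDerivAt_const p.2 (0 : ℝ))).deriv

theorem diskFace_pdθ_pdθ (p : ℝ × ℝ) : pdθ (pdθ (diskFace c).X) p =
    c • !₂[2 * p.1 / Real.sqrt 3 * -Real.cos p.2, 2 * p.1 / Real.sqrt 3 * -Real.sin p.2, 0] := by
  rw [show pdθ (diskFace c).X = _ from funext (diskFace_pdθ c)]
  exact (hasDerivAt_vec c ((Real.hasDerivAt_sin p.2).neg.const_mul (2 * p.1 / Real.sqrt 3))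
    ((Real.hasDerivAt_cos p.2).const_mul (2 * p.1 / Real.sqrt 3))
    (hasDerivAt_const p.2 (0 : ℝ))).deriv

variable {c}

theorem diskFace_crossVec (p : ℝ × ℝ) : (diskFace c).crossVec p =
    !₂[0, 0, c ^ 2 * (4 / 3) * p.1] := by
  have h3 : Real.sqrt 3 ^ 2 = 3 := Real.sq_sqrt (by norm_num)
  have htr := Real.sin_sq_add_cos_sq p.2
  rw [Face.crossVec, diskFace_pdt, diskFace_pdθ, smul_vec, smul_vec, cross_vec]
  congr 1
  ext i; fin_cases i
  · simp
  · simp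
  · simp; field_simp
    rw [h3]
    linear_combination 12 * c ^ 2 * p.1 * htr

theorem diskFace_normal (hc : 0 < c) {p : ℝ × ℝ} (hp : 0 < p.1) :
    (diskFace c).normal p = !₂[0, 0, 1] := by
  have h : 0 < c ^ 2 * (4 / 3) * p.1 := by positivity
  rw [Face.normal, diskFace_crossVec, norm_vec_eq h.le (by ring), smul_vec, mul_zero,
    inv_mul_cancel₀ h.ne']

theorem diskFace_secondFF (p : ℝ × ℝ) : (diskFace c).secondFF p = 0 := by
  rw [Face.secondFF, diskFace_pdt_pdt, diskFace_pdt_pdθ, diskFace_pdθ_pdt, diskFace_pdθ_pdθ,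
    Face.normal, diskFace_crossVec]
  simp only [smul_vec, inner_vec]
  ext i j
  fin_cases i <;> fin_cases j <;> simp

theorem diskFace_normA (p : ℝ × ℝ) : (diskFace c).normA p = 0 := by
  simp [Face.normA, Face.shape, diskFace_secondFF]

theorem diskFace_sqrt_det (p : ℝ × ℝ) :
    Real.sqrt ((diskFace c).firstFF p).det = c ^ 2 * (4 / 3) * |p.1| := by
  have h3 : Real.sqrt 3 ^ 2 = 3 := Real.sq_sqrt (by norm_num)
  have htr := Real.sin_sq_add_cos_sq p.2
  have e : ((diskFace c).firstFF p).det = (c ^ 2 * (4 / 3) * |p.1|) ^ 2 := by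
    rw [Face.firstFF, Matrix.det_fin_two_of, diskFace_pdt, diskFace_pdθ]
    simp only [smul_vec, inner_vec]
    rw [mul_pow, sq_abs]
    field_simp
    have h4 : Real.sqrt 3 ^ 4 = 9 := by nlinarith
    rw [h4]
    linear_combination 144 * c ^ 4 * p.1 ^ 2 * (Real.sin p.2 ^ 2 + Real.cos p.2 ^ 2 + 1) * htr
  rw [e, Real.sqrt_sq (by positivity)]

/-- The parameter domain of the disk. -/
def strip : Measure (ℝ × ℝ) := (volume.restrict (Ioc 0 1)).prod Face.cparam

theorem diskFace_dom : (diskFace c).dom = Ioc 0 1 := by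
  ext t; simp [Face.dom, diskFace]

theorem diskFace_param : (diskFace c).param = strip := by
  rw [Face.param, restrict_prod_cparam, diskFace_dom, strip]

theorem diskFace_area : (diskFace c).area =
    strip.withDensity fun p => ENNReal.ofReal (c ^ 2 * (4 / 3) * |p.1|) := by
  rw [Face.area, diskFace_param]
  simp only [diskFace_sqrt_det]

theorem diskFace_deriv_curve (θ : ℝ) : deriv (diskFace c).curve θ =
    c • !₂[2 / Real.sqrt 3 * -Real.sin θ, 2 / Real.sqrt 3 * Real.cos θ, 0] := by
  have := diskFace_pdθ c (1, θ)
  rw [mul_one] at this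
  exact this

theorem diskFace_deriv_deriv_curve (θ : ℝ) : deriv (deriv (diskFace c).curve) θ =
    c • !₂[2 / Real.sqrt 3 * -Real.cos θ, 2 / Real.sqrt 3 * -Real.sin θ, 0] := by
  rw [show deriv (diskFace c).curve = _ from funext diskFace_deriv_curve]
  exact (hasDerivAt_vec c ((Real.hasDerivAt_sin θ).neg.const_mul (2 / Real.sqrt 3))
    ((Real.hasDerivAt_cos θ).const_mul (2 / Real.sqrt 3)) (hasDerivAt_const θ (0 : ℝ))).deriv

theorem diskFace_norm_deriv_curve (hc : 0 < c) (θ : ℝ) :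
    ‖deriv (diskFace c).curve θ‖ = c * (2 / Real.sqrt 3) := by
  rw [diskFace_deriv_curve, norm_smul, norm_circle (by positivity), Real.norm_of_nonneg hc.le]

theorem diskFace_length (hc : 0 < c) : (diskFace c).length =
    Face.cparam.withDensity fun _ => ENNReal.ofReal (c * (2 / Real.sqrt 3)) := by
  simp only [Face.length, diskFace_norm_deriv_curve hc]

/-- The outward conormal is radial and the curvature vector points to the centre. The sign is
opposite to that on the ends, so the disk contributes the stabilizing term + ∫ g² dθ. -/
theorem diskFace_curvNu (hc : 0 < c) (θ : ℝ) :
    (diskFace c).curvNu θ = -(c * (2 / Real.sqrt 3))⁻¹ := by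
  have hr : 0 < 2 / Real.sqrt 3 := by positivity
  have htr := Real.sin_sq_add_cos_sq θ
  have e1 : (diskFace c).conormalVec θ =
      !₂[c * (2 / Real.sqrt 3) * Real.cos θ, c * (2 / Real.sqrt 3) * Real.sin θ, 0] := by
    rw [Face.conormalVec, diskFace_pdt, diskFace_deriv_curve,
      show (diskFace c).side = 1 from rfl]
    generalize 2 / Real.sqrt 3 = r
    simp only [smul_vec, inner_vec]
    rw [show c * (r * Real.cos θ) * (c * (r * -Real.sin θ)) +
      c * (r * Real.sin θ) * (c * (r * Real.cos θ)) + c * 0 * (c * 0) = 0 by ring]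
    simp only [zero_div, zero_mul, sub_vec, smul_vec]
    congr 1
    ext i; fin_cases i <;> simp <;> ring
  have e2 : ‖(diskFace c).conormalVec θ‖ = c * (2 / Real.sqrt 3) := by
    rw [e1]
    refine norm_vec_eq (by positivity) ?_
    linear_combination (c * (2 / Real.sqrt 3)) ^ 2 * htr
  have e3 : (diskFace c).curvVec θ =
      (c * (2 / Real.sqrt 3))⁻¹ • !₂[-Real.cos θ, -Real.sin θ, 0] := by
    rw [Face.curvVec, diskFace_norm_deriv_curve hc, diskFace_deriv_deriv_curve,
      diskFace_deriv_curve]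
    generalize 2 / Real.sqrt 3 = r at *
    simp only [smul_vec, inner_vec]
    rw [show c * (r * -Real.cos θ) * (c * (r * -Real.sin θ)) +
      c * (r * -Real.sin θ) * (c * (r * Real.cos θ)) + c * 0 * (c * 0) = 0 by ring]
    simp only [zero_div, zero_mul, sub_vec, smul_vec]
    congr 1
    ext i; fin_cases i <;> simp <;> field_simp
  rw [Face.curvNu, Face.conormal, e2, e1, e3]
  generalize 2 / Real.sqrt 3 = r at *
  rw [smul_vec, smul_vec, inner_vec]
  field_simp
  linear_combination -(c * r) * htr

theorem diskFace_eq_zero (hc : 0 < c) {p : ℝ × ℝ} (hp : 0 < p.1) {V : E3}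
    (h1 : inner ℝ V ((diskFace c).normal p) = 0) (h2 : inner ℝ V (pdt (diskFace c).X p) = 0)
    (h3 : inner ℝ V (pdθ (diskFace c).X p) = 0) : V = 0 := by
  have htr := Real.sin_sq_add_cos_sq p.2
  rw [diskFace_normal hc hp, inner_vec_right] at h1
  rw [diskFace_pdt, smul_vec, inner_vec_right] at h2
  rw [diskFace_pdθ, smul_vec, inner_vec_right] at h3
  have hr : 0 < c * (2 / Real.sqrt 3) := by positivity
  have h2' : V 0 * Real.cos p.2 + V 1 * Real.sin p.2 = 0 := by
    have : c * (2 / Real.sqrt 3) * (V 0 * Real.cos p.2 + V 1 * Real.sin p.2) = 0 := by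
      linear_combination h2
    exact (mul_eq_zero.1 this).resolve_left hr.ne'
  have h3' : -(V 0 * Real.sin p.2) + V 1 * Real.cos p.2 = 0 := by
    have : c * (2 / Real.sqrt 3) * p.1 * (-(V 0 * Real.sin p.2) + V 1 * Real.cos p.2) = 0 := by
      linear_combination h3
    exact (mul_eq_zero.1 this).resolve_left (mul_pos hr hp).ne'
  ext i
  fin_cases i
  · show V 0 = 0
    linear_combination Real.cos p.2 * h2' - Real.sin p.2 * h3' - V 0 * htr
  · show V 1 = 0
    linear_combination Real.sin p.2 * h2' + Real.cos p.2 * h3' - V 1 * htr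
  · show V 2 = 0
    linear_combination h1

theorem catFace_eq_zero {ε : ℝ} (hc : 0 < c) (hε : ε ^ 2 = 1) {p : ℝ × ℝ} {V : E3}
    (h1 : inner ℝ V ((catFace c ε).normal p) = 0) (h2 : inner ℝ V (pdt (catFace c ε).X p) = 0)
    (h3 : inner ℝ V (pdθ (catFace c ε).X p) = 0) : V = 0 := by
  have h := catFace_inner hc hε p V V h1
  rw [h2, h3, zero_mul, add_zero] at h
  have := Real.cosh_pos (p.1 + T₀)
  exact inner_self_eq_zero.1 ((mul_eq_zero.1 h).resolve_left (by positivity))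

end Disk

/-! ### Square integrability and integrals with respect to a density. -/

section Density

variable {α : Type*} {m : MeasurableSpace α} {μ : Measure α} {ρ : α → ℝ}

/-- Multiplication by √ρ is an isometry between the two L² spaces. Positivity almost everywhere lets
measurability pass through a division by √ρ. -/
theorem memLp_withDensity_iff {E : Type*} [NormedAddCommGroup E] [NormedSpace ℝ E]
    (hρ : Measurable ρ) (h0 : ∀ᵐ x ∂μ, 0 < ρ x) {f : α → E} :
    MemLp f 2 (μ.withDensity fun x => ENNReal.ofReal (ρ x)) ↔
      MemLp (fun x => Real.sqrt (ρ x) • f x) 2 μ := by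
  have hm : AEStronglyMeasurable f (μ.withDensity fun x => ENNReal.ofReal (ρ x)) ↔
      AEStronglyMeasurable (fun x => Real.sqrt (ρ x) • f x) μ := by
    have h1 := aestronglyMeasurable_withDensity_iff (μ := μ) (g := f) hρ.real_toNNReal
    refine h1.trans ⟨fun h => ?_, fun h => ?_⟩
    · have h2 : AEStronglyMeasurable (fun x => (Real.sqrt (ρ x))⁻¹ • (((ρ x).toNNReal : ℝ) • f x))
          μ := hρ.sqrt.inv.aestronglyMeasurable.smul h
      refine h2.congr ?_
      filter_upwards [h0] with x hx
      rw [Real.coe_toNNReal _ hx.le, smul_smul]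
      congr 1
      have := Real.sqrt_pos.2 hx
      rw [inv_mul_eq_iff_eq_mul₀ this.ne', Real.mul_self_sqrt hx.le]
    · have h2 : AEStronglyMeasurable (fun x => Real.sqrt (ρ x) • (Real.sqrt (ρ x) • f x))
          μ := hρ.sqrt.aestronglyMeasurable.smul h
      refine h2.congr ?_
      filter_upwards [h0] with x hx
      rw [Real.coe_toNNReal _ hx.le, smul_smul, Real.mul_self_sqrt hx.le]
  have hi : Integrable (fun x => ‖f x‖ ^ 2) (μ.withDensity fun x => ENNReal.ofReal (ρ x)) ↔
      Integrable (fun x => ‖Real.sqrt (ρ x) • f x‖ ^ 2) μ := by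
    rw [integrable_withDensity_iff_integrable_smul' hρ.ennreal_ofReal
      (ae_of_all _ fun x => ENNReal.ofReal_lt_top)]
    refine integrable_congr ?_
    filter_upwards [h0] with x hx
    rw [ENNReal.toReal_ofReal hx.le, norm_smul, mul_pow, Real.norm_eq_abs, sq_abs,
      Real.sq_sqrt hx.le, smul_eq_mul]
  constructor
  · intro h
    have h1 := hm.1 h.aestronglyMeasurable
    exact (memLp_two_iff_integrable_sq_norm h1).2
      (hi.1 ((memLp_two_iff_integrable_sq_norm h.aestronglyMeasurable).1 h))
  · intro h
    have h1 := hm.2 h.aestronglyMeasurable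
    exact (memLp_two_iff_integrable_sq_norm h1).2
      (hi.2 ((memLp_two_iff_integrable_sq_norm h.aestronglyMeasurable).1 h))

theorem integral_withDensity_ofReal (hρ : Measurable ρ) (h0 : ∀ᵐ x ∂μ, 0 < ρ x) (f : α → ℝ) :
    ∫ x, f x ∂(μ.withDensity fun x => ENNReal.ofReal (ρ x)) = ∫ x, ρ x * f x ∂μ := by
  rw [integral_withDensity_eq_integral_toReal_smul hρ.ennreal_ofReal
    (ae_of_all _ fun x => ENNReal.ofReal_lt_top)]
  refine integral_congr_ae ?_
  filter_upwards [h0] with x hx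
  rw [ENNReal.toReal_ofReal hx.le, smul_eq_mul]

theorem ae_of_ae_withDensity (hρ : Measurable ρ) (h0 : ∀ᵐ x ∂μ, 0 < ρ x) {P : α → Prop}
    (h : ∀ᵐ x ∂(μ.withDensity fun x => ENNReal.ofReal (ρ x)), P x) : ∀ᵐ x ∂μ, P x := by
  rw [ae_withDensity_iff hρ.ennreal_ofReal] at h
  filter_upwards [h, h0] with x hx h1
  exact hx (by simpa using h1)

end Density

/-! ### Sobolev functions on the ends in conformal coordinates. -/

namespace Face

/-- The `t`-component of a vector field along a face. -/
def compT (F : Face) (V : ℝ × ℝ → E3) (p : ℝ × ℝ) : ℝ := inner ℝ (V p) (pdt F.X p)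

/-- The `θ`-component of a vector field along a face. -/
def compθ (F : Face) (V : ℝ × ℝ → E3) (p : ℝ × ℝ) : ℝ := inner ℝ (V p) (pdθ F.X p)

theorem isTest_mul_cas (F : Face) {η : ℝ → ℝ} (hη : ContDiff ℝ ∞ η) (hs : HasCompactSupport η)
    (hJ : tsupport η ⊆ F.J) (k : ℤ) : F.IsTest fun p => η p.1 * cas k p.2 where
  smooth := (hη.comp contDiff_fst).mul ((contDiff_cas k).comp contDiff_snd)
  periodic t θ := by simp only [cas_periodic]
  support := ⟨tsupport η, hs, hJ, fun t θ ht => by simp [image_eq_zero_of_notMem_tsupport ht]⟩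

theorem pdt_mul_cas {η : ℝ → ℝ} (hη : ContDiff ℝ ∞ η) (k : ℤ) (p : ℝ × ℝ) :
    pdt (fun p : ℝ × ℝ => η p.1 * cas k p.2) p = deriv η p.1 * cas k p.2 :=
  ((hη.differentiable (by simp) p.1).hasDerivAt.mul_const (cas k p.2)).deriv

theorem pdθ_mul_cas (η : ℝ → ℝ) (k : ℤ) (p : ℝ × ℝ) :
    pdθ (fun p : ℝ × ℝ => η p.1 * cas k p.2) p = η p.1 * (k * cas (-k) p.2) :=
  ((hasDerivAt_cas k p.2).const_mul (η p.1)).deriv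

end Face

theorem continuous_catFace_pdt (c ε : ℝ) : Continuous (pdt (catFace c ε).X) := by
  rw [show pdt (catFace c ε).X = _ from funext (catFace_pdt c ε)]
  simp only [smul_vec]
  fun_prop

theorem continuous_catFace_pdθ (c ε : ℝ) : Continuous (pdθ (catFace c ε).X) := by
  rw [show pdθ (catFace c ε).X = _ from funext (catFace_pdθ c ε)]
  simp only [smul_vec]
  fun_prop

section Catenoid

variable {c ε : ℝ}

theorem catFace_norm_pdt (hc : 0 < c) (hε : ε ^ 2 = 1) (p : ℝ × ℝ) :
    ‖pdt (catFace c ε).X p‖ = c * Real.cosh (p.1 + T₀) := by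
  have := Real.cosh_pos (p.1 + T₀)
  rw [catFace_pdt, smul_vec]
  refine norm_vec_eq (by positivity) ?_
  linear_combination c ^ 2 * Real.sinh (p.1 + T₀) ^ 2 * Real.sin_sq_add_cos_sq p.2 + c ^ 2 * hε -
    c ^ 2 * Real.cosh_sq (p.1 + T₀)

theorem catFace_norm_pdθ (hc : 0 < c) (p : ℝ × ℝ) :
    ‖pdθ (catFace c ε).X p‖ = c * Real.cosh (p.1 + T₀) := by
  have := Real.cosh_pos (p.1 + T₀)
  rw [catFace_pdθ, smul_vec]
  refine norm_vec_eq (by positivity) ?_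
  linear_combination c ^ 2 * Real.cosh (p.1 + T₀) ^ 2 * Real.sin_sq_add_cos_sq p.2

theorem measurable_catFace_density (c : ℝ) :
    Measurable fun p : ℝ × ℝ => (c * Real.cosh (p.1 + T₀)) ^ 2 := by fun_prop

theorem catFace_memLp_area (hc : 0 < c) (hε : ε ^ 2 = 1) {E : Type*} [NormedAddCommGroup E]
    [NormedSpace ℝ E] {f : ℝ × ℝ → E} : MemLp f 2 (catFace c ε).area ↔
      MemLp (fun p : ℝ × ℝ => (c * Real.cosh (p.1 + T₀)) • f p) 2 cylinder := by
  rw [catFace_area hε, memLp_withDensity_iff (measurable_catFace_density c)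
    (ae_of_all _ fun p => by have := Real.cosh_pos (p.1 + T₀); positivity)]
  have h : ∀ p : ℝ × ℝ, Real.sqrt ((c * Real.cosh (p.1 + T₀)) ^ 2) = c * Real.cosh (p.1 + T₀) :=
    fun p => Real.sqrt_sq (by have := Real.cosh_pos (p.1 + T₀); positivity)
  simp only [h]

theorem catFace_aestronglyMeasurable (hc : 0 < c) (hε : ε ^ 2 = 1) {E : Type*}
    [NormedAddCommGroup E] [NormedSpace ℝ E] {V : ℝ × ℝ → E} (h : MemLp V 2 (catFace c ε).area) :
    AEStronglyMeasurable V cylinder := by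
  have h3 : AEStronglyMeasurable (fun p : ℝ × ℝ => (c * Real.cosh (p.1 + T₀))⁻¹ •
      ((c * Real.cosh (p.1 + T₀)) • V p)) cylinder :=
    (by fun_prop : Measurable fun p : ℝ × ℝ =>
      (c * Real.cosh (p.1 + T₀))⁻¹).aestronglyMeasurable.smul
      ((catFace_memLp_area hc hε).1 h).aestronglyMeasurable
  refine h3.congr (ae_of_all _ fun p => ?_)
  have := Real.cosh_pos (p.1 + T₀)
  exact inv_smul_smul₀ (by positivity) _

theorem catFace_ae {P : ℝ × ℝ → Prop} :
    (∀ᵐ p ∂(catFace c ε).param, P p) ↔ ∀ᵐ p ∂cylinder, P p := by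
  rw [catFace_param]

theorem memLp_const_withDensity {r : ℝ} (hr : 0 < r) {g : ℝ → ℝ} :
    MemLp g 2 (Face.cparam.withDensity fun _ => ENNReal.ofReal r) ↔ MemLp g 2 Face.cparam := by
  rw [memLp_withDensity_iff (ρ := fun _ => r) measurable_const (ae_of_all _ fun _ => hr)]
  have := Real.sqrt_pos.2 hr
  refine ⟨fun h => ?_, fun h => h.const_smul (Real.sqrt r)⟩
  refine (h.const_smul (Real.sqrt r)⁻¹).ae_eq (ae_of_all _ fun θ => ?_)
  simp only [Pi.smul_apply, smul_eq_mul]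
  field_simp

theorem catFace_memLp_length (hc : 0 < c) {g : ℝ → ℝ} :
    MemLp g 2 (catFace c ε).length ↔ MemLp g 2 Face.cparam := by
  have := Real.cosh_pos T₀
  rw [catFace_length hc, memLp_const_withDensity (by positivity)]

/-- An element of the Sobolev space of a catenoidal end, read in conformal coordinates. -/
theorem catFace_cylSobolev (hc : 0 < c) (hε : ε ^ 2 = 1) {u V g}
    (h : (catFace c ε).IsSobolev u V g) :
    CylSobolev u ((catFace c ε).compT V) ((catFace c ε).compθ V) g where
  memU := by
    -- The bound comes from finiteness of ∫ |A|² u², not from the logarithmic weight: |A| times the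
    -- root of the area density is √2 sech.
    refine (((catFace_memLp_area hc hε).1 h.finA).const_mul (Real.sqrt 2)⁻¹).ae_eq
      (ae_of_all _ fun p => ?_)
    have h2 : Real.sqrt 2 ≠ 0 := by positivity
    have := Real.cosh_pos (p.1 + T₀)
    simp only [catFace_normA hc hε, sech, smul_eq_mul]
    field_simp
  memP := by
    have h1 := (catFace_memLp_area hc hε).1 h.memV
    have h2 := catFace_aestronglyMeasurable hc hε h.memV
    refine h1.mono (h2.inner (continuous_catFace_pdt c ε).aestronglyMeasurable)
      (ae_of_all _ fun p => ?_)
    have := Real.cosh_pos (p.1 + T₀)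
    rw [norm_smul, Real.norm_of_nonneg (by positivity : 0 ≤ c * Real.cosh (p.1 + T₀)),
      ← catFace_norm_pdt hc hε, mul_comm]
    exact norm_inner_le_norm (𝕜 := ℝ) _ _
  memQ := by
    have h1 := (catFace_memLp_area hc hε).1 h.memV
    have h2 := catFace_aestronglyMeasurable hc hε h.memV
    refine h1.mono (h2.inner (continuous_catFace_pdθ c ε).aestronglyMeasurable)
      (ae_of_all _ fun p => ?_)
    have := Real.cosh_pos (p.1 + T₀)
    rw [norm_smul, Real.norm_of_nonneg (by positivity : 0 ≤ c * Real.cosh (p.1 + T₀)),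
      ← catFace_norm_pdθ (ε := ε) hc, mul_comm]
    exact norm_inner_le_norm (𝕜 := ℝ) _ _
  memG := (catFace_memLp_length hc).1 h.memG
  weakT k η hη hs := by
    have h1 := h.weakT _ ((catFace c ε).isTest_mul_cas hη hs (subset_univ _) k)
    simp only [Face.pdt_mul_cas hη, catFace_param] at h1
    rw [h1, show (catFace c ε).side = -1 from rfl, show (catFace c ε).bdry = 0 from rfl]
    simp only [Face.compT]
    ring
  weakθ k η hη hs := by
    have h1 := h.weakθ _ ((catFace c ε).isTest_mul_cas hη hs (subset_univ _) k)
    simp only [Face.pdθ_mul_cas, catFace_param] at h1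
    exact h1

theorem integral_const_withDensity {r : ℝ} (hr : 0 < r) (f : ℝ → ℝ) :
    ∫ θ, f θ ∂(Face.cparam.withDensity fun _ => ENNReal.ofReal r) = r * ∫ θ, f θ ∂Face.cparam := by
  rw [integral_withDensity_ofReal (ρ := fun _ => r) measurable_const (ae_of_all _ fun _ => hr),
    integral_const_mul]

/-- Conformal invariance of the Dirichlet integral in two dimensions: the area density cancels
against the squared length of the coordinate frame (`catFace_inner`). -/
theorem catFace_form (hc : 0 < c) (hε : ε ^ 2 = 1) (U W : (catFace c ε).sobolev) :
    (catFace c ε).form U W =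
      (∫ x, ((catFace c ε).compT U.1.2.1 x * (catFace c ε).compT W.1.2.1 x +
        (catFace c ε).compθ U.1.2.1 x * (catFace c ε).compθ W.1.2.1 x -
        2 * ((sech x.1 * U.1.1 x) * (sech x.1 * W.1.1 x))) ∂cylinder) -
        1 / 2 * ∫ θ, U.1.2.2 θ * W.1.2.2 θ ∂Face.cparam := by
  have hch := Real.cosh_pos T₀
  rw [Face.form, catFace_length hc, integral_const_withDensity (by positivity), catFace_area hε,
    integral_withDensity_ofReal (measurable_catFace_density c)
    (ae_of_all _ fun p => by have := Real.cosh_pos (p.1 + T₀); positivity)]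
  simp only [catFace_curvNu hc hε, integral_const_mul]
  congr 1
  · refine integral_congr_ae ?_
    filter_upwards [catFace_ae.1 U.2.tangent] with p hp
    have h1 := catFace_inner hc hε p _ (W.1.2.1 p) hp
    have := Real.cosh_pos (p.1 + T₀)
    have h2 : Real.sqrt 2 ^ 2 = 2 := Real.sq_sqrt (by norm_num)
    rw [mul_sub, h1, catFace_normA hc hε]
    simp only [Face.compT, Face.compθ, sech]
    congr 1
    field_simp
    rw [h2]
    ring
  · field_simp

theorem catFace_form_self (hc : 0 < c) (hε : ε ^ 2 = 1) (U : (catFace c ε).sobolev) :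
    (catFace c ε).form U U = cylEnergy U.1.1 ((catFace c ε).compT U.1.2.1)
      ((catFace c ε).compθ U.1.2.1) U.1.2.2 := by
  have h := catFace_cylSobolev hc hε U.2
  rw [catFace_form hc hε, cylEnergy]
  simp only [← pow_two]
  have i := h.memP.integrable_sq.add h.memQ.integrable_sq
  simp only [Pi.add_def] at i
  rw [integral_sub i (h.memU.integrable_sq.const_mul 2),
    integral_add h.memP.integrable_sq h.memQ.integrable_sq, integral_const_mul]

end Catenoid

/-! ### A function determines its weak gradient and its trace. -/

/-- Data on an annular parameter domain `S × S¹` with a weight `κ`, used to detect functions by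
testing on the open part `U` of `S`. -/
structure Weight (S U : Set ℝ) (κ : ℝ → ℝ) : Prop where
  isOpen : IsOpen U
  subset : U ⊆ S
  ae_mem : ∀ᵐ t ∂volume.restrict S, t ∈ U
  continuousOn : ContinuousOn κ U
  pos : ∀ t ∈ U, 0 < κ t

namespace Weight

variable {S U : Set ℝ} {κ : ℝ → ℝ} (h : Weight S U κ) {f : ℝ × ℝ → ℝ}
  (hf : MemLp (fun x : ℝ × ℝ => κ x.1 * f x) 2 ((volume.restrict S).prod Face.cparam))
include h hf

theorem integrable_mul_cas {η : ℝ → ℝ} (hη : Continuous η) (hs : HasCompactSupport η)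
    (hU : tsupport η ⊆ U) (k : ℤ) :
    Integrable (fun x => f x * (η x.1 * cas k x.2)) ((volume.restrict S).prod Face.cparam) := by
  -- Outside `U` nothing is known about `κ`, but there `η` vanishes in a whole neighbourhood, so the
  -- quotient is continuous everywhere.
  have hc : Continuous fun t => (κ t)⁻¹ * η t := by
    refine continuous_iff_continuousAt.2 fun t => ?_
    by_cases ht : t ∈ U
    · exact ((h.continuousOn.continuousAt (h.isOpen.mem_nhds ht)).inv₀ (h.pos t ht).ne').mul
        hη.continuousAt
    · have h1 : (fun t => (κ t)⁻¹ * η t) =ᶠ[nhds t] fun _ => 0 := by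
        filter_upwards [(isClosed_tsupport η).isOpen_compl.mem_nhds fun h1 => ht (hU h1)] with s hs
        rw [image_eq_zero_of_notMem_tsupport hs, mul_zero]
      exact continuousAt_const.congr h1.symm
  have h2 := memLp_mul_snd (memLp_of_hasCompactSupport hc hs.mul_left S) (memLp_cas k)
  refine (hf.integrable_mul h2).congr ?_
  have h3 : ∀ᵐ x ∂(volume.restrict S).prod Face.cparam, x.1 ∈ U :=
    Measure.quasiMeasurePreserving_fst.ae h.ae_mem
  filter_upwards [h3] with x hx
  have := (h.pos x.1 hx).ne'
  simp only [Pi.mul_apply]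
  field_simp

/-- A function is determined by its integrals against products of test functions. -/
theorem ae_eq_zero
    (H : ∀ (k : ℤ) (η : ℝ → ℝ), ContDiff ℝ ∞ η → HasCompactSupport η → tsupport η ⊆ U →
      ∫ x, f x * (η x.1 * cas k x.2) ∂(volume.restrict S).prod Face.cparam = 0) :
    ∀ᵐ x ∂(volume.restrict S).prod Face.cparam, f x = 0 := by
  have hmode : ∀ k t, mode (fun x => κ x.1 * f x) k t = κ t * mode f k t := fun k t => by
    simp only [mode, coef]
    rw [← integral_const_mul]
    congr 1
    funext θ
    ring
  have h0 : ∀ k, ∀ᵐ t ∂volume.restrict S, mode (fun x => κ x.1 * f x) k t = 0 := fun k => by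
    have hm := memLp_mode hf k
    -- Parseval is applied to κ f, which is in L², while the fundamental lemma is applied to the
    -- modes of `f`. On `U` the weight is continuous and positive, so it can be divided out.
    have hloc : LocallyIntegrableOn (mode f k) U := by
      have h1 : LocallyIntegrableOn (mode (fun x => κ x.1 * f x) k) U := by
        rw [locallyIntegrableOn_iff h.isOpen.isLocallyClosed]
        intro K hK hKc
        have h2 : MemLp (mode (fun x => κ x.1 * f x) k) 2 (volume.restrict K) :=
          hm.mono_measure (Measure.restrict_mono (hK.trans h.subset) le_rfl)
        have : IsFiniteMeasure (volume.restrict K) :=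
          ⟨by rw [Measure.restrict_apply_univ]; exact hKc.measure_lt_top⟩
        exact h2.integrable (by norm_num)
      have h2 := h1.continuousOn_mul (g := fun t => (κ t)⁻¹)
        (h.continuousOn.inv₀ fun t ht => (h.pos t ht).ne') h.isOpen.isLocallyClosed
      rw [locallyIntegrableOn_iff h.isOpen.isLocallyClosed] at h2 ⊢
      intro K hK hKc
      refine (h2 K hK hKc).congr_fun (fun t ht => ?_) hKc.measurableSet
      simp only [hmode]
      exact inv_mul_cancel_left₀ (h.pos t (hK ht)).ne' _
    have h3 := h.isOpen.ae_eq_zero_of_integral_contDiff_smul_eq_zero hloc fun η hη hs hU => by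
      have h4 := H k η hη hs hU
      rw [integral_mul_cas η k (h.integrable_mul_cas hf hη.continuous hs hU k)] at h4
      rw [← h4]
      symm
      refine setIntegral_eq_integral_of_forall_compl_eq_zero fun t ht => ?_
      rw [image_eq_zero_of_notMem_tsupport fun h5 => ht (h.subset (hU h5)), zero_mul]
    filter_upwards [ae_restrict_of_ae h3, h.ae_mem] with t h4 h5
    rw [hmode, h4 h5, mul_zero]
  have h1 := ae_eq_zero_of_mode hf h0
  have h3 : ∀ᵐ x ∂(volume.restrict S).prod Face.cparam, x.1 ∈ U :=
    Measure.quasiMeasurePreserving_fst.ae h.ae_mem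
  filter_upwards [h1, h3] with x h4 h5
  exact (mul_eq_zero.1 h4).resolve_left (h.pos _ h5).ne'

end Weight

namespace Face

variable {F : Face} {u : ℝ × ℝ → ℝ} {V : ℝ × ℝ → E3} {g : ℝ → ℝ} {S U : Set ℝ} {κ : ℝ → ℝ}

theorem integral_mul_const_cas (g : ℝ → ℝ) (r : ℝ) (k : ℤ) :
    ∫ θ, g θ * (r * cas k θ) ∂cparam = r * coef g k := by
  rw [coef, ← integral_const_mul]
  congr 1
  funext θ
  ring

/-- The weak gradient and the trace are determined by the function. -/
theorem IsSobolev.comp_eq_zero (h : F.IsSobolev u V g) (hu : ∀ᵐ p ∂F.param, u p = 0)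
    (hparam : F.param = (volume.restrict S).prod cparam) (hκ : Weight S U κ)
    (hp : MemLp (fun x : ℝ × ℝ => κ x.1 * F.compT V x) 2 ((volume.restrict S).prod cparam))
    (hq : MemLp (fun x : ℝ × ℝ => κ x.1 * F.compθ V x) 2 ((volume.restrict S).prod cparam))
    (hg : MemLp g 2 cparam) (hUJ : U ⊆ F.J) (hb : F.bdry ∉ U) (hJ : F.J ∈ nhds F.bdry)
    (hside : F.side ≠ 0) :
    (∀ᵐ p ∂F.param, F.compT V p = 0) ∧ (∀ᵐ p ∂F.param, F.compθ V p = 0) ∧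
      ∀ᵐ θ ∂cparam, g θ = 0 := by
  have hu0 : ∀ f : ℝ × ℝ → ℝ, ∫ p, u p * f p ∂F.param = 0 := fun f =>
    integral_eq_zero_of_ae (by filter_upwards [hu] with p hp; simp [hp])
  have hT : ∀ (k : ℤ) (η : ℝ → ℝ), ContDiff ℝ ∞ η → HasCompactSupport η → tsupport η ⊆ F.J →
      ∫ p, F.compT V p * (η p.1 * cas k p.2) ∂F.param = F.side * (η F.bdry * coef g k) := by
    intro k η hη hs hJ
    have h1 := h.weakT _ (F.isTest_mul_cas hη hs hJ k)
    rw [hu0] at h1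
    simp only [integral_mul_const_cas] at h1
    simp only [compT]
    linarith
  have hθ : ∀ (k : ℤ) (η : ℝ → ℝ), ContDiff ℝ ∞ η → HasCompactSupport η → tsupport η ⊆ F.J →
      ∫ p, F.compθ V p * (η p.1 * cas k p.2) ∂F.param = 0 := by
    intro k η hη hs hJ
    have h1 := h.weakθ _ (F.isTest_mul_cas hη hs hJ k)
    rw [hu0] at h1
    simp only [compθ]
    linarith
  have e1 : ∀ᵐ p ∂F.param, F.compT V p = 0 := by
    rw [hparam]
    refine hκ.ae_eq_zero hp fun k η hη hs hU => ?_
    rw [← hparam, hT k η hη hs (hU.trans hUJ),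
      image_eq_zero_of_notMem_tsupport fun h5 => hb (hU h5)]
    ring
  have e2 : ∀ᵐ p ∂F.param, F.compθ V p = 0 := by
    rw [hparam]
    refine hκ.ae_eq_zero hq fun k η hη hs hU => ?_
    rw [← hparam, hθ k η hη hs (hU.trans hUJ)]
  refine ⟨e1, e2, ae_eq_zero_of_coef hg fun k => ?_⟩
  -- With the interior integral already known to vanish, a test function equal to 1 at the boundary
  -- parameter isolates the coefficient of the trace.
  obtain ⟨η, hηJ, hs, hη, -, hη1⟩ := exists_contDiff_tsupport_subset (n := ⊤) hJ
  have h1 := hT k η hη hs hηJ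
  rw [integral_eq_zero_of_ae (by filter_upwards [e1] with p hp; simp [hp]), hη1, one_mul] at h1
  exact (mul_eq_zero.1 h1.symm).resolve_left hside

end Face

section Uniqueness

variable {c ε : ℝ} {u : ℝ × ℝ → ℝ} {V : ℝ × ℝ → E3} {g : ℝ → ℝ}

theorem weight_one : Weight (Ioi 0) (Ioi 0) fun _ => 1 :=
  ⟨isOpen_Ioi, subset_rfl, ae_restrict_mem measurableSet_Ioi, continuousOn_const,
    fun _ _ => one_pos⟩

/-- An element of the domain stores function, gradient and trace. Together with `diskFace_unique`
this makes the function alone decide equality, as the description of the null space by functions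
requires. -/
theorem catFace_unique (hc : 0 < c) (hε : ε ^ 2 = 1) (h : (catFace c ε).IsSobolev u V g)
    (hu : ∀ᵐ p ∂(catFace c ε).param, u p = 0) :
    (∀ᵐ p ∂(catFace c ε).param, V p = 0) ∧ ∀ᵐ θ ∂Face.cparam, g θ = 0 := by
  have hs := catFace_cylSobolev hc hε h
  obtain ⟨h1, h2, h3⟩ := h.comp_eq_zero hu catFace_param weight_one
    (by simpa using! hs.memP) (by simpa using! hs.memQ) hs.memG (subset_univ _)
    (by simp [catFace]) (by simp [catFace]) (by simp [catFace])
  refine ⟨?_, h3⟩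
  filter_upwards [h1, h2, h.tangent] with p h4 h5 h6
  exact catFace_eq_zero hc hε h6 h4 h5

theorem ae_restrict_Ioc_mem_Ioo : ∀ᵐ t ∂volume.restrict (Ioc (0 : ℝ) 1), t ∈ Ioo (0 : ℝ) 1 := by
  rw [← restrict_Ioo_eq_restrict_Ioc]
  exact ae_restrict_mem measurableSet_Ioo

theorem weight_disk {κ : ℝ → ℝ} (hκ : Continuous κ) (hpos : ∀ t, 0 < t → 0 < κ t) :
    Weight (Ioc 0 1) (Ioo 0 1) κ :=
  ⟨isOpen_Ioo, Ioo_subset_Ioc_self, ae_restrict_Ioc_mem_Ioo, hκ.continuousOn,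
    fun _ ht => hpos _ ht.1⟩

theorem ae_strip : ∀ᵐ p ∂strip, p.1 ∈ Ioo (0 : ℝ) 1 :=
  Measure.quasiMeasurePreserving_fst.ae ae_restrict_Ioc_mem_Ioo

theorem ae_strip_pos (hc : 0 < c) : ∀ᵐ p ∂strip, 0 < c ^ 2 * (4 / 3) * |p.1| := by
  filter_upwards [ae_strip] with p hp
  have := abs_pos.2 hp.1.ne'
  positivity

theorem measurable_disk_density (c : ℝ) :
    Measurable fun p : ℝ × ℝ => c ^ 2 * (4 / 3) * |p.1| := by fun_prop

theorem diskFace_memLp_area (hc : 0 < c) {E : Type*} [NormedAddCommGroup E]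
    [NormedSpace ℝ E] {f : ℝ × ℝ → E} : MemLp f 2 (diskFace c).area ↔
      MemLp (fun p : ℝ × ℝ => Real.sqrt (c ^ 2 * (4 / 3) * |p.1|) • f p) 2 strip := by
  rw [diskFace_area, memLp_withDensity_iff (measurable_disk_density c) (ae_strip_pos hc)]

theorem diskFace_memLp_length (hc : 0 < c) {g : ℝ → ℝ} :
    MemLp g 2 (diskFace c).length ↔ MemLp g 2 Face.cparam := by
  rw [diskFace_length hc, memLp_const_withDensity (by positivity)]

theorem continuous_diskFace_pdt (c : ℝ) : Continuous (pdt (diskFace c).X) := by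
  rw [show pdt (diskFace c).X = _ from funext (diskFace_pdt c)]
  simp only [smul_vec]
  fun_prop

theorem continuous_diskFace_pdθ (c : ℝ) : Continuous (pdθ (diskFace c).X) := by
  rw [show pdθ (diskFace c).X = _ from funext (diskFace_pdθ c)]
  simp only [smul_vec]
  fun_prop

theorem diskFace_norm_pdt (hc : 0 < c) (p : ℝ × ℝ) :
    ‖pdt (diskFace c).X p‖ = c * (2 / Real.sqrt 3) := by
  rw [diskFace_pdt, smul_vec]
  refine norm_vec_eq (by positivity) ?_
  linear_combination (c * (2 / Real.sqrt 3)) ^ 2 * Real.sin_sq_add_cos_sq p.2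

theorem diskFace_norm_pdθ (hc : 0 < c) (p : ℝ × ℝ) :
    ‖pdθ (diskFace c).X p‖ = c * (2 / Real.sqrt 3) * |p.1| := by
  rw [diskFace_pdθ, smul_vec]
  refine norm_vec_eq (by positivity) ?_
  rw [mul_pow _ |p.1|, sq_abs]
  linear_combination (c * (2 / Real.sqrt 3)) ^ 2 * p.1 ^ 2 * Real.sin_sq_add_cos_sq p.2

theorem memLp_inner_of_bounded {μ : Measure (ℝ × ℝ)} {κ : ℝ × ℝ → ℝ} {W : ℝ × ℝ → E3} {C : ℝ}
    (hV : MemLp (fun p => κ p • V p) 2 μ) (hW : Continuous W) (hb : ∀ᵐ p ∂μ, ‖W p‖ ≤ C) :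
    MemLp (fun p => κ p * inner ℝ (V p) (W p)) 2 μ := by
  have h1 : MemLp (fun p => inner ℝ (κ p • V p) (W p)) 2 μ := by
    refine MemLp.of_le_mul (c := C) hV
      (hV.aestronglyMeasurable.inner hW.aestronglyMeasurable) ?_
    filter_upwards [hb] with p hp
    refine (norm_inner_le_norm (𝕜 := ℝ) _ _).trans ?_
    rw [mul_comm]
    exact mul_le_mul_of_nonneg_right hp (norm_nonneg _)
  simpa only [real_inner_smul_left] using h1

theorem continuous_disk_weight (c : ℝ) :
    Continuous fun t : ℝ => Real.sqrt (c ^ 2 * (4 / 3) * |t|) := by fun_prop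

theorem disk_weight_pos (hc : 0 < c) (t : ℝ) (ht : 0 < t) :
    0 < Real.sqrt (c ^ 2 * (4 / 3) * |t|) :=
  Real.sqrt_pos.2 (by have := abs_pos.2 ht.ne'; positivity)

theorem diskFace_unique (hc : 0 < c) (h : (diskFace c).IsSobolev u V g)
    (hu : ∀ᵐ p ∂(diskFace c).param, u p = 0) :
    (∀ᵐ p ∂(diskFace c).param, V p = 0) ∧ ∀ᵐ θ ∂Face.cparam, g θ = 0 := by
  have hV := (diskFace_memLp_area hc).1 h.memV
  obtain ⟨h1, h2, h3⟩ := h.comp_eq_zero hu diskFace_param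
    (weight_disk (continuous_disk_weight c) (disk_weight_pos hc))
    (memLp_inner_of_bounded hV (continuous_diskFace_pdt c)
      (ae_of_all _ fun p => (diskFace_norm_pdt hc p).le))
    (memLp_inner_of_bounded hV (continuous_diskFace_pdθ c) (C := c * (2 / Real.sqrt 3)) (by
      filter_upwards [ae_strip] with p hp
      rw [diskFace_norm_pdθ hc]
      refine mul_le_of_le_one_right (by positivity) ?_
      rw [abs_of_pos hp.1]
      exact hp.2.le))
    ((diskFace_memLp_length hc).1 h.memG) (fun t ht => ht.1) (by simp [diskFace])
    (Ioi_mem_nhds (by simp [diskFace])) (by simp [diskFace])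
  refine ⟨?_, h3⟩
  have hpos : ∀ᵐ p ∂(diskFace c).param, 0 < p.1 := by
    rw [diskFace_param]
    filter_upwards [ae_strip] with p hp using hp.1
  filter_upwards [h1, h2, h.tangent, hpos] with p h4 h5 h6 h7
  exact diskFace_eq_zero hc h7 h6 h4 h5

/-- The weight of `L²_*` on the disk, as a function of `t`. -/
def diskWeight (c t : ℝ) : ℝ :=
  Real.sqrt (c ^ 2 * (4 / 3) * |t|) *
    Real.sqrt ((1 + (c * (2 / Real.sqrt 3) * |t|) ^ 2)⁻¹ *
      ((Real.log (2 + c * (2 / Real.sqrt 3) * |t|)) ^ 2)⁻¹)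

theorem diskFace_norm_X (hc : 0 < c) (p : ℝ × ℝ) :
    ‖(diskFace c).X p‖ = c * (2 / Real.sqrt 3) * |p.1| := by
  rw [show (diskFace c).X p = c • !₂[2 * p.1 / Real.sqrt 3 * Real.cos p.2,
    2 * p.1 / Real.sqrt 3 * Real.sin p.2, 0] from rfl, smul_vec]
  refine norm_vec_eq (by positivity) ?_
  rw [mul_pow _ |p.1|, sq_abs]
  linear_combination (c * (2 / Real.sqrt 3)) ^ 2 * p.1 ^ 2 * Real.sin_sq_add_cos_sq p.2

theorem log_two_add_pos {r : ℝ} (hr : 0 ≤ r) : 0 < Real.log (2 + r) := Real.log_pos (by linarith)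

theorem diskFace_memLp_weighted (hc : 0 < c) {f : ℝ × ℝ → ℝ} :
    MemLp f 2 (diskFace c).weighted ↔
      MemLp (fun p : ℝ × ℝ => diskWeight c p.1 * f p) 2 strip := by
  have hr : ∀ t : ℝ, 0 ≤ c * (2 / Real.sqrt 3) * |t| := fun t => by positivity
  simp only [Face.weighted, diskFace_norm_X hc]
  rw [memLp_withDensity_iff (ρ := fun p : ℝ × ℝ => (1 + (c * (2 / Real.sqrt 3) * |p.1|) ^ 2)⁻¹ *
      ((Real.log (2 + c * (2 / Real.sqrt 3) * |p.1|)) ^ 2)⁻¹) (by fun_prop)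
    (ae_of_all _ fun p => by have := log_two_add_pos (hr p.1); positivity), diskFace_memLp_area hc]
  simp only [smul_eq_mul, diskWeight, mul_assoc]

theorem continuous_diskWeight (hc : 0 < c) : Continuous (diskWeight c) := by
  have hr : ∀ t : ℝ, 0 ≤ c * (2 / Real.sqrt 3) * |t| := fun t => by positivity
  unfold diskWeight
  refine (continuous_disk_weight c).mul (Real.continuous_sqrt.comp ?_)
  refine Continuous.mul ?_ ?_
  · exact Continuous.inv₀ (by fun_prop) fun t => by positivity
  · refine Continuous.inv₀ ((Continuous.log (by fun_prop) fun t => ?_).pow 2) fun t => ?_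
    · have := hr t; positivity
    · have := log_two_add_pos (hr t); positivity

theorem weight_diskWeight (hc : 0 < c) : Weight (Ioc 0 1) (Ioo 0 1) (diskWeight c) := by
  have hr : ∀ t : ℝ, 0 ≤ c * (2 / Real.sqrt 3) * |t| := fun t => by positivity
  refine weight_disk (continuous_diskWeight hc) fun t ht => ?_
  have := disk_weight_pos hc t ht
  have := log_two_add_pos (hr t)
  unfold diskWeight
  positivity

/-- A function on the disk with vanishing weak gradient and trace vanishes. -/
theorem diskFace_eq_zero_of_grad (hc : 0 < c) (h : (diskFace c).IsSobolev u V g)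
    (hV : ∀ᵐ p ∂(diskFace c).param, V p = 0) (hg : ∀ᵐ θ ∂Face.cparam, g θ = 0) :
    ∀ᵐ p ∂(diskFace c).param, u p = 0 := by
  have hu := (diskFace_memLp_weighted hc).1 h.memU
  rw [diskFace_param]
  refine (weight_diskWeight hc).ae_eq_zero hu fun k ρ hρ hs hU => ?_
  -- Now the primitive is based at the centre: `ρ` is supported in (0, 1), so `P` vanishes near t =
  -- 0 and gives an admissible test function. It may be nonzero at t = 1, where the vanishing trace
  -- absorbs it.
  set P : ℝ → ℝ := fun t => ∫ s in (0 : ℝ)..t, ρ s with hP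
  have hPd : ∀ t, HasDerivAt P (ρ t) t := fun t =>
    intervalIntegral.integral_hasDerivAt_right (hρ.continuous.intervalIntegrable _ _)
      (hρ.continuous.stronglyMeasurableAtFilter _ _) hρ.continuous.continuousAt
  have hPs : ContDiff ℝ ∞ P := by
    rw [contDiff_infty_iff_deriv]
    refine ⟨fun t => (hPd t).differentiableAt, ?_⟩
    rwa [show deriv P = ρ from funext fun t => (hPd t).deriv]
  obtain ⟨α, hα0, hα⟩ : ∃ α, 0 < α ∧ ∀ t, t ≤ α → ρ t = 0 := by
    rcases (tsupport ρ).eq_empty_or_nonempty with he | hne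
    · exact ⟨1, one_pos, fun t _ => image_eq_zero_of_notMem_tsupport (by simp [he])⟩
    · obtain ⟨m, hm, hmin⟩ := hs.isCompact.exists_isLeast hne
      refine ⟨m / 2, by linarith [(hU hm).1], fun t ht => image_eq_zero_of_notMem_tsupport fun h1 => ?_⟩
      have := hmin h1
      linarith [(hU hm).1]
  have hPα : ∀ t, t ≤ α → P t = 0 := fun t ht => by
    have h1 : EqOn ρ (fun _ => (0 : ℝ)) (uIcc 0 t) := fun s hs =>
      hα s (hs.2.trans (max_le hα0.le ht))
    simp only [hP, intervalIntegral.integral_congr h1, intervalIntegral.integral_zero]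
  -- The cutoff acts only between t = 2 and t = 3, outside the disk.
  set η : ℝ → ℝ := fun t => Real.smoothTransition (3 - t) * P t with hη
  have hηP : ∀ t, t ≤ 2 → η t = P t := fun t ht => by
    simp [hη, Real.smoothTransition.one_of_one_le (show 1 ≤ 3 - t by linarith)]
  have hηs : ContDiff ℝ ∞ η :=
    (Real.smoothTransition.contDiff.comp (contDiff_const.sub contDiff_id)).mul hPs
  have hηsupp : Function.support η ⊆ Icc α 3 := by
    intro t ht
    constructor
    · by_contra h1
      exact ht (by simp [hη, hPα t (not_le.1 h1).le])
    · by_contra h1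
      exact ht (by
        simp [hη, Real.smoothTransition.zero_of_nonpos (show 3 - t ≤ 0 by linarith [not_le.1 h1])])
  have hηt : tsupport η ⊆ Icc α 3 := closure_minimal hηsupp isClosed_Icc
  have hηc : HasCompactSupport η := isCompact_Icc.of_isClosed_subset (isClosed_tsupport η) hηt
  have h1 := h.weakT _ ((diskFace c).isTest_mul_cas hηs hηc
    (fun t ht => hα0.trans_le (hηt ht).1) k)
  have e1 : ∫ p, inner ℝ (V p) (pdt (diskFace c).X p) * (η p.1 * cas k p.2) ∂(diskFace c).param = 0 :=
    integral_eq_zero_of_ae (by filter_upwards [hV] with p hp; simp [hp])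
  have e2 : ∫ θ, g θ * (η ((diskFace c).bdry, θ).1 * cas k ((diskFace c).bdry, θ).2) ∂Face.cparam = 0 :=
    integral_eq_zero_of_ae (by filter_upwards [hg] with p hp; simp [hp])
  rw [e1, e2, mul_zero, neg_zero, add_zero] at h1
  refine Eq.trans ?_ h1
  rw [diskFace_param]
  refine integral_congr_ae ?_
  filter_upwards [ae_strip] with p hp
  rw [Face.pdt_mul_cas hηs]
  have : deriv η p.1 = ρ p.1 := by
    rw [← (hPd p.1).deriv]
    refine Filter.EventuallyEq.deriv_eq ?_
    filter_upwards [gt_mem_nhds (show p.1 < 2 by linarith [hp.2])] with s hs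
    exact hηP s hs.le
  rw [this]

end Uniqueness

/-! ### Construction of explicit elements on the ends. -/

theorem Face.integrableOn_of_continuous (F : Face) {f : ℝ × ℝ → ℝ} (hf : Continuous f) {K : Set ℝ}
    (hK : IsCompact K) : IntegrableOn f (K ×ˢ univ) F.param := by
  have h1 : IntegrableOn f (K ×ˢ Icc 0 (2 * Real.pi)) :=
    hf.continuousOn.integrableOn_compact (hK.prod isCompact_Icc)
  refine Integrable.mono_measure h1 ?_
  rw [Face.param, Measure.restrict_restrict (hK.measurableSet.prod MeasurableSet.univ)]
  refine Measure.restrict_mono ?_ le_rfl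
  rintro ⟨t, θ⟩ ⟨h2, h3⟩
  exact ⟨h2.1, h3.2.1.le, h3.2.2⟩

theorem Face.IsTest.hasDerivAt_t {F : Face} {φ : ℝ × ℝ → ℝ} (h : F.IsTest φ) (t θ : ℝ) :
    HasDerivAt (fun s => φ (s, θ)) (pdt φ (t, θ)) t := by
  have : DifferentiableAt ℝ (fun s => φ (s, θ)) t :=
    ((h.smooth.differentiable (by simp)) (t, θ)).comp t (by fun_prop)
  exact this.hasDerivAt

theorem Face.IsTest.hasDerivAt_θ {F : Face} {φ : ℝ × ℝ → ℝ} (h : F.IsTest φ) (t θ : ℝ) :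
    HasDerivAt (fun s => φ (t, s)) (pdθ φ (t, θ)) θ := by
  have : DifferentiableAt ℝ (fun s => φ (t, s)) θ :=
    ((h.smooth.differentiable (by simp)) (t, θ)).comp θ (by fun_prop)
  exact this.hasDerivAt

/-- Integration by parts over one period. -/
theorem Face.IsTest.integral_period {F : Face} {φ : ℝ × ℝ → ℝ} (h : F.IsTest φ) (k : ℤ) (t : ℝ) :
    ∫ θ, (cas k θ * pdθ φ (t, θ) + k * cas (-k) θ * φ (t, θ)) ∂Face.cparam = 0 := by
  rw [Face.cparam, ← intervalIntegral.integral_of_le Real.two_pi_pos.le]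
  have hd : ∀ θ, HasDerivAt (fun θ => cas k θ * φ (t, θ))
      (cas k θ * pdθ φ (t, θ) + k * cas (-k) θ * φ (t, θ)) θ := fun θ => by
    convert! (hasDerivAt_cas k θ).mul (h.hasDerivAt_θ t θ) using 1
    ring
  have hc : Continuous fun θ => cas k θ * pdθ φ (t, θ) + k * cas (-k) θ * φ (t, θ) :=
    ((contDiff_cas k).continuous.mul (h.cont_pdθ.comp (by fun_prop))).add
      ((continuous_const.mul (contDiff_cas (-k)).continuous).mul
        (h.smooth.continuous.comp (by fun_prop)))
  rw [intervalIntegral.integral_eq_sub_of_hasDerivAt (fun θ _ => hd θ) (hc.intervalIntegrable _ _)]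
  have h1 := h.periodic t 0
  have h2 := cas_periodic k 0
  rw [zero_add] at h1 h2
  rw [h1, h2, sub_self]

section Catenoid

variable {c ε : ℝ}

/-- The tangential vector field on a catenoidal end with given components. -/
def catVec (c ε : ℝ) (P Q : ℝ × ℝ → ℝ) (p : ℝ × ℝ) : E3 :=
  ((c * Real.cosh (p.1 + T₀)) ^ 2)⁻¹ •
    (P p • pdt (catFace c ε).X p + Q p • pdθ (catFace c ε).X p)

theorem catFace_inner_pdt_pdθ (p : ℝ × ℝ) :
    inner ℝ (pdt (catFace c ε).X p) (pdθ (catFace c ε).X p) = 0 := by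
  rw [catFace_pdt, catFace_pdθ, smul_vec, smul_vec, inner_vec]
  ring

theorem compT_catVec (hc : 0 < c) (hε : ε ^ 2 = 1) (P Q : ℝ × ℝ → ℝ) (p : ℝ × ℝ) :
    (catFace c ε).compT (catVec c ε P Q) p = P p := by
  have := Real.cosh_pos (p.1 + T₀)
  rw [Face.compT, catVec, real_inner_smul_left, inner_add_left, real_inner_smul_left,
    real_inner_smul_left, real_inner_self_eq_norm_sq, catFace_norm_pdt hc hε, real_inner_comm,
    catFace_inner_pdt_pdθ]
  field_simp
  ring

theorem compθ_catVec (hc : 0 < c) (P Q : ℝ × ℝ → ℝ) (p : ℝ × ℝ) :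
    (catFace c ε).compθ (catVec c ε P Q) p = Q p := by
  have := Real.cosh_pos (p.1 + T₀)
  rw [Face.compθ, catVec, real_inner_smul_left, inner_add_left, real_inner_smul_left,
    real_inner_smul_left, real_inner_self_eq_norm_sq, catFace_norm_pdθ hc, catFace_inner_pdt_pdθ]
  field_simp
  ring

theorem catVec_tangent (hc : 0 < c) (hε : ε ^ 2 = 1) (P Q : ℝ × ℝ → ℝ) (p : ℝ × ℝ) :
    inner ℝ (catVec c ε P Q p) ((catFace c ε).normal p) = 0 := by
  have := Real.cosh_pos (p.1 + T₀)
  have htr := Real.sin_sq_add_cos_sq p.2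
  rw [catVec, real_inner_smul_left, inner_add_left, real_inner_smul_left,
    real_inner_smul_left, catFace_normal hc hε, catFace_pdt, catFace_pdθ, smul_vec, smul_vec,
    inner_vec, inner_vec]
  field_simp
  linear_combination (-P p * Real.sinh (p.1 + T₀) * ε) * htr

theorem continuous_catVec (hc : 0 < c) {P Q : ℝ × ℝ → ℝ} (hP : Continuous P) (hQ : Continuous Q) :
    Continuous (catVec c ε P Q) := by
  refine Continuous.smul (Continuous.inv₀ (by fun_prop : Continuous fun p : ℝ × ℝ =>
    (c * Real.cosh (p.1 + T₀)) ^ 2) fun p => ?_)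
    ((hP.smul (continuous_catFace_pdt c ε)).add (hQ.smul (continuous_catFace_pdθ c ε)))
  have := Real.cosh_pos (p.1 + T₀)
  positivity

theorem memLp_catVec (hc : 0 < c) (hε : ε ^ 2 = 1) {P Q : ℝ × ℝ → ℝ} (hP : Continuous P)
    (hQ : Continuous Q) (mP : MemLp P 2 cylinder) (mQ : MemLp Q 2 cylinder) :
    MemLp (catVec c ε P Q) 2 (catFace c ε).area := by
  rw [catFace_memLp_area hc hε]
  have hm : Continuous fun p : ℝ × ℝ => (c * Real.cosh (p.1 + T₀)) • catVec c ε P Q p :=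
    Continuous.smul (by fun_prop : Continuous fun p : ℝ × ℝ => c * Real.cosh (p.1 + T₀))
      (continuous_catVec hc hP hQ)
  refine (mP.norm.add mQ.norm).mono hm.aestronglyMeasurable (ae_of_all _ fun p => ?_)
  have := Real.cosh_pos (p.1 + T₀)
  rw [catVec, smul_smul, norm_smul]
  have h1 : ‖P p • pdt (catFace c ε).X p + Q p • pdθ (catFace c ε).X p‖ ≤
      (‖P p‖ + ‖Q p‖) * (c * Real.cosh (p.1 + T₀)) := by
    refine (norm_add_le _ _).trans (le_of_eq ?_)
    rw [norm_smul, norm_smul, catFace_norm_pdt hc hε, catFace_norm_pdθ hc]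
    ring
  rw [Real.norm_of_nonneg (by positivity)]
  calc c * Real.cosh (p.1 + T₀) * ((c * Real.cosh (p.1 + T₀)) ^ 2)⁻¹ * _
      ≤ c * Real.cosh (p.1 + T₀) * ((c * Real.cosh (p.1 + T₀)) ^ 2)⁻¹ *
        ((‖P p‖ + ‖Q p‖) * (c * Real.cosh (p.1 + T₀))) :=
        mul_le_mul_of_nonneg_left h1 (by positivity)
    _ = ‖P p‖ + ‖Q p‖ := by field_simp
    _ ≤ ‖((fun x => ‖P x‖) + fun x => ‖Q x‖) p‖ := Real.le_norm_self _

theorem catFace_norm_X (c ε : ℝ) (hε : ε ^ 2 = 1) (p : ℝ × ℝ) :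
    ‖(catFace c ε).X p‖ ^ 2 = c ^ 2 * (Real.cosh (p.1 + T₀) ^ 2 + p.1 ^ 2) := by
  rw [show (catFace c ε).X p = c • !₂[Real.cosh (p.1 + T₀) * Real.cos p.2,
    Real.cosh (p.1 + T₀) * Real.sin p.2, ε * p.1] from rfl, smul_vec, norm_vec,
    Real.sq_sqrt (by positivity)]
  linear_combination c ^ 2 * Real.cosh (p.1 + T₀) ^ 2 * Real.sin_sq_add_cos_sq p.2 +
    c ^ 2 * p.1 ^ 2 * hε

/-- Logarithmic growth of `log (2 + |x|)` along a catenoidal end. -/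
theorem exists_le_log (hc : 0 < c) : ∃ δ, 0 < δ ∧ ∀ t, 0 ≤ t →
    δ * (1 + t) ≤ Real.log (2 + c * Real.cosh (t + T₀)) := by
  -- m ≤ c/2 gives m eᵗ ≤ c cosh(t + T₀), and m ≤ 1 is needed for Bernoulli's inequality.
  set m := min (c / 2) 1 with hm
  have hm0 : 0 < m := lt_min (by linarith) one_pos
  have hl := Real.log_pos one_lt_two
  refine ⟨min (Real.log 2) m / 2, by positivity, fun t ht => ?_⟩
  have h1 : m * Real.exp t ≤ c * Real.cosh (t + T₀) := by
    have h2 : Real.exp t ≤ Real.exp (t + T₀) := Real.exp_le_exp.2 (by linarith [T₀_pos])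
    have h3 := Real.exp_pos (-(t + T₀))
    have h4 : m ≤ c / 2 := min_le_left _ _
    rw [Real.cosh_eq]
    nlinarith [Real.exp_pos t]
  -- Bernoulli with an exponent at most one: (1 + (eᵗ - 1))ᵐ ≤ 1 + m (eᵗ - 1).
  have h5 : Real.exp (t * m) ≤ 2 + m * Real.exp t := by
    have := _root_.rpow_one_add_le_one_add_mul_self (s := Real.exp t - 1)
      (by linarith [Real.exp_pos t]) hm0.le (min_le_right _ _ : m ≤ 1)
    rw [add_sub_cancel, ← Real.exp_mul] at this
    linarith
  have h6 : t * m ≤ Real.log (2 + c * Real.cosh (t + T₀)) := by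
    rw [Real.le_log_iff_exp_le (by positivity [Real.cosh_pos (t + T₀)])]
    linarith
  have h7 : Real.log 2 ≤ Real.log (2 + c * Real.cosh (t + T₀)) :=
    Real.log_le_log two_pos (by have := Real.cosh_pos (t + T₀); nlinarith)
  have h8 : min (Real.log 2) m ≤ Real.log 2 := min_le_left _ _
  have h9 : min (Real.log 2) m * t ≤ m * t := mul_le_mul_of_nonneg_right (min_le_right _ _) ht
  linarith

/-- The factor (1 + |x|²)⁻¹ compensates the area density (c cosh)², and the logarithmic factor
decays like (1 + t)⁻², since log(2 + |x|) grows at least linearly in t. So the weighted measure of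
an end is finite, which is what admits the non-decaying tanh. -/
theorem catFace_memLp_weighted (hc : 0 < c) (hε : ε ^ 2 = 1) {f : ℝ × ℝ → ℝ} (hf : Continuous f)
    {C : ℝ} (hb : ∀ p : ℝ × ℝ, 0 ≤ p.1 → |f p| ≤ C) : MemLp f 2 (catFace c ε).weighted := by
  obtain ⟨δ, hδ, hlog⟩ := exists_le_log hc
  have hXc : Continuous (catFace c ε).X := by
    rw [show (catFace c ε).X = fun p : ℝ × ℝ => c • !₂[Real.cosh (p.1 + T₀) * Real.cos p.2,
      Real.cosh (p.1 + T₀) * Real.sin p.2, ε * p.1] from rfl]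
    simp only [smul_vec]
    fun_prop
  have hl : ∀ p, 0 < Real.log (2 + ‖(catFace c ε).X p‖) := fun p => log_two_add_pos (norm_nonneg _)
  have hρ : Continuous fun p => (1 + ‖(catFace c ε).X p‖ ^ 2)⁻¹ *
      ((Real.log (2 + ‖(catFace c ε).X p‖)) ^ 2)⁻¹ := by
    refine Continuous.mul (Continuous.inv₀ (by fun_prop) fun p => by positivity)
      (Continuous.inv₀ ((Continuous.log (by fun_prop) fun p => ?_).pow 2) fun p => ?_)
    · have := norm_nonneg ((catFace c ε).X p); positivity
    · have := hl p; positivity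
  rw [Face.weighted, memLp_withDensity_iff hρ.measurable
    (ae_of_all _ fun p => by have := hl p; positivity), catFace_memLp_area hc hε]
  have hg : MemLp (fun t : ℝ => (Real.sqrt (1 + t ^ 2))⁻¹) 2 (volume.restrict (Ioi 0)) := by
    refine (memLp_two_iff (by fun_prop)).2 ?_
    refine integrable_inv_one_add_sq.restrict.congr (ae_of_all _ fun t => ?_)
    simp only [inv_pow]
    rw [Real.sq_sqrt (by positivity)]
  -- `cas 0` is the constant 1; it turns a majorant in `t` into one on the cylinder.
  have hg2 := memLp_mul_snd hg (memLp_cas 0)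
  refine MemLp.of_le_mul (c := C / δ) hg2 ?_ ?_
  · exact (Continuous.smul (by fun_prop : Continuous fun p : ℝ × ℝ => c * Real.cosh (p.1 + T₀))
      ((Real.continuous_sqrt.comp hρ).smul hf)).aestronglyMeasurable
  · have hpos : ∀ᵐ p ∂cylinder, 0 ≤ p.1 :=
      Measure.quasiMeasurePreserving_fst.ae ((ae_restrict_mem measurableSet_Ioi).mono
        fun t ht => le_of_lt ht)
    filter_upwards [hpos] with p hp
    have hch := Real.cosh_pos (p.1 + T₀)
    have hX := catFace_norm_X c ε hε p
    have hX1 : c * Real.cosh (p.1 + T₀) ≤ ‖(catFace c ε).X p‖ :=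
      le_of_sq_le_sq (by rw [hX]; nlinarith [sq_nonneg (c * p.1)]) (norm_nonneg _)
    have h1 : δ * (1 + p.1) ≤ Real.log (2 + ‖(catFace c ε).X p‖) :=
      (hlog _ hp).trans (Real.log_le_log (by positivity) (by linarith))
    have h2 : δ * Real.sqrt (1 + p.1 ^ 2) ≤ Real.log (2 + ‖(catFace c ε).X p‖) := by
      refine le_trans (mul_le_mul_of_nonneg_left ?_ hδ.le) h1
      rw [Real.sqrt_le_left (by linarith)]
      nlinarith
    have hs : 0 < Real.sqrt (1 + p.1 ^ 2) := Real.sqrt_pos.2 (by positivity)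
    have h3 : Real.sqrt ((1 + ‖(catFace c ε).X p‖ ^ 2)⁻¹ *
        ((Real.log (2 + ‖(catFace c ε).X p‖)) ^ 2)⁻¹) ≤
        (c * Real.cosh (p.1 + T₀))⁻¹ * (δ * Real.sqrt (1 + p.1 ^ 2))⁻¹ := by
      rw [Real.sqrt_le_left (by positivity), mul_pow, inv_pow, inv_pow]
      refine mul_le_mul (inv_anti₀ (by positivity) ?_) (inv_anti₀ (by positivity) ?_)
        (by positivity) (by positivity)
      · have := pow_le_pow_left₀ (by positivity) hX1 2
        linarith
      · exact pow_le_pow_left₀ (by positivity) h2 2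
    rw [smul_eq_mul, smul_eq_mul, cas_zero, mul_one, norm_mul (c * _), norm_mul (Real.sqrt _),
      Real.norm_eq_abs (f p),
      Real.norm_of_nonneg (by positivity : 0 ≤ c * Real.cosh (p.1 + T₀)),
      Real.norm_of_nonneg (Real.sqrt_nonneg _), Real.norm_of_nonneg (inv_nonneg.2 hs.le)]
    calc _ ≤ c * Real.cosh (p.1 + T₀) * ((c * Real.cosh (p.1 + T₀))⁻¹ *
          (δ * Real.sqrt (1 + p.1 ^ 2))⁻¹ * C) := by
          have := hb p hp
          gcongr
      _ = C / δ * (Real.sqrt (1 + p.1 ^ 2))⁻¹ := by field_simp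

/-- Products of a function of `t` and a trigonometric function belong to the Sobolev space. -/
theorem isSobolev_mul_cas (hc : 0 < c) (hε : ε ^ 2 = 1) {a a' : ℝ → ℝ} {k : ℤ}
    (ha : ∀ t, HasDerivAt a (a' t) t) (ha' : Continuous a') (hb : ∀ t, 0 ≤ t → |a t| ≤ 1)
    (m' : MemLp a' 2 (volume.restrict (Ioi 0)))
    (hk : k = 0 ∨ MemLp a 2 (volume.restrict (Ioi 0))) :
    (catFace c ε).IsSobolev (fun p => a p.1 * cas k p.2)
      (catVec c ε (fun p => a' p.1 * cas k p.2) fun p => a p.1 * (k * cas (-k) p.2))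
      (fun θ => a 0 * cas k θ) := by
  have hac : Continuous a := continuous_iff_continuousAt.2 fun t => (ha t).continuousAt
  have hcas := fun k => (contDiff_cas k).continuous
  have cu : Continuous fun p : ℝ × ℝ => a p.1 * cas k p.2 :=
    (hac.comp continuous_fst).mul ((hcas k).comp continuous_snd)
  have cP : Continuous fun p : ℝ × ℝ => a' p.1 * cas k p.2 :=
    (ha'.comp continuous_fst).mul ((hcas k).comp continuous_snd)
  have cQ : Continuous fun p : ℝ × ℝ => a p.1 * (k * cas (-k) p.2) :=
    (hac.comp continuous_fst).mul (continuous_const.mul ((hcas (-k)).comp continuous_snd))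
  have hbu : ∀ p : ℝ × ℝ, 0 ≤ p.1 → |a p.1 * cas k p.2| ≤ 2 := fun p hp => by
    rw [abs_mul]
    nlinarith [hb p.1 hp, abs_cas_le k p.2, abs_nonneg (a p.1), abs_nonneg (cas k p.2)]
  have mP : MemLp (fun p : ℝ × ℝ => a' p.1 * cas k p.2) 2 cylinder := memLp_mul_snd m' (memLp_cas k)
  have mQ : MemLp (fun p : ℝ × ℝ => a p.1 * (k * cas (-k) p.2)) 2 cylinder := by
    rcases hk with hk | hk
    · simp [hk]
    · exact memLp_mul_snd hk ((memLp_cas (-k)).const_mul _)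
  have mg : MemLp (fun θ => a 0 * cas k θ) 2 Face.cparam := (memLp_cas k).const_mul _
  have eT : ∀ p, inner ℝ (catVec c ε (fun p => a' p.1 * cas k p.2)
      (fun p => a p.1 * (k * cas (-k) p.2)) p) (pdt (catFace c ε).X p) = a' p.1 * cas k p.2 :=
    fun p => compT_catVec hc hε _ _ p
  have eθ : ∀ p, inner ℝ (catVec c ε (fun p => a' p.1 * cas k p.2)
      (fun p => a p.1 * (k * cas (-k) p.2)) p) (pdθ (catFace c ε).X p) =
        a p.1 * (k * cas (-k) p.2) :=
    fun p => compθ_catVec hc _ _ p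
  refine ⟨catFace_memLp_weighted hc hε cu hbu, memLp_catVec hc hε cP cQ mP mQ,
    (catFace_memLp_length hc).2 mg, ?_, ?_, ae_of_all _ fun p => catVec_tangent hc hε _ _ p,
    fun K hK _ => Face.integrableOn_of_continuous _ cu hK, fun K hK _ => ?_, fun K hK _ => ?_,
    mg.integrable (by norm_num), fun φ hφ => ?_, fun φ hφ => ?_⟩
  · rw [catFace_memLp_area hc hε]
    refine MemLp.of_le_mul (c := Real.sqrt 2 * 2) (memLp_mul_snd memLp_sech (memLp_cas 0)) ?_ ?_
    · have : Continuous fun p : ℝ × ℝ => (c * Real.cosh (p.1 + T₀)) •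
          ((catFace c ε).normA p * (a p.1 * cas k p.2)) := by
        simp only [catFace_normA hc hε]
        refine Continuous.smul (by fun_prop : Continuous fun p : ℝ × ℝ => c * Real.cosh (p.1 + T₀))
          (Continuous.mul ?_ cu)
        exact (continuous_const.mul ((continuous_sech.comp continuous_fst).pow 2)).div_const _
      exact this.aestronglyMeasurable
    · have hpos : ∀ᵐ p ∂cylinder, 0 ≤ p.1 :=
        Measure.quasiMeasurePreserving_fst.ae ((ae_restrict_mem measurableSet_Ioi).mono
          fun t ht => le_of_lt ht)
      filter_upwards [hpos] with p hp
      have hch := Real.cosh_pos (p.1 + T₀)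
      have e : (c * Real.cosh (p.1 + T₀)) • ((catFace c ε).normA p * (a p.1 * cas k p.2)) =
          Real.sqrt 2 * (a p.1 * cas k p.2) * sech p.1 := by
        rw [catFace_normA hc hε, smul_eq_mul, sech]
        field_simp
      rw [e, cas_zero, mul_one, norm_mul, norm_mul, Real.norm_of_nonneg (Real.sqrt_nonneg 2)]
      have := hbu p hp
      rw [← Real.norm_eq_abs] at this
      gcongr
  · rw [catFace_memLp_length hc]
    simp only [catFace_curvNu hc hε]
    exact mg.const_mul _
  · simp only [eT]
    exact Face.integrableOn_of_continuous _ cP hK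
  · simp only [eθ]
    exact Face.integrableOn_of_continuous _ cQ hK
  · simp only [eT]
    obtain ⟨K, hK, hKJ, h0, h1, -⟩ := hφ.exists_support
    have i1 := Face.integrable_mul_of_support hK
      ((catFace c ε).integrableOn_of_continuous cu hK) hφ.cont_pdt h1
    have i2 := Face.integrable_mul_of_support hK
      ((catFace c ε).integrableOn_of_continuous cP hK) hφ.smooth.continuous h0
    rw [← sub_eq_iff_eq_add', sub_neg_eq_add, ← integral_add i1 i2]
    have i3 := i1.add i2
    simp only [Pi.add_def] at i3
    rw [catFace_param] at i3 ⊢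
    rw [cylinder] at i3 ⊢
    -- For fixed θ the integrand is the `t`-derivative of a · cas · φ, which vanishes for large `t`.
    -- Only the value at t = 0 survives, with the sign given by `side`.
    rw [integral_prod_symm _ i3, ← integral_const_mul]
    congr 1
    funext θ
    have hd : ∀ t, HasDerivAt (fun t => a t * cas k θ * φ (t, θ))
        (a t * cas k θ * pdt φ (t, θ) + a' t * cas k θ * φ (t, θ)) t := fun t => by
      convert! ((ha t).mul_const (cas k θ)).mul (hφ.hasDerivAt_t t θ) using 1
      ring
    have cd : Continuous fun t => a t * cas k θ * pdt φ (t, θ) + a' t * cas k θ * φ (t, θ) :=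
      ((hac.mul continuous_const).mul (hφ.cont_pdt.comp (by fun_prop))).add
        ((ha'.mul continuous_const).mul (hφ.smooth.continuous.comp (by fun_prop)))
    have hcs : HasCompactSupport fun t =>
        a t * cas k θ * pdt φ (t, θ) + a' t * cas k θ * φ (t, θ) :=
      HasCompactSupport.intro hK fun t ht => by rw [h0 t θ ht, h1 t θ ht]; ring
    have hlim : Filter.Tendsto (fun t => a t * cas k θ * φ (t, θ)) Filter.atTop (nhds 0) := by
      refine tendsto_const_nhds.congr' ?_
      obtain ⟨R, hR⟩ := hK.bddAbove
      filter_upwards [Filter.eventually_gt_atTop R] with t ht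
      rw [h0 t θ fun h => absurd (hR h) (not_le.2 ht), mul_zero]
    have := integral_Ioi_of_hasDerivAt_of_tendsto' (a := 0) (fun t _ => hd t)
      (cd.integrable_of_hasCompactSupport hcs).integrableOn hlim
    rw [this]
    simp [catFace]
  · simp only [eθ]
    obtain ⟨K, hK, hKJ, h0, -, h2⟩ := hφ.exists_support
    have i1 := Face.integrable_mul_of_support hK
      ((catFace c ε).integrableOn_of_continuous cu hK) hφ.cont_pdθ h2
    have i2 := Face.integrable_mul_of_support hK
      ((catFace c ε).integrableOn_of_continuous cQ hK) hφ.smooth.continuous h0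
    rw [eq_neg_iff_add_eq_zero, ← integral_add i1 i2]
    have i3 := i1.add i2
    simp only [Pi.add_def] at i3
    rw [catFace_param] at i3 ⊢
    rw [cylinder] at i3 ⊢
    rw [integral_prod _ i3]
    refine integral_eq_zero_of_ae (ae_of_all _ fun t => ?_)
    have h3 : ∀ θ, a t * cas k θ * pdθ φ (t, θ) + a t * (k * cas (-k) θ) * φ (t, θ) =
        a t * (cas k θ * pdθ φ (t, θ) + k * cas (-k) θ * φ (t, θ)) := fun θ => by ring
    simp only [h3, integral_const_mul, hφ.integral_period, mul_zero, Pi.zero_apply]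

end Catenoid

theorem Face.IsSobolev.exists_sobolev {F : Face} {u : ℝ × ℝ → ℝ} {V : ℝ × ℝ → E3} {g : ℝ → ℝ}
    (h : F.IsSobolev u V g) (hu : Continuous u) (hV : Continuous V) (hg : Continuous g) :
    ∃ E : F.sobolev, E.1.1 =ᵐ[F.param] u ∧ E.1.2.1 =ᵐ[F.param] V ∧ E.1.2.2 =ᵐ[Face.cparam] g :=
  ⟨⟨(AEEqFun.mk u hu.aestronglyMeasurable, AEEqFun.mk V hV.aestronglyMeasurable,
    AEEqFun.mk g hg.aestronglyMeasurable), h.congr (AEEqFun.coeFn_mk _ _).symm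
      (AEEqFun.coeFn_mk _ _).symm (AEEqFun.coeFn_mk _ _).symm⟩,
    AEEqFun.coeFn_mk _ _, AEEqFun.coeFn_mk _ _, AEEqFun.coeFn_mk _ _⟩

section Catenoid

variable {c ε : ℝ}

/-- `E` is the element of the Sobolev space of a catenoidal end given by `a(t) cas k(θ)`. -/
structure IsProduct (E : (catFace c ε).sobolev) (a a' : ℝ → ℝ) (k : ℤ) : Prop where
  fn : E.1.1 =ᵐ[cylinder] fun p => a p.1 * cas k p.2
  grad : E.1.2.1 =ᵐ[cylinder] catVec c ε (fun p => a' p.1 * cas k p.2)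
    fun p => a p.1 * (k * cas (-k) p.2)
  trace : E.1.2.2 =ᵐ[Face.cparam] fun θ => a 0 * cas k θ

theorem exists_isProduct (hc : 0 < c) (hε : ε ^ 2 = 1) {a a' : ℝ → ℝ} {k : ℤ}
    (ha : ∀ t, HasDerivAt a (a' t) t) (ha' : Continuous a') (hb : ∀ t, 0 ≤ t → |a t| ≤ 1)
    (m' : MemLp a' 2 (volume.restrict (Ioi 0)))
    (hk : k = 0 ∨ MemLp a 2 (volume.restrict (Ioi 0))) :
    ∃ E : (catFace c ε).sobolev, IsProduct E a a' k := by
  have hac : Continuous a := continuous_iff_continuousAt.2 fun t => (ha t).continuousAt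
  have hcas := fun k => (contDiff_cas k).continuous
  obtain ⟨E, h1, h2, h3⟩ := (isSobolev_mul_cas hc hε ha ha' hb m' hk).exists_sobolev
    ((hac.comp continuous_fst).mul ((hcas k).comp continuous_snd))
    (continuous_catVec hc ((ha'.comp continuous_fst).mul ((hcas k).comp continuous_snd))
      ((hac.comp continuous_fst).mul (continuous_const.mul ((hcas (-k)).comp continuous_snd))))
    (continuous_const.mul (hcas k))
  exact ⟨E, catFace_ae.1 h1, catFace_ae.1 h2, h3⟩

theorem coef_congr {g g' : ℝ → ℝ} (h : g =ᵐ[Face.cparam] g') (k : ℤ) : coef g k = coef g' k :=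
  integral_congr_ae (by filter_upwards [h] with θ hθ; rw [hθ])

/-- Fubini projects the other argument onto its mode `k`. One factor of k² is the angular derivative
of the product, the other is the relation between the modes of the angular derivative and those of
the function. -/
theorem IsProduct.form_eq (hc : 0 < c) (hε : ε ^ 2 = 1) {E : (catFace c ε).sobolev} {a a' : ℝ → ℝ}
    {k : ℤ} (hE : IsProduct E a a' k) (ha : Continuous a) (hb : ∀ t, 0 ≤ t → |a t| ≤ 1)
    (m' : MemLp a' 2 (volume.restrict (Ioi 0)))
    (hk : k = 0 ∨ MemLp a 2 (volume.restrict (Ioi 0))) (W : (catFace c ε).sobolev) :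
    (catFace c ε).form E W =
      (∫ t in Ioi 0, (a' t * mode ((catFace c ε).compT W.1.2.1) k t +
        a t * (k ^ 2 * prim (coef W.1.2.2 k) (mode ((catFace c ε).compT W.1.2.1) k) t) -
        2 * sech t ^ 2 * (a t * prim (coef W.1.2.2 k)
          (mode ((catFace c ε).compT W.1.2.1) k) t))) - 1 / 2 * (a 0 * coef W.1.2.2 k) := by
  have h := catFace_cylSobolev hc hε W.2
  set p := (catFace c ε).compT W.1.2.1 with hp
  set q := (catFace c ε).compθ W.1.2.1 with hq
  have hsa : MemLp (fun t => sech t * a t) 2 (volume.restrict (Ioi 0)) := by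
    refine (memLp_bdd_mul (C := 1) memLp_sech ha.continuousOn fun t ht => hb t (le_of_lt ht)).ae_eq
      (ae_of_all _ fun t => mul_comm _ _)
  have hka : MemLp (fun t => k * a t) 2 (volume.restrict (Ioi 0)) := by
    rcases hk with hk | hk
    · simp [hk]
    · exact hk.const_mul _
  have i1 : Integrable (fun x => p x * (a' x.1 * cas k x.2)) cylinder :=
    h.memP.integrable_mul (memLp_mul_snd m' (memLp_cas k))
  have i2 : Integrable (fun x => q x * ((k * a x.1) * cas (-k) x.2)) cylinder :=
    h.memQ.integrable_mul (memLp_mul_snd hka (memLp_cas (-k)))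
  have i3 : Integrable (fun x => (sech x.1 * W.1.1 x) * ((sech x.1 * a x.1) * cas k x.2)) cylinder :=
    h.memU.integrable_mul (memLp_mul_snd hsa (memLp_cas k))
  rw [catFace_form hc hε]
  congr 1
  · have e1 : ∫ x, ((catFace c ε).compT E.1.2.1 x * p x + (catFace c ε).compθ E.1.2.1 x * q x -
        2 * (sech x.1 * E.1.1 x * (sech x.1 * W.1.1 x))) ∂cylinder =
        ∫ x, (p x * (a' x.1 * cas k x.2) + q x * ((k * a x.1) * cas (-k) x.2) -
          2 * ((sech x.1 * W.1.1 x) * ((sech x.1 * a x.1) * cas k x.2))) ∂cylinder := by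
      refine integral_congr_ae ?_
      filter_upwards [hE.fn, hE.grad] with x h1 h2
      have e2 : (catFace c ε).compT E.1.2.1 x = a' x.1 * cas k x.2 := by
        rw [← compT_catVec hc hε (fun p => a' p.1 * cas k p.2)
          (fun p => a p.1 * (k * cas (-k) p.2)) x, Face.compT, Face.compT, h2]
      have e3 : (catFace c ε).compθ E.1.2.1 x = a x.1 * (k * cas (-k) x.2) := by
        rw [← compθ_catVec (ε := ε) hc (fun p => a' p.1 * cas k p.2)
          (fun p => a p.1 * (k * cas (-k) p.2)) x, Face.compθ, Face.compθ, h2]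
      rw [e2, e3, h1]
      ring
    have i12 := i1.add i2
    simp only [Pi.add_def] at i12
    rw [e1, integral_sub i12 (i3.const_mul 2), integral_add i1 i2, integral_const_mul]
    rw [cylinder] at i1 i2 i3 ⊢
    rw [integral_mul_cas a' k i1, integral_mul_cas (fun t => k * a t) (-k) i2,
      integral_mul_cas (f := fun x => sech x.1 * W.1.1 x) (fun t => sech t * a t) k i3]
    have j1 : IntegrableOn (fun t => a' t * mode p k t) (Ioi 0) :=
      m'.integrable_mul (memLp_mode h.memP k)
    have j2 : IntegrableOn (fun t => k * a t * mode q (-k) t) (Ioi 0) :=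
      hka.integrable_mul (memLp_mode h.memQ (-k))
    have j3 : IntegrableOn (fun t => sech t * a t * mode (fun x => sech x.1 * W.1.1 x) k t)
      (Ioi 0) := hsa.integrable_mul (memLp_mode h.memU k)
    have j12 := j1.add j2
    simp only [Pi.add_def] at j12
    rw [← integral_const_mul, ← integral_add j1 j2, ← integral_sub j12 (j3.const_mul 2)]
    refine integral_congr_ae ?_
    filter_upwards [h.ae_mode_u k, h.ae_mode_q (-k)] with t h1 h2
    have e4 : mode (fun x => sech x.1 * W.1.1 x) k t = sech t * mode W.1.1 k t := by
      simp only [mode, coef]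
      rw [← integral_const_mul]
      congr 1
      funext θ
      ring
    rw [e4, h2, neg_neg, h1]
    push_cast
    ring
  · congr 1
    rw [coef, ← integral_const_mul]
    refine integral_congr_ae ?_
    filter_upwards [hE.trace] with θ h1
    rw [h1]
    ring

/-- The interior Jacobi equation leaves -3/4 of the zeroth trace coefficient, and the boundary term
adds -½ · tanh T₀ = -1/4. So tanh fails the natural boundary condition by a multiple of the mean,
which yields both the negative direction and the dilation null field. -/
theorem exists_tanh (hc : 0 < c) (hε : ε ^ 2 = 1) : ∃ E : (catFace c ε).sobolev,
    IsProduct E th (fun t => sech t ^ 2) 0 ∧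
      ∀ W : (catFace c ε).sobolev, (catFace c ε).form E W = -coef W.1.2.2 0 := by
  have m' : MemLp (fun t => sech t ^ 2) 2 (volume.restrict (Ioi 0)) :=
    (memLp_bdd_mul (C := 1) memLp_sech continuous_sech.continuousOn fun t _ => by
      rw [abs_of_pos (sech_pos t)]; exact sech_le_one t).ae_eq (ae_of_all _ fun t => by ring)
  obtain ⟨E, hE⟩ := exists_isProduct (ε := ε) (k := 0) hc hε hasDerivAt_th (continuous_sech.pow 2)
    (fun t _ => abs_th_le_one t) m' (Or.inl rfl)
  refine ⟨E, hE, fun W => ?_⟩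
  have h := catFace_cylSobolev hc hε W.2
  rw [hE.form_eq hc hε continuous_th (fun t _ => abs_th_le_one t) m' (Or.inl rfl) W, th_zero]
  have h1 := integral_jacobi_tanh (memLp_mode h.memP 0) (h.memLp_sech_prim 0)
  have h2 := h1
  simp only [Int.cast_zero, ne_eq, OfNat.ofNat_ne_zero, not_false_eq_true, zero_pow, zero_mul,
    mul_zero, add_zero]
  rw [h1]
  ring

/-- The contribution ½ sech(0) w₀ of the interior equation cancels the boundary term, so the
rotation field satisfies the natural boundary condition on each end separately. -/
theorem exists_sech (hc : 0 < c) (hε : ε ^ 2 = 1) {k : ℤ} (hk : k ^ 2 = 1) :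
    ∃ E : (catFace c ε).sobolev, IsProduct E sech (fun t => -(th t * sech t)) k ∧
      ∀ W : (catFace c ε).sobolev, (catFace c ε).form E W = 0 := by
  have m' : MemLp (fun t => -(th t * sech t)) 2 (volume.restrict (Ioi 0)) :=
    (memLp_bdd_mul (C := 1) memLp_sech continuous_th.continuousOn fun t _ => abs_th_le_one t).neg
  have hb : ∀ t, 0 ≤ t → |sech t| ≤ 1 := fun t _ => by
    rw [abs_of_pos (sech_pos t)]; exact sech_le_one t
  obtain ⟨E, hE⟩ := exists_isProduct (ε := ε) (k := k) hc hε hasDerivAt_sech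
    (continuous_th.mul continuous_sech).neg hb m' (Or.inr memLp_sech)
  refine ⟨E, hE, fun W => ?_⟩
  have h := catFace_cylSobolev hc hε W.2
  have hk0 : k ≠ 0 := fun h => by simp [h] at hk
  rw [hE.form_eq hc hε continuous_sech hb m' (Or.inr memLp_sech) W]
  have h1 := integral_jacobi_sech (memLp_mode h.memP k) (h.memLp_prim hk0)
  have hk' : (k : ℝ) ^ 2 = 1 := by exact_mod_cast hk
  simp only [hk', one_mul]
  rw [h1]
  ring

/-! ### A compactly supported direction of negative energy. -/

/-- A compactly supported profile on the half-line. -/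
def cutoff (t : ℝ) : ℝ := max 0 (1 - t / 16) ^ 2

theorem hasDerivAt_cutoff (t : ℝ) : HasDerivAt cutoff (-(max 0 (1 - t / 16) / 8)) t := by
  have h1 : HasDerivAt (fun t : ℝ => 1 - t / 16) (-(1 / 16)) t := by
    simpa using ((hasDerivAt_id t).div_const 16).const_sub 1
  rcases lt_trichotomy (1 - t / 16) 0 with h | h | h
  · have h2 : cutoff =ᶠ[nhds t] fun _ => 0 := by
      filter_upwards [h1.continuousAt.eventually (gt_mem_nhds h)] with s hs
      rw [cutoff, max_eq_left hs.le]; ring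
    rw [max_eq_left h.le]
    simpa using (hasDerivAt_const t (0 : ℝ)).congr_of_eventuallyEq h2
  · rw [h, max_self, zero_div, neg_zero, hasDerivAt_iff_isLittleO]
    have h0 : cutoff t = 0 := by simp [cutoff, h]
    simp only [h0, sub_zero, smul_zero]
    -- At the junction t = 16 the profile is squeezed between 0 and (s - 16)². Squaring the positive
    -- part is what makes it differentiable there.
    refine Asymptotics.IsBigO.trans_isLittleO (g := fun s => (s - t) ^ 2) ?_ ?_
    · refine Asymptotics.IsBigO.of_bound 1 (Filter.Eventually.of_forall fun s => ?_)
      rw [cutoff, Real.norm_of_nonneg (sq_nonneg _), Real.norm_of_nonneg (sq_nonneg _), one_mul]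
      have ht : t = 16 := by linarith
      rcases le_total (1 - s / 16) 0 with h3 | h3
      · rw [max_eq_left h3]; nlinarith [sq_nonneg (s - t)]
      · rw [max_eq_right h3, ht]; nlinarith [sq_nonneg (s - 16)]
    · have := (Asymptotics.isLittleO_pow_id (𝕜 := ℝ) (n := 2) one_lt_two).comp_tendsto
        (show Filter.Tendsto (fun s => s - t) (nhds t) (nhds 0) by
          simpa using (continuous_id.sub continuous_const).tendsto (f := fun s : ℝ => s - t) t)
      exact this
  · have h2 : cutoff =ᶠ[nhds t] fun s => (1 - s / 16) ^ 2 := by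
      filter_upwards [h1.continuousAt.eventually (lt_mem_nhds h)] with s hs
      rw [cutoff, max_eq_right (le_of_lt hs)]
    rw [max_eq_right h.le]
    refine HasDerivAt.congr_of_eventuallyEq ?_ h2
    convert! h1.pow 2 using 1
    ring

theorem cutoff_zero : cutoff 0 = 1 := by simp [cutoff]

theorem abs_cutoff_le {t : ℝ} (ht : 0 ≤ t) : |cutoff t| ≤ 1 := by
  have h1 : max 0 (1 - t / 16) ≤ 1 := max_le zero_le_one (by linarith)
  rw [cutoff, abs_of_nonneg (sq_nonneg _)]
  exact pow_le_one₀ (le_max_left _ _) h1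

theorem cutoff_eq_zero {t : ℝ} (ht : 16 ≤ t) : cutoff t = 0 := by
  rw [cutoff, max_eq_left (by linarith)]; ring

/-- The slope is at most 1/8 on an interval of length 16, giving 16/64 = 1/4. The length is chosen
to bring this below the boundary coefficient 1/2. -/
theorem integrable_cutoff_deriv_sq :
    IntegrableOn (fun t : ℝ => (-(max 0 (1 - t / 16) / 8)) ^ 2) (Ioi 0) ∧
      ∫ t in Ioi (0 : ℝ), (-(max 0 (1 - t / 16) / 8)) ^ 2 ≤ 1 / 4 := by
  have hc : Continuous fun t : ℝ => (-(max 0 (1 - t / 16) / 8)) ^ 2 := by fun_prop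
  have h0 : ∀ t ∈ Ioi (0 : ℝ) \ Ioc 0 16, (-(max 0 (1 - t / 16) / 8)) ^ 2 = 0 := fun t ht => by
    have : 16 < t := by
      by_contra h
      exact ht.2 ⟨ht.1, not_lt.1 h⟩
    rw [max_eq_left (by linarith)]
    norm_num
  have hi : IntegrableOn (fun t : ℝ => (-(max 0 (1 - t / 16) / 8)) ^ 2) (Ioc 0 16) :=
    (hc.integrableOn_Icc).mono_set Ioc_subset_Icc_self
  constructor
  · exact hi.of_forall_sdiff_eq_zero measurableSet_Ioi h0
  · rw [setIntegral_eq_of_subset_of_forall_sdiff_eq_zero measurableSet_Ioi Ioc_subset_Ioi_self h0]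
    have h1 : ∫ t in Ioc (0 : ℝ) 16, (-(max 0 (1 - t / 16) / 8)) ^ 2 ≤
        ∫ _t in Ioc (0 : ℝ) 16, (1 / 64 : ℝ) := by
      refine setIntegral_mono_on hi (integrableOn_const (by simp)) measurableSet_Ioc fun t ht => ?_
      have h1 : max 0 (1 - t / 16) ≤ 1 := max_le zero_le_one (by linarith [ht.1])
      have h2 : 0 ≤ max 0 (1 - t / 16) := le_max_left _ _
      nlinarith
    refine h1.trans ?_
    simp
    norm_num

theorem cparam_univ : Face.cparam.real univ = 2 * Real.pi := by
  rw [Face.cparam, measureReal_restrict_apply_univ]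
  simp [Real.pi_pos.le]

/-- A compactly supported element of negative energy. -/
theorem exists_cutoff (hc : 0 < c) (hε : ε ^ 2 = 1) : ∃ E : (catFace c ε).sobolev,
    IsProduct E cutoff (fun t => -(max 0 (1 - t / 16) / 8)) 0 ∧ (catFace c ε).form E E < 0 := by
  have hc' : Continuous fun t : ℝ => -(max 0 (1 - t / 16) / 8) := by fun_prop
  have m' : MemLp (fun t : ℝ => -(max 0 (1 - t / 16) / 8)) 2 (volume.restrict (Ioi 0)) :=
    (memLp_two_iff hc'.aestronglyMeasurable).2 integrable_cutoff_deriv_sq.1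
  obtain ⟨E, hE⟩ := exists_isProduct (ε := ε) (k := 0) hc hε hasDerivAt_cutoff hc'
    (fun t ht => abs_cutoff_le ht) m' (Or.inl rfl)
  refine ⟨E, hE, ?_⟩
  rw [catFace_form_self hc hε, cylEnergy]
  have h1 : ∫ x, (catFace c ε).compT E.1.2.1 x ^ 2 ∂cylinder ≤ 2 * Real.pi * (1 / 4) := by
    have e1 : ∫ x, (catFace c ε).compT E.1.2.1 x ^ 2 ∂cylinder =
        ∫ x : ℝ × ℝ, (-(max 0 (1 - x.1 / 16) / 8)) ^ 2 * 1 ∂cylinder := by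
      refine integral_congr_ae ?_
      filter_upwards [hE.grad] with x hx
      rw [Face.compT, hx]
      have := compT_catVec (ε := ε) hc hε (fun p => -(max 0 (1 - p.1 / 16) / 8) * cas 0 p.2)
        (fun p => cutoff p.1 * (((0 : ℤ) : ℝ) * cas (-0) p.2)) x
      rw [Face.compT] at this
      rw [this, cas_zero, mul_one, mul_one]
    rw [e1, cylinder, integral_prod_mul (f := fun t : ℝ => (-(max 0 (1 - t / 16) / 8)) ^ 2)
      (g := fun _ => (1 : ℝ)), integral_const, cparam_univ, smul_eq_mul, mul_one, mul_comm]
    exact mul_le_mul_of_nonneg_left integrable_cutoff_deriv_sq.2 Real.two_pi_pos.le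
  have h2 : ∫ x, (catFace c ε).compθ E.1.2.1 x ^ 2 ∂cylinder = 0 := by
    refine integral_eq_zero_of_ae ?_
    filter_upwards [hE.grad] with x hx
    rw [Face.compθ, hx]
    have := compθ_catVec (ε := ε) hc (fun p => -(max 0 (1 - p.1 / 16) / 8) * cas 0 p.2)
      (fun p => cutoff p.1 * (((0 : ℤ) : ℝ) * cas (-0) p.2)) x
    rw [Face.compθ] at this
    rw [this]
    simp
  have h3 : 0 ≤ ∫ x, (sech x.1 * E.1.1 x) ^ 2 ∂cylinder := integral_nonneg fun _ => sq_nonneg _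
  have h4 : ∫ θ, E.1.2.2 θ ^ 2 ∂Face.cparam = 2 * Real.pi := by
    have e1 : ∫ θ, E.1.2.2 θ ^ 2 ∂Face.cparam = ∫ _θ, (1 : ℝ) ∂Face.cparam := by
      refine integral_congr_ae ?_
      filter_upwards [hE.trace] with θ hθ
      rw [hθ, cutoff_zero, cas_zero]
      norm_num
    rw [e1, integral_const, cparam_univ, smul_eq_mul, mul_one]
  have := Real.pi_pos
  rw [h2, h4]
  -- The Dirichlet part is at most 2π/4 and the boundary part is -½ · 2π; the potential term can
  -- only lower the sum.
  linarith

end Catenoid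

/-! ### The index form and the constants on the disk. -/

section Disk

variable {c : ℝ}

theorem diskFace_form (hc : 0 < c) (U W : (diskFace c).sobolev) :
    (diskFace c).form U W = (∫ p, inner ℝ (U.1.2.1 p) (W.1.2.1 p) ∂(diskFace c).area) +
      ∫ θ, U.1.2.2 θ * W.1.2.2 θ ∂Face.cparam := by
  rw [Face.form, diskFace_length hc, integral_const_withDensity (by positivity)]
  simp only [diskFace_curvNu hc, diskFace_normA, integral_const_mul]
  rw [sub_eq_add_neg]
  congr 1
  · simp
  · field_simp

/-- Constants on the disk. -/
theorem diskFace_one (hc : 0 < c) : (diskFace c).IsSobolev (fun _ => 1) (fun _ => 0) fun _ => 1 := by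
  have : IsFiniteMeasure strip := by unfold strip; infer_instance
  have hm : MemLp (fun _ => (1 : ℝ)) 2 Face.cparam := memLp_const 1
  refine ⟨?_, MemLp.zero', (diskFace_memLp_length hc).2 hm, ?_, ?_, by simp,
    fun K hK _ => Face.integrableOn_of_continuous _ continuous_const hK, fun K _ _ => by simp,
    fun K _ _ => by simp, integrable_const 1, fun φ hφ => ?_, fun φ hφ => ?_⟩
  · rw [diskFace_memLp_weighted hc]
    have hw := continuous_diskWeight hc
    obtain ⟨C, hC⟩ := (isCompact_Icc (a := (0 : ℝ)) (b := 1)).exists_bound_of_continuousOn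
      hw.continuousOn
    refine MemLp.of_bound ((hw.comp continuous_fst).mul continuous_const).aestronglyMeasurable C ?_
    filter_upwards [ae_strip] with p hp
    simpa using hC p.1 ⟨hp.1.le, hp.2.le⟩
  · simp [diskFace_normA]
  · rw [diskFace_memLp_length hc]
    simp only [diskFace_curvNu hc]
    exact hm.const_mul _
  · obtain ⟨K, hK, hKJ, h0, h1, -⟩ := hφ.exists_support
    have i1 := Face.integrable_mul_of_support hK ((diskFace c).integrableOn_of_continuous
      (f := fun _ => 1) continuous_const hK) hφ.cont_pdt h1
    simp only [one_mul] at i1 ⊢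
    rw [diskFace_param] at i1 ⊢
    rw [strip] at i1 ⊢
    rw [integral_prod_symm _ i1]
    simp only [inner_zero_left, zero_mul, integral_zero, neg_zero, zero_add]
    rw [show (diskFace c).side = 1 from rfl, one_mul]
    congr 1
    funext θ
    have hd : ∀ t, HasDerivAt (fun t => φ (t, θ)) (pdt φ (t, θ)) t := fun t => hφ.hasDerivAt_t t θ
    have hcd : Continuous fun t => pdt φ (t, θ) := hφ.cont_pdt.comp (by fun_prop)
    rw [← intervalIntegral.integral_of_le zero_le_one,
      intervalIntegral.integral_eq_sub_of_hasDerivAt (fun t _ => hd t) (hcd.intervalIntegrable _ _),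
      h0 0 θ (fun h => absurd (show (0 : ℝ) < 0 from hKJ h) (lt_irrefl _)), sub_zero]
    rfl
  · obtain ⟨K, hK, hKJ, h0, -, h2⟩ := hφ.exists_support
    have i1 := Face.integrable_mul_of_support hK ((diskFace c).integrableOn_of_continuous
      (f := fun _ => 1) continuous_const hK) hφ.cont_pdθ h2
    simp only [one_mul, inner_zero_left, zero_mul, integral_zero, neg_zero] at i1 ⊢
    rw [diskFace_param] at i1 ⊢
    rw [strip] at i1 ⊢
    rw [integral_prod _ i1]
    refine integral_eq_zero_of_ae (ae_of_all _ fun t => ?_)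
    have := hφ.integral_period 0 t
    simpa [cas_zero] using this

end Disk

/-! ### Trigonometric coefficients of traces. -/

theorem integral_cos_int (n : ℤ) (hn : n ≠ 0) : ∫ θ, Real.cos (n * θ) ∂Face.cparam = 0 := by
  have hn' : (n : ℝ) ≠ 0 := by exact_mod_cast hn
  rw [Face.cparam, ← intervalIntegral.integral_of_le Real.two_pi_pos.le,
    intervalIntegral.integral_comp_mul_left (fun x => Real.cos x) hn', integral_cos]
  have : (n : ℝ) * (2 * Real.pi) = ((2 * n : ℤ) : ℝ) * Real.pi := by push_cast; ring
  rw [this, Real.sin_int_mul_pi]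
  simp

theorem integral_sin_int (n : ℤ) : ∫ θ, Real.sin (n * θ) ∂Face.cparam = 0 := by
  rcases eq_or_ne n 0 with rfl | hn
  · simp
  have hn' : (n : ℝ) ≠ 0 := by exact_mod_cast hn
  rw [Face.cparam, ← intervalIntegral.integral_of_le Real.two_pi_pos.le,
    intervalIntegral.integral_comp_mul_left (fun x => Real.sin x) hn', integral_sin,
    Real.cos_int_mul_two_pi]
  simp

/-- The product of two members of the system is cos((j - k)θ) + sin((j + k)θ), and only the cosine
with j = k has a nonzero mean. -/
theorem coef_cas (j k : ℤ) : coef (cas j) k = if j = k then 2 * Real.pi else 0 := by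
  have h : ∀ θ, cas j θ * cas k θ =
      Real.cos ((j - k : ℤ) * θ) + Real.sin ((j + k : ℤ) * θ) := fun θ => by
    have h1 : ((j - k : ℤ) : ℝ) * θ = j * θ - k * θ := by push_cast; ring
    have h2 : ((j + k : ℤ) : ℝ) * θ = j * θ + k * θ := by push_cast; ring
    rw [h1, h2, Real.cos_sub, Real.sin_add, cas, cas]
    ring
  have i1 : Integrable (fun θ => Real.cos ((j - k : ℤ) * θ)) Face.cparam :=
    Integrable.of_bound (by fun_prop) 1 (ae_of_all _ fun θ => Real.abs_cos_le_one _)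
  have i2 : Integrable (fun θ => Real.sin ((j + k : ℤ) * θ)) Face.cparam :=
    Integrable.of_bound (by fun_prop) 1 (ae_of_all _ fun θ => Real.abs_sin_le_one _)
  rw [coef]
  simp only [h]
  rw [integral_add i1 i2, integral_sin_int, add_zero]
  split_ifs with hjk
  · subst hjk
    simp [cparam_univ]
  · exact integral_cos_int _ (sub_ne_zero.2 hjk)

theorem Face.sobolev_eq_zero {F : Face} {U : F.sobolev} (hu : ∀ᵐ p ∂F.param, U.1.1 p = 0)
    (hV : ∀ᵐ p ∂F.param, U.1.2.1 p = 0) (hg : ∀ᵐ θ ∂Face.cparam, U.1.2.2 θ = 0) : U = 0 := by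
  refine Subtype.ext (Prod.ext (AEEqFun.ext ?_) (Prod.ext (AEEqFun.ext ?_) (AEEqFun.ext ?_)))
  · filter_upwards [hu, AEEqFun.coeFn_zero (α := ℝ × ℝ) (μ := F.param) (β := ℝ)] with p h1 h2
    rw [h1]; exact h2.symm
  · filter_upwards [hV, AEEqFun.coeFn_zero (α := ℝ × ℝ) (μ := F.param) (β := E3)] with p h1 h2
    rw [h1]; exact h2.symm
  · filter_upwards [hg, AEEqFun.coeFn_zero (α := ℝ) (μ := Face.cparam) (β := ℝ)] with p h1 h2
    rw [h1]; exact h2.symm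

theorem integrable_mul_cas_of_integrable {g : ℝ → ℝ} (hg : Integrable g Face.cparam) (k : ℤ) :
    Integrable (fun θ => g θ * cas k θ) Face.cparam :=
  hg.mul_bdd (c := 2) (contDiff_cas k).continuous.aestronglyMeasurable
    (ae_of_all _ fun θ => abs_cas_le k θ)

theorem coef_sum_eq_zero {g₁ g₂ g₃ : ℝ → ℝ} (h₁ : Integrable g₁ Face.cparam)
    (h₂ : Integrable g₂ Face.cparam) (h₃ : Integrable g₃ Face.cparam)
    (h : ∀ᵐ θ ∂Face.cparam, g₁ θ + g₂ θ + g₃ θ = 0) (k : ℤ) :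
    coef g₁ k + coef g₂ k + coef g₃ k = 0 := by
  have i₁ := integrable_mul_cas_of_integrable h₁ k
  have i₂ := integrable_mul_cas_of_integrable h₂ k
  have i₃ := integrable_mul_cas_of_integrable h₃ k
  have i₁₂ : Integrable (fun θ => g₁ θ * cas k θ + g₂ θ * cas k θ) Face.cparam := i₁.add i₂
  rw [coef, coef, coef, ← integral_add i₁ i₂, ← integral_add i₁₂ i₃]
  refine integral_eq_zero_of_ae ?_
  filter_upwards [h] with θ hθ
  rw [← add_mul, ← add_mul, hθ, zero_mul, Pi.zero_apply]

/-- Trigonometric coefficients of the trace. -/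
def Face.coefTrace (F : Face) (k : ℤ) : F.sobolev →ₗ[ℝ] ℝ where
  toFun U := coef U.1.2.2 k
  map_add' U U' := by
    rw [coef, coef, coef, ← integral_add (integrable_mul_cas_of_integrable U.2.locG k)
      (integrable_mul_cas_of_integrable U'.2.locG k)]
    refine integral_congr_ae ?_
    filter_upwards [AEEqFun.coeFn_add U.1.2.2 U'.1.2.2] with θ h
    have h' : (U + U').1.2.2 θ = U.1.2.2 θ + U'.1.2.2 θ := h
    rw [h', add_mul]
  map_smul' a U := by
    rw [coef, coef, RingHom.id_apply, smul_eq_mul, ← integral_const_mul]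
    refine integral_congr_ae ?_
    filter_upwards [AEEqFun.coeFn_smul a U.1.2.2] with θ h
    have h' : (a • U).1.2.2 θ = a * U.1.2.2 θ := h
    rw [h', mul_assoc]

theorem IsProduct.coefTrace {c ε : ℝ} {E : (catFace c ε).sobolev} {a a' : ℝ → ℝ} {k : ℤ}
    (hE : IsProduct E a a' k) (j : ℤ) :
    (catFace c ε).coefTrace j E = a 0 * if k = j then 2 * Real.pi else 0 := by
  change coef E.1.2.2 j = _
  rw [coef_congr hE.trace, ← coef_cas k j, coef, coef, ← integral_const_mul]
  congr 1
  funext θ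
  ring

/-! ### Triples on the Y-catenoid: the test element and the null vectors. -/

section Triple

variable {c : ℝ}

/-- The triple with the given components. -/
def mkTriple (D : (diskFace c).sobolev) (A : (catFace c 1).sobolev) (B : (catFace c (-1)).sobolev)
    (h : D.1.2.2 + A.1.2.2 + B.1.2.2 = 0) : (yCatenoid c).formDomain :=
  ⟨fun i => match i with
    | 0 => D
    | 1 => A
    | 2 => B, by
    change ∑ i : Fin 3, _ = _
    rw [Fin.sum_univ_three]
    exact h⟩

/-- The component on the disk. -/
def diskPart : (yCatenoid c).formDomain →ₗ[ℝ] (diskFace c).sobolev :=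
  (LinearMap.proj (R := ℝ) (φ := fun i => (yCatenoid c i).sobolev) 0).comp
    (yCatenoid c).formDomain.subtype

/-- The component on the upper catenoidal end. -/
def upperPart : (yCatenoid c).formDomain →ₗ[ℝ] (catFace c 1).sobolev :=
  (LinearMap.proj (R := ℝ) (φ := fun i => (yCatenoid c i).sobolev) 1).comp
    (yCatenoid c).formDomain.subtype

/-- The component on the lower catenoidal end. -/
def lowerPart : (yCatenoid c).formDomain →ₗ[ℝ] (catFace c (-1)).sobolev :=
  (LinearMap.proj (R := ℝ) (φ := fun i => (yCatenoid c i).sobolev) 2).comp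
    (yCatenoid c).formDomain.subtype

theorem diskPart_mkTriple {D : (diskFace c).sobolev} {A : (catFace c 1).sobolev}
    {B : (catFace c (-1)).sobolev} (h : D.1.2.2 + A.1.2.2 + B.1.2.2 = 0) :
    diskPart (mkTriple D A B h) = D := rfl

theorem upperPart_mkTriple {D : (diskFace c).sobolev} {A : (catFace c 1).sobolev}
    {B : (catFace c (-1)).sobolev} (h : D.1.2.2 + A.1.2.2 + B.1.2.2 = 0) :
    upperPart (mkTriple D A B h) = A := rfl

theorem lowerPart_mkTriple {D : (diskFace c).sobolev} {A : (catFace c 1).sobolev}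
    {B : (catFace c (-1)).sobolev} (h : D.1.2.2 + A.1.2.2 + B.1.2.2 = 0) :
    lowerPart (mkTriple D A B h) = B := rfl

theorem trace_sum (U : (yCatenoid c).formDomain) :
    (diskPart U).1.2.2 + (upperPart U).1.2.2 + (lowerPart U).1.2.2 = 0 := by
  have h : ∑ i : Fin 3, (U.1 i).1.2.2 = 0 := U.2
  rw [Fin.sum_univ_three] at h
  exact h

theorem trace_sum_ae (U : (yCatenoid c).formDomain) :
    ∀ᵐ θ ∂Face.cparam, (diskPart U).1.2.2 θ + (upperPart U).1.2.2 θ + (lowerPart U).1.2.2 θ = 0 := by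
  have h := trace_sum U
  filter_upwards [AEEqFun.coeFn_add ((diskPart U).1.2.2 + (upperPart U).1.2.2) (lowerPart U).1.2.2,
    AEEqFun.coeFn_add (diskPart U).1.2.2 (upperPart U).1.2.2,
    AEEqFun.coeFn_zero (α := ℝ) (μ := Face.cparam) (β := ℝ)] with θ h1 h2 h3
  rw [h] at h1
  have h4 : (0 : ℝ) = _ := h3.symm.trans h1
  rw [Pi.add_apply, h2] at h4
  exact h4.symm

theorem eq_zero_of_parts {U : (yCatenoid c).formDomain} (h0 : diskPart U = 0)
    (h1 : upperPart U = 0) (h2 : lowerPart U = 0) : U = 0 := by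
  refine Subtype.ext (funext fun i => ?_)
  fin_cases i
  exacts [h0, h1, h2]

theorem indexForm_apply (U W : (yCatenoid c).formDomain) :
    (yCatenoid c).indexForm U W = (diskFace c).form (diskPart U) (diskPart W) +
      (catFace c 1).form (upperPart U) (upperPart W) +
      (catFace c (-1)).form (lowerPart U) (lowerPart W) := by
  rw [TripleJunction.indexForm, LinearMap.sum_apply, LinearMap.sum_apply, Fin.sum_univ_three]
  rfl

theorem fn_zero (U : (yCatenoid c).formDomain) :
    TripleJunction.fn U 0 = (diskPart U).1.1 := rfl

theorem fn_one (U : (yCatenoid c).formDomain) :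
    TripleJunction.fn U 1 = (upperPart U).1.1 := rfl

theorem fn_two (U : (yCatenoid c).formDomain) :
    TripleJunction.fn U 2 = (lowerPart U).1.1 := rfl

theorem ae_fn_zero_iff {U : (yCatenoid c).formDomain} {f : ℝ × ℝ → ℝ} :
    (∀ᵐ p ∂(yCatenoid c 0).param, TripleJunction.fn U 0 p = f p) ↔
      ∀ᵐ p ∂(diskFace c).param, (diskPart U).1.1 p = f p := Iff.rfl

theorem ae_fn_one_iff {U : (yCatenoid c).formDomain} {f : ℝ × ℝ → ℝ} :
    (∀ᵐ p ∂(yCatenoid c 1).param, TripleJunction.fn U 1 p = f p) ↔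
      ∀ᵐ p ∂cylinder, (upperPart U).1.1 p = f p :=
  catFace_ae (c := c) (ε := 1) (P := fun p => (upperPart U).1.1 p = f p)

theorem ae_fn_two_iff {U : (yCatenoid c).formDomain} {f : ℝ × ℝ → ℝ} :
    (∀ᵐ p ∂(yCatenoid c 2).param, TripleJunction.fn U 2 p = f p) ↔
      ∀ᵐ p ∂cylinder, (lowerPart U).1.1 p = f p :=
  catFace_ae (c := c) (ε := -1) (P := fun p => (lowerPart U).1.1 p = f p)

attribute [irreducible] mkTriple diskPart upperPart lowerPart

theorem form_zero_left {F : Face} (W : F.sobolev) : F.form 0 W = 0 := by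
  rw [← zero_smul ℝ (0 : F.sobolev), Face.form_smul, zero_mul]

theorem ae_neg {F : Face} (U : F.sobolev) : ∀ᵐ p ∂F.param, ((-1 : ℝ) • U).1.1 p = -U.1.1 p := by
  filter_upwards [AEEqFun.coeFn_smul (-1 : ℝ) U.1.1] with p h
  have h' : ((-1 : ℝ) • U).1.1 p = -1 * U.1.1 p := h
  rw [h', neg_one_mul]

/-- Opposite traces on the two ends cancel, so the disk may carry zero. -/
theorem exists_antisymm {E : (catFace c 1).sobolev} {E' : (catFace c (-1)).sobolev}
    {a a' : ℝ → ℝ} {k : ℤ} (hE : IsProduct E a a' k) (hE' : IsProduct E' a a' k) :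
    ∃ U : (yCatenoid c).formDomain, diskPart U = 0 ∧ upperPart U = E ∧ lowerPart U = (-1 : ℝ) • E' := by
  have h : E.1.2.2 = E'.1.2.2 := AEEqFun.ext (hE.trace.trans hE'.trace.symm)
  have ht : (0 : (diskFace c).sobolev).1.2.2 + E.1.2.2 + ((-1 : ℝ) • E').1.2.2 = 0 := by
    change (0 : ℝ →ₘ[Face.cparam] ℝ) + E.1.2.2 + (-1 : ℝ) • E'.1.2.2 = 0
    rw [h]
    simp
  exact ⟨mkTriple 0 E ((-1 : ℝ) • E') ht, diskPart_mkTriple ht, upperPart_mkTriple ht,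
    lowerPart_mkTriple ht⟩

theorem ae_zero (F : Face) : ∀ᵐ p ∂F.param, (0 : F.sobolev).1.1 p = 0 :=
  AEEqFun.coeFn_zero

theorem indexForm_antisymm {U : (yCatenoid c).formDomain} {E : (catFace c 1).sobolev}
    {E' : (catFace c (-1)).sobolev} (h0 : diskPart U = 0) (h1 : upperPart U = E)
    (h2 : lowerPart U = (-1 : ℝ) • E') (W : (yCatenoid c).formDomain) :
    (yCatenoid c).indexForm U W =
      (catFace c 1).form E (upperPart W) - (catFace c (-1)).form E' (lowerPart W) := by
  rw [indexForm_apply, h0, h1, h2, form_zero_left (diskPart W),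
    Face.form_smul (-1) E' (lowerPart W)]
  ring

/-- The test element `(0, tanh, -tanh)`. -/
theorem exists_pair_tanh (hc : 0 < c) : ∃ U : (yCatenoid c).formDomain,
    (∀ᵐ p ∂(diskFace c).param, (diskPart U).1.1 p = 0) ∧
    (∀ᵐ p ∂cylinder, (upperPart U).1.1 p = th p.1) ∧
    (∀ᵐ p ∂cylinder, (lowerPart U).1.1 p = -th p.1) ∧
    (∀ W, (yCatenoid c).indexForm U W =
      (catFace c (-1)).coefTrace 0 (lowerPart W) - (catFace c 1).coefTrace 0 (upperPart W)) ∧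
    (yCatenoid c).indexForm U U < 0 := by
  obtain ⟨E, hE, h⟩ := exists_tanh (ε := 1) hc (by norm_num)
  obtain ⟨E', hE', h'⟩ := exists_tanh (ε := -1) hc (by norm_num)
  obtain ⟨U, h0, h1, h2⟩ := exists_antisymm hE hE'
  have hQ : ∀ W, (yCatenoid c).indexForm U W =
      (catFace c (-1)).coefTrace 0 (lowerPart W) - (catFace c 1).coefTrace 0 (upperPart W) :=
    fun W => by
      rw [indexForm_antisymm h0 h1 h2, h, h']
      change -coef _ _ - -coef _ _ = coef _ _ - coef _ _
      ring
  refine ⟨U, ?_, ?_, ?_, hQ, ?_⟩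
  · rw [h0]; exact ae_zero _
  · rw [h1]
    filter_upwards [hE.fn] with p hp
    rw [hp, cas_zero, mul_one]
  · rw [h2]
    filter_upwards [hE'.fn, catFace_ae.1 (ae_neg E')] with p hp hp'
    rw [hp', hp, cas_zero, mul_one]
  -- The zeroth coefficients are π above and -π below, so the value is -2π.
  · rw [hQ, h1, h2, map_smul, smul_eq_mul, hE.coefTrace, hE'.coefTrace, if_pos rfl, th_zero]
    linarith [Real.pi_pos]

theorem diskFace_form_const (hc : 0 < c) {D : (diskFace c).sobolev}
    (h2 : D.1.2.1 =ᵐ[(diskFace c).param] fun _ => 0) (h3 : D.1.2.2 =ᵐ[Face.cparam] fun _ => 1)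
    (W : (diskFace c).sobolev) : (diskFace c).form D W = coef W.1.2.2 0 := by
  have e : ∫ p, inner ℝ (D.1.2.1 p) (W.1.2.1 p) ∂(diskFace c).area = 0 := by
    refine integral_eq_zero_of_ae ?_
    filter_upwards [Face.area_ac.ae_le h2] with p hp
    rw [hp, inner_zero_left]
    rfl
  rw [diskFace_form hc, coef, e, zero_add]
  refine integral_congr_ae ?_
  filter_upwards [h3] with θ hθ
  simp only [hθ, cas_zero, one_mul, mul_one]

/-- The null vector `(-1, tanh, tanh)`, which comes from dilations. -/
theorem exists_null_tanh (hc : 0 < c) : ∃ U : (yCatenoid c).formDomain,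
    (∀ᵐ p ∂(diskFace c).param, (diskPart U).1.1 p = -1) ∧
    (∀ᵐ p ∂cylinder, (upperPart U).1.1 p = th p.1) ∧
    (∀ᵐ p ∂cylinder, (lowerPart U).1.1 p = th p.1) ∧
    (∀ k, (catFace c 1).coefTrace k (upperPart U) = if 0 = k then Real.pi else 0) ∧
    (∀ k, (catFace c (-1)).coefTrace k (lowerPart U) = if 0 = k then Real.pi else 0) ∧
    ∀ W, (yCatenoid c).indexForm U W = 0 := by
  obtain ⟨E, hE, h⟩ := exists_tanh (ε := 1) hc (by norm_num)
  obtain ⟨E', hE', h'⟩ := exists_tanh (ε := -1) hc (by norm_num)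
  obtain ⟨D, d1, d2, d3⟩ := (diskFace_one hc).exists_sobolev continuous_const continuous_const
    continuous_const
  have ht : ((-1 : ℝ) • D).1.2.2 + E.1.2.2 + E'.1.2.2 = 0 := by
    have e1 : E.1.2.2 = E'.1.2.2 := AEEqFun.ext (hE.trace.trans hE'.trace.symm)
    have e2 : D.1.2.2 = E.1.2.2 + E.1.2.2 := by
      refine AEEqFun.ext ?_
      filter_upwards [d3, hE.trace, AEEqFun.coeFn_add E.1.2.2 E.1.2.2] with θ h1 h2 h3
      rw [h1, h3, Pi.add_apply, h2, th_zero, cas_zero]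
      norm_num
    change (-1 : ℝ) • D.1.2.2 + E.1.2.2 + E'.1.2.2 = 0
    rw [← e1, e2, neg_one_smul]
    abel
  have hco : ∀ k : ℤ, (1 / 2 : ℝ) * (if 0 = k then 2 * Real.pi else 0) =
      if 0 = k then Real.pi else 0 := fun k => by
    split_ifs <;> ring
  refine ⟨mkTriple ((-1 : ℝ) • D) E E' ht, ?_, ?_, ?_, fun k => ?_, fun k => ?_, fun W => ?_⟩
  · rw [diskPart_mkTriple]
    filter_upwards [d1, ae_neg D] with p h1 h2
    rw [h2, h1]
  · rw [upperPart_mkTriple]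
    filter_upwards [hE.fn] with p hp
    rw [hp, cas_zero, mul_one]
  · rw [lowerPart_mkTriple]
    filter_upwards [hE'.fn] with p hp
    rw [hp, cas_zero, mul_one]
  · rw [upperPart_mkTriple, hE.coefTrace, th_zero, hco]
  · rw [lowerPart_mkTriple, hE'.coefTrace, th_zero, hco]
  · rw [indexForm_apply, diskPart_mkTriple, upperPart_mkTriple, lowerPart_mkTriple]
    have e1 := diskFace_form_const hc d2 d3 (diskPart W)
    -- Each face contributes minus the zeroth coefficient of its trace of `W`: the disk through the
    -- constant -1, the ends through tanh. The trace condition makes the sum vanish.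
    have e3 := coef_sum_eq_zero (diskPart W).2.locG (upperPart W).2.locG (lowerPart W).2.locG
      (trace_sum_ae W) 0
    have e4 : ∀ x y z : ℝ, x + y + z = 0 → -1 * x + -y + -z = 0 := fun x y z h => by linarith
    have e5 := (Face.form_smul (-1) D (diskPart W)).trans (congrArg (-1 * ·) e1)
    exact (congrArg₂ (· + ·) (congrArg₂ (· + ·) e5 (h (upperPart W))) (h' (lowerPart W))).trans
      (e4 _ _ _ e3)

/-- The null vectors `(0, sech cas k, -sech cas k)`, `k = ±1`, which come from rotations. -/
theorem exists_null_sech (hc : 0 < c) {k : ℤ} (hk : k ^ 2 = 1) :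
    ∃ U : (yCatenoid c).formDomain,
    (∀ᵐ p ∂(diskFace c).param, (diskPart U).1.1 p = 0) ∧
    (∀ᵐ p ∂cylinder, (upperPart U).1.1 p = sech p.1 * cas k p.2) ∧
    (∀ᵐ p ∂cylinder, (lowerPart U).1.1 p = -(sech p.1 * cas k p.2)) ∧
    (∀ j, (catFace c 1).coefTrace j (upperPart U) = if k = j then sech 0 * (2 * Real.pi) else 0) ∧
    (∀ j, (catFace c (-1)).coefTrace j (lowerPart U) =
      -if k = j then sech 0 * (2 * Real.pi) else 0) ∧
    ∀ W, (yCatenoid c).indexForm U W = 0 := by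
  obtain ⟨E, hE, h⟩ := exists_sech (ε := 1) hc (by norm_num) hk
  obtain ⟨E', hE', h'⟩ := exists_sech (ε := -1) hc (by norm_num) hk
  obtain ⟨U, h0, h1, h2⟩ := exists_antisymm hE hE'
  refine ⟨U, ?_, ?_, ?_, fun j => ?_, fun j => ?_, fun W => ?_⟩
  · rw [h0]; exact ae_zero _
  · rw [h1]; exact hE.fn
  · rw [h2]
    filter_upwards [hE'.fn, catFace_ae.1 (ae_neg E')] with p hp hp'
    rw [hp', hp]
  · rw [h1, hE.coefTrace, mul_ite, mul_zero]
  · rw [h2, map_smul, smul_eq_mul, hE'.coefTrace, mul_ite, mul_zero, neg_one_mul]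
  · rw [indexForm_antisymm h0 h1 h2, h, h', sub_zero]

/-- Since |X|² = c² (cosh² + t²) increases for t ≥ 0, a profile with bounded support in `t` has
bounded support in space. -/
theorem le_of_catFace_norm_X_le {ε t θ : ℝ} (hc : 0 < c) (hε : ε ^ 2 = 1) {s : ℝ}
    (h : c * (Real.cosh (s + T₀) + s) < ‖(catFace c ε).X (t, θ)‖) (hs : 0 ≤ s) (ht : 0 ≤ t) :
    s ≤ t := by
  by_contra hst
  push Not at hst
  have hT : 0 ≤ T₀ := Real.log_nonneg (by rw [Real.one_le_sqrt]; norm_num)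
  have h1 : Real.cosh (t + T₀) ≤ Real.cosh (s + T₀) := by
    rw [Real.cosh_le_cosh, abs_of_nonneg (by linarith), abs_of_nonneg (by linarith)]
    linarith
  have h2 := catFace_norm_X c ε hε (t, θ)
  have h3 := Real.cosh_pos (t + T₀)
  have h4 : ‖(catFace c ε).X (t, θ)‖ ≤ c * (Real.cosh (s + T₀) + s) := by
    refine abs_le_of_sq_le_sq' ?_ (by positivity) |>.2
    rw [h2, mul_pow]
    refine mul_le_mul_of_nonneg_left ?_ (sq_nonneg c)
    simp only
    nlinarith [mul_nonneg h3.le ht]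
  linarith

theorem exists_compact_neg (hc : 0 < c) : ∃ U ∈ (yCatenoid c).compactDomain,
    (yCatenoid c).indexForm U U < 0 := by
  obtain ⟨E, hE, h⟩ := exists_cutoff (ε := 1) hc (by norm_num)
  obtain ⟨E', hE', h'⟩ := exists_cutoff (ε := -1) hc (by norm_num)
  obtain ⟨U, h0, h1, h2⟩ := exists_antisymm hE hE'
  refine ⟨U, ⟨c * (Real.cosh (16 + T₀) + 16), fun i => ?_⟩, ?_⟩
  · have key : ∀ (ε : ℝ) (E : (catFace c ε).sobolev), ε ^ 2 = 1 →
        IsProduct E cutoff (fun t => -(max 0 (1 - t / 16) / 8)) 0 →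
        ∀ᵐ p ∂(catFace c ε).param, c * (Real.cosh (16 + T₀) + 16) < ‖(catFace c ε).X p‖ →
          E.1.1 p = 0 := fun ε E hε hE => by
      refine catFace_ae.2 ?_
      have hpos : ∀ᵐ p ∂cylinder, 0 ≤ p.1 := by
        have := (Measure.quasiMeasurePreserving_fst (μ := volume.restrict (Ioi (0 : ℝ)))
          (ν := Face.cparam)).ae (ae_restrict_mem measurableSet_Ioi)
        filter_upwards [this] with p hp
        exact le_of_lt hp
      filter_upwards [hE.fn, hpos] with p hp hp0 hX
      rw [hp, cutoff_eq_zero (le_of_catFace_norm_X_le hc hε hX (by norm_num) hp0), zero_mul]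
    match i with
    | 0 =>
      rw [fn_zero, h0]
      filter_upwards [ae_zero (diskFace c)] with p hp _
      exact hp
    | 1 =>
      rw [fn_one, h1]
      exact key 1 E (by norm_num) hE
    | 2 =>
      rw [fn_two, h2]
      filter_upwards [key (-1) E' (by norm_num) hE', ae_neg E'] with p hp hp' hX
      exact hp'.trans (by rw [hp hX, neg_zero])
  · rw [indexForm_antisymm h0 h1 h2, h1, h2, Face.form_comm E', Face.form_smul (-1) E' E']
    linarith

end Triple

/-! ### Index, positivity and rigidity. -/

theorem index_eq_one {V : Type} [AddCommMonoid V] [Module ℝ V] {B : LinearMap.BilinForm ℝ V}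
    (l : V →ₗ[ℝ] ℝ) (hl : ∀ v, l v = 0 → 0 ≤ B v v) {v₀ : V} (hv₀ : B v₀ v₀ < 0) :
    index B = 1 := by
  -- The index is defined over additive monoids; scalar multiplication by -1 provides the negation
  -- that rank arguments need.
  let _ : AddCommGroup V := Module.addCommMonoidToAddCommGroup ℝ
  refine le_antisymm (iSup_le fun W => ?_) ?_
  -- A nonzero vector of the kernel of `l` cannot have negative energy, so `l` embeds every negative
  -- definite subspace into ℝ.
  · have hinj : Function.Injective (l.domRestrict W.1) := by
      rw [← LinearMap.ker_eq_bot, LinearMap.ker_eq_bot']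
      intro w hw
      by_contra hne
      have h1 := W.2 w w.2 fun h => hne (Subtype.ext h)
      exact absurd (hl w hw) (not_le.2 h1)
    have h1 := LinearMap.rank_le_of_injective _ hinj
    rw [Module.rank_self] at h1
    simpa using OrderHomClass.mono Cardinal.toENat h1
  · have hne : v₀ ≠ 0 := by
      rintro rfl
      simp at hv₀
    let W : {W : Submodule ℝ V // ∀ w ∈ W, w ≠ 0 → B w w < 0} := ⟨Submodule.span ℝ {v₀}, by
      intro w hw hw0
      obtain ⟨a, rfl⟩ := Submodule.mem_span_singleton.1 hw
      have ha : a ≠ 0 := fun h => hw0 (by rw [h, zero_smul])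
      rw [map_smul, map_smul, LinearMap.smul_apply, smul_eq_mul, smul_eq_mul, ← mul_assoc]
      exact mul_neg_of_pos_of_neg (mul_self_pos.2 ha) hv₀⟩
    have h1 : Cardinal.toENat (Module.rank ℝ W.1) = 1 := by
      rw [← Module.finrank_eq_rank ℝ (Submodule.span ℝ {v₀}), finrank_span_singleton hne,
        Nat.cast_one, map_one]
    rw [← h1]
    exact le_iSup (fun W : {W : Submodule ℝ V // ∀ w ∈ W, w ≠ 0 → B w w < 0} =>
      Cardinal.toENat (Module.rank ℝ W.1)) W

section Triple

variable {c : ℝ}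

theorem cyl_upper (hc : 0 < c) (U : (yCatenoid c).formDomain) :
    CylSobolev (upperPart U).1.1 ((catFace c 1).compT (upperPart U).1.2.1)
      ((catFace c 1).compθ (upperPart U).1.2.1) (upperPart U).1.2.2 :=
  catFace_cylSobolev hc (by norm_num) (upperPart U).2

theorem cyl_lower (hc : 0 < c) (U : (yCatenoid c).formDomain) :
    CylSobolev (lowerPart U).1.1 ((catFace c (-1)).compT (lowerPart U).1.2.1)
      ((catFace c (-1)).compθ (lowerPart U).1.2.1) (lowerPart U).1.2.2 :=
  catFace_cylSobolev hc (by norm_num) (lowerPart U).2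

theorem diskFace_ae_of_area (hc : 0 < c) {P : ℝ × ℝ → Prop}
    (h : ∀ᵐ p ∂(diskFace c).area, P p) : ∀ᵐ p ∂(diskFace c).param, P p := by
  rw [diskFace_area] at h
  rw [diskFace_param]
  exact ae_of_ae_withDensity (measurable_disk_density c) (ae_strip_pos hc) h

/-- The disk trace is eliminated through the trace condition, leaving a Dirichlet integral that is
nonnegative by itself and an expression in the two ends alone. -/
theorem indexForm_self (hc : 0 < c) (U : (yCatenoid c).formDomain) :
    (yCatenoid c).indexForm U U = (∫ p, ‖(diskPart U).1.2.1 p‖ ^ 2 ∂(diskFace c).area) +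
      ((∫ θ, ((upperPart U).1.2.2 θ + (lowerPart U).1.2.2 θ) ^ 2 ∂Face.cparam) +
        cylEnergy (upperPart U).1.1 ((catFace c 1).compT (upperPart U).1.2.1)
          ((catFace c 1).compθ (upperPart U).1.2.1) (upperPart U).1.2.2 +
        cylEnergy (lowerPart U).1.1 ((catFace c (-1)).compT (lowerPart U).1.2.1)
          ((catFace c (-1)).compθ (lowerPart U).1.2.1) (lowerPart U).1.2.2) := by
  have e1 : ∫ θ, (diskPart U).1.2.2 θ * (diskPart U).1.2.2 θ ∂Face.cparam =
      ∫ θ, ((upperPart U).1.2.2 θ + (lowerPart U).1.2.2 θ) ^ 2 ∂Face.cparam := by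
    refine integral_congr_ae ?_
    filter_upwards [trace_sum_ae U] with θ hθ
    rw [add_assoc] at hθ
    rw [eq_neg_of_add_eq_zero_left hθ]
    ring
  have e2 := diskFace_form hc (diskPart U) (diskPart U)
  have e3 := catFace_form_self hc (show (1 : ℝ) ^ 2 = 1 by norm_num) (upperPart U)
  have e4 := catFace_form_self hc (show (-1 : ℝ) ^ 2 = 1 by norm_num) (lowerPart U)
  rw [e1] at e2
  simp only [real_inner_self_eq_norm_sq] at e2
  rw [indexForm_apply]
  refine (congrArg₂ (· + ·) (congrArg₂ (· + ·) e2 e3) e4).trans ?_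
  simp only [add_assoc]

theorem indexForm_nonneg (hc : 0 < c) {U : (yCatenoid c).formDomain}
    (h : (catFace c 1).coefTrace 0 (upperPart U) = (catFace c (-1)).coefTrace 0 (lowerPart U)) :
    0 ≤ (yCatenoid c).indexForm U U := by
  rw [indexForm_self hc]
  exact add_nonneg (integral_nonneg fun _ => sq_nonneg _)
    ((cyl_upper hc U).pair_nonneg (cyl_lower hc U) h)

/-- Agreement of the coefficients for |k| ≤ 1 gives the antisymmetric modes zero initial value where
their square has a kernel, and the vanishing mean does so for the symmetric mode k = 0. Once the
ends vanish, the disk component has zero gradient and zero trace. -/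
theorem eq_zero_of_indexForm (hc : 0 < c) {U : (yCatenoid c).formDomain}
    (h : ∀ k : ℤ, |k| ≤ 1 →
      (catFace c 1).coefTrace k (upperPart U) = (catFace c (-1)).coefTrace k (lowerPart U))
    (h0 : (catFace c 1).coefTrace 0 (upperPart U) = 0)
    (hQ : (yCatenoid c).indexForm U U = 0) : U = 0 := by
  have h00 := h 0 (by norm_num)
  have n1 : 0 ≤ ∫ p, ‖(diskPart U).1.2.1 p‖ ^ 2 ∂(diskFace c).area :=
    integral_nonneg fun _ => sq_nonneg _
  have n2 := (cyl_upper hc U).pair_nonneg (cyl_lower hc U) h00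
  rw [indexForm_self hc] at hQ
  obtain ⟨z1, z2⟩ := (add_eq_zero_iff_of_nonneg n1 n2).1 hQ
  have h0' : coef (upperPart U).1.2.2 0 + coef (lowerPart U).1.2.2 0 = 0 :=
    (congrArg₂ (· + ·) h0 (h00.symm.trans h0)).trans (add_zero 0)
  obtain ⟨u1, u2⟩ := (cyl_upper hc U).pair_eq_zero (cyl_lower hc U) h h0' z2
  obtain ⟨V1, g1⟩ := catFace_unique hc (by norm_num) (upperPart U).2 (catFace_ae.2 u1)
  obtain ⟨V2, g2⟩ := catFace_unique hc (by norm_num) (lowerPart U).2 (catFace_ae.2 u2)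
  have g0 : ∀ᵐ θ ∂Face.cparam, (diskPart U).1.2.2 θ = 0 := by
    filter_upwards [trace_sum_ae U, g1, g2] with θ h1 h2 h3
    rwa [h2, h3, add_zero, add_zero] at h1
  have V0 : ∀ᵐ p ∂(diskFace c).param, (diskPart U).1.2.1 p = 0 := by
    have i := (diskPart U).2.memV.norm.integrable_sq
    have h1 := (integral_eq_zero_iff_of_nonneg (fun _ => sq_nonneg _) i).1 z1
    have h2 : ∀ᵐ p ∂(diskFace c).area, (diskPart U).1.2.1 p = 0 := by
      filter_upwards [h1] with p hp
      simpa using hp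
    exact diskFace_ae_of_area hc h2
  exact eq_zero_of_parts
    (Face.sobolev_eq_zero (diskFace_eq_zero_of_grad hc (diskPart U).2 V0 g0) V0 g0)
    (Face.sobolev_eq_zero (catFace_ae.2 u1) V1 g1) (Face.sobolev_eq_zero (catFace_ae.2 u2) V2 g2)

theorem eq_zero_of_fn (hc : 0 < c) {U : (yCatenoid c).formDomain}
    (h0 : ∀ᵐ p ∂(diskFace c).param, (diskPart U).1.1 p = 0)
    (h1 : ∀ᵐ p ∂cylinder, (upperPart U).1.1 p = 0)
    (h2 : ∀ᵐ p ∂cylinder, (lowerPart U).1.1 p = 0) : U = 0 := by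
  obtain ⟨V0, g0⟩ := diskFace_unique hc (diskPart U).2 h0
  obtain ⟨V1, g1⟩ := catFace_unique hc (by norm_num) (upperPart U).2 (catFace_ae.2 h1)
  obtain ⟨V2, g2⟩ := catFace_unique hc (by norm_num) (lowerPart U).2 (catFace_ae.2 h2)
  exact eq_zero_of_parts (Face.sobolev_eq_zero h0 V0 g0)
    (Face.sobolev_eq_zero (catFace_ae.2 h1) V1 g1) (Face.sobolev_eq_zero (catFace_ae.2 h2) V2 g2)

end Triple

theorem ae_linear_combination {F : Face} (a b d : ℝ) (X Y Z : F.sobolev) :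
    ∀ᵐ p ∂F.param, (a • X + b • Y + d • Z).1.1 p = a * X.1.1 p + b * Y.1.1 p + d * Z.1.1 p := by
  filter_upwards [AEEqFun.coeFn_add (a • X.1.1 + b • Y.1.1) (d • Z.1.1),
    AEEqFun.coeFn_add (a • X.1.1) (b • Y.1.1), AEEqFun.coeFn_smul a X.1.1,
    AEEqFun.coeFn_smul b Y.1.1, AEEqFun.coeFn_smul d Z.1.1] with p h1 h2 h3 h4 h5
  change (a • X.1.1 + b • Y.1.1 + d • Z.1.1) p = _
  rw [h1, Pi.add_apply, h2, Pi.add_apply, h3, h4, h5]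
  rfl

theorem ae_sub {F : Face} (X Y : F.sobolev) :
    ∀ᵐ p ∂F.param, (X + (-1 : ℝ) • Y).1.1 p = X.1.1 p - Y.1.1 p := by
  filter_upwards [AEEqFun.coeFn_add X.1.1 ((-1 : ℝ) • Y.1.1), AEEqFun.coeFn_smul (-1 : ℝ) Y.1.1]
    with p h1 h2
  change (X.1.1 + (-1 : ℝ) • Y.1.1) p = _
  rw [h1, Pi.add_apply, h2, Pi.smul_apply, smul_eq_mul]
  ring

theorem eq_of_add_neg_one_smul {V : Type*} [AddCommMonoid V] [Module ℝ V] {x y : V}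
    (h : x + (-1 : ℝ) • y = 0) : x = y := by
  let _ : AddCommGroup V := Module.addCommMonoidToAddCommGroup ℝ
  rwa [neg_one_smul, add_neg_eq_zero] at h

theorem nullity_eq_three {V : Type} [AddCommMonoid V] [Module ℝ V] {B : LinearMap.BilinForm ℝ V}
    {X Y Z : V} (h0 : ∀ a b d : ℝ, a • X + b • Y + d • Z = 0 → a = 0 ∧ b = 0 ∧ d = 0)
    (h : ∀ v, (∀ w, B v w = 0) ↔ ∃ a b d : ℝ, v = a • X + b • Y + d • Z) :
    nullity B = 3 := by
  let _ : AddCommGroup V := Module.addCommMonoidToAddCommGroup ℝ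
  have hN : LinearIndependent ℝ ![X, Y, Z] := by
    rw [Fintype.linearIndependent_iff]
    intro g hg
    rw [Fin.sum_univ_three] at hg
    obtain ⟨ha, hb, hd⟩ := h0 _ _ _ hg
    intro i
    fin_cases i
    exacts [ha, hb, hd]
  have hk : LinearMap.ker B = Submodule.span ℝ (range ![X, Y, Z]) := by
    ext v
    have h1 : B v = 0 ↔ ∀ w, B v w = 0 := LinearMap.ext_iff
    rw [LinearMap.mem_ker, h1, h, Submodule.mem_span_range_iff_exists_fun]
    constructor
    · rintro ⟨a, b, d, rfl⟩
      exact ⟨![a, b, d], by rw [Fin.sum_univ_three]; rfl⟩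
    · rintro ⟨g, rfl⟩
      exact ⟨g 0, g 1, g 2, Fin.sum_univ_three _⟩
  have := FiniteDimensional.span_of_finite ℝ (finite_range ![X, Y, Z])
  rw [nullity, hk, ← Module.finrank_eq_rank ℝ (Submodule.span ℝ (range ![X, Y, Z])),
    finrank_span_eq_card hN]
  simp

/-- Pure linear algebra. `N` adjusts the common zeroth coefficient, while `S` and `R`, opposite on
the two ends, adjust the differences at frequencies 1 and -1. The zeroth difference needs no
adjustment, by `h0`. -/
theorem null_space_of_coefficients {V : Type*} [AddCommMonoid V] [Module ℝ V]
    {B : LinearMap.BilinForm ℝ V} (up lo : ℤ → V →ₗ[ℝ] ℝ) {N S R : V} {m : ℝ} (hm : 0 < m)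
    (uN : ∀ k, up k N = if 0 = k then Real.pi else 0) (uS : ∀ k, up k S = if 1 = k then m else 0)
    (uR : ∀ k, up k R = if -1 = k then m else 0)
    (lN : ∀ k, lo k N = if 0 = k then Real.pi else 0) (lS : ∀ k, lo k S = -if 1 = k then m else 0)
    (lR : ∀ k, lo k R = -if -1 = k then m else 0)
    (hN : ∀ W, B N W = 0) (hS : ∀ W, B S W = 0) (hR : ∀ W, B R W = 0)
    (h0 : ∀ U, (∀ W, B U W = 0) → up 0 U = lo 0 U)
    (h : ∀ U, (∀ k : ℤ, |k| ≤ 1 → up k U = lo k U) → up 0 U = 0 → B U U = 0 → U = 0) :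
    (∀ a b d : ℝ, a • N + b • S + d • R = 0 → a = 0 ∧ b = 0 ∧ d = 0) ∧
    ∀ U, (∀ W, B U W = 0) ↔ ∃ a b d : ℝ, U = a • N + b • S + d • R := by
  have hup : ∀ (a b d : ℝ) (k : ℤ), up k (a • N + b • S + d • R) =
      a * (if 0 = k then Real.pi else 0) + b * (if 1 = k then m else 0) +
        d * (if -1 = k then m else 0) := fun a b d k => by
    simp only [map_add, map_smul, uN, uS, uR, smul_eq_mul]
  have hlo : ∀ (a b d : ℝ) (k : ℤ), lo k (a • N + b • S + d • R) =
      a * (if 0 = k then Real.pi else 0) + b * (-if 1 = k then m else 0) +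
        d * (-if -1 = k then m else 0) := fun a b d k => by
    simp only [map_add, map_smul, lN, lS, lR, smul_eq_mul]
  have hnull : ∀ (a b d : ℝ) W, B (a • N + b • S + d • R) W = 0 := fun a b d W => by
    simp [hN, hS, hR]
  refine ⟨fun a b d hz => ?_, fun U => ⟨fun hU => ?_, ?_⟩⟩
  · have hk : ∀ k : ℤ, a * (if 0 = k then Real.pi else 0) + b * (if 1 = k then m else 0) +
        d * (if -1 = k then m else 0) = 0 := fun k => by
      rw [← hup a b d k, hz, map_zero]
    exact ⟨by simpa [Real.pi_ne_zero] using hk 0, by simpa [hm.ne'] using hk 1,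
      by simpa [hm.ne'] using hk (-1)⟩
  · obtain ⟨a, ha⟩ : ∃ a, a * Real.pi = up 0 U := ⟨_, div_mul_cancel₀ _ Real.pi_ne_zero⟩
    -- The fields `S` and `R` contribute `m` above and `-m` below, so they change the difference by
    -- `2 * m`.
    have hex : ∀ k, ∃ b, b * (2 * m) = up k U - lo k U :=
      fun k => ⟨_, div_mul_cancel₀ _ (mul_pos two_pos hm).ne'⟩
    obtain ⟨b, hb⟩ := hex 1
    obtain ⟨d, hd⟩ := hex (-1)
    refine ⟨a, b, d, eq_of_add_neg_one_smul (h _ (fun k hk => ?_) ?_ ?_)⟩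
    · rw [map_add, map_smul, hup, map_add, map_smul, hlo]
      obtain ⟨k1, k2⟩ := abs_le.1 hk
      have hk' : k = -1 ∨ k = 0 ∨ k = 1 := by lia
      rcases hk' with rfl | rfl | rfl
      · simp
        linarith
      · simpa using h0 U hU
      · simp
        linarith
    · rw [map_add, map_smul, hup, ← ha]
      simp
    · rw [LinearMap.map_add₂, LinearMap.map_smul₂, hU, hnull, smul_zero, add_zero]
  · rintro ⟨a, b, d, rfl⟩ W
    exact hnull a b d W

/-! ### The null space and the index of the Y-catenoid. -/

section Triple

variable {c : ℝ}

theorem indexForm_comm (U W : (yCatenoid c).formDomain) :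
    (yCatenoid c).indexForm U W = (yCatenoid c).indexForm W U := by
  rw [indexForm_apply, indexForm_apply]
  exact congrArg₂ (· + ·) (congrArg₂ (· + ·) (Face.form_comm _ _) (Face.form_comm _ _))
    (Face.form_comm _ _)

/-- `U` is the triple `(-a, a tanh + v, a tanh - v)` with `v = (b cos θ + d sin θ) / cosh`. -/
def IsJacobi (U : (yCatenoid c).formDomain) (a b d : ℝ) : Prop :=
  (∀ᵐ p ∂(diskFace c).param, (diskPart U).1.1 p = -a) ∧
  (∀ᵐ p ∂cylinder, (upperPart U).1.1 p = a * Real.tanh (p.1 + T₀) +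
    (b * Real.cos p.2 + d * Real.sin p.2) / Real.cosh (p.1 + T₀)) ∧
  (∀ᵐ p ∂cylinder, (lowerPart U).1.1 p = a * Real.tanh (p.1 + T₀) -
    (b * Real.cos p.2 + d * Real.sin p.2) / Real.cosh (p.1 + T₀))

theorem IsJacobi.eq (hc : 0 < c) {U W : (yCatenoid c).formDomain} {a b d : ℝ}
    (h : IsJacobi U a b d) (h' : IsJacobi W a b d) : U = W := by
  refine eq_of_add_neg_one_smul (eq_zero_of_fn hc ?_ ?_ ?_)
  · rw [map_add, map_smul]
    filter_upwards [h.1, h'.1, ae_sub (diskPart U) (diskPart W)] with p h1 h2 h3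
    rw [h3, h1, h2, sub_self]
  · rw [map_add, map_smul]
    filter_upwards [h.2.1, h'.2.1, catFace_ae.1 (ae_sub (upperPart U) (upperPart W))]
      with p h1 h2 h3
    rw [h3, h1, h2, sub_self]
  · rw [map_add, map_smul]
    filter_upwards [h.2.2, h'.2.2, catFace_ae.1 (ae_sub (lowerPart U) (lowerPart W))]
      with p h1 h2 h3
    rw [h3, h1, h2, sub_self]

/-- `S` and `R` carry cos + sin and cos - sin, the members `cas 1` and `cas (-1)` of the system.
This accounts for the coefficients b + d and b - d. -/
theorem IsJacobi.linear_combination {N S R : (yCatenoid c).formDomain}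
    (n : IsJacobi N 1 0 0) (s : IsJacobi S 0 1 1) (r : IsJacobi R 0 1 (-1)) (a b d : ℝ) :
    IsJacobi (a • N + b • S + d • R) a (b + d) (b - d) := by
  refine ⟨?_, ?_, ?_⟩
  · rw [map_add, map_add, map_smul, map_smul, map_smul]
    filter_upwards [n.1, s.1, r.1,
      ae_linear_combination a b d (diskPart N) (diskPart S) (diskPart R)] with p h1 h2 h3 h4
    rw [h4, h1, h2, h3]
    ring
  · rw [map_add, map_add, map_smul, map_smul, map_smul]
    filter_upwards [n.2.1, s.2.1, r.2.1,
      catFace_ae.1 (ae_linear_combination a b d (upperPart N) (upperPart S) (upperPart R))]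
      with p h1 h2 h3 h4
    rw [h4, h1, h2, h3]
    ring
  · rw [map_add, map_add, map_smul, map_smul, map_smul]
    filter_upwards [n.2.2, s.2.2, r.2.2,
      catFace_ae.1 (ae_linear_combination a b d (lowerPart N) (lowerPart S) (lowerPart R))]
      with p h1 h2 h3 h4
    rw [h4, h1, h2, h3]
    ring

theorem exists_isJacobi_tanh (hc : 0 < c) : ∃ U : (yCatenoid c).formDomain, IsJacobi U 1 0 0 ∧
    (∀ k, (catFace c 1).coefTrace k (upperPart U) = if 0 = k then Real.pi else 0) ∧
    (∀ k, (catFace c (-1)).coefTrace k (lowerPart U) = if 0 = k then Real.pi else 0) ∧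
    ∀ W, (yCatenoid c).indexForm U W = 0 := by
  obtain ⟨U, h0, h1, h2, h⟩ := exists_null_tanh hc
  refine ⟨U, ⟨h0, ?_, ?_⟩, h⟩
  · filter_upwards [h1] with p hp
    rw [hp, th]
    ring
  · filter_upwards [h2] with p hp
    rw [hp, th]
    ring

theorem exists_isJacobi_sech (hc : 0 < c) {k : ℤ} (hk : k = 1 ∨ k = -1) :
    ∃ U : (yCatenoid c).formDomain, IsJacobi U 0 1 k ∧
    (∀ j, (catFace c 1).coefTrace j (upperPart U) = if k = j then sech 0 * (2 * Real.pi) else 0) ∧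
    (∀ j, (catFace c (-1)).coefTrace j (lowerPart U) =
      -if k = j then sech 0 * (2 * Real.pi) else 0) ∧
    ∀ W, (yCatenoid c).indexForm U W = 0 := by
  obtain ⟨U, h0, h1, h2, h⟩ := exists_null_sech hc (k := k) (by rcases hk with rfl | rfl <;> rfl)
  have hcas : ∀ θ, cas k θ = Real.cos θ + k * Real.sin θ := fun θ => by
    rcases hk with rfl | rfl <;> simp [cas]
  refine ⟨U, ⟨?_, ?_, ?_⟩, h⟩
  · filter_upwards [h0] with p hp
    rw [hp, neg_zero]
  · filter_upwards [h1] with p hp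
    rw [hp, hcas, sech]
    ring
  · filter_upwards [h2] with p hp
    rw [hp, hcas, sech]
    ring

set_option maxHeartbeats 400000 in
/-- The null space of the index form is spanned by three independent Jacobi fields. -/
theorem exists_null_basis (hc : 0 < c) : ∃ N S R : (yCatenoid c).formDomain,
    (∀ a b d : ℝ, a • N + b • S + d • R = 0 → a = 0 ∧ b = 0 ∧ d = 0) ∧
    (∀ U, (∀ W, (yCatenoid c).indexForm U W = 0) ↔
      ∃ a b d : ℝ, U = a • N + b • S + d • R) ∧
    ∀ a b d : ℝ, IsJacobi (a • N + b • S + d • R) a (b + d) (b - d) := by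
  obtain ⟨P, -, -, -, hP, -⟩ := exists_pair_tanh hc
  obtain ⟨N, n, cu, cl, hN⟩ := exists_isJacobi_tanh hc
  obtain ⟨S, s, su, sl, hS⟩ := exists_isJacobi_sech hc (k := 1) (Or.inl rfl)
  obtain ⟨R, r, ru, rl, hR⟩ := exists_isJacobi_sech hc (k := -1) (Or.inr rfl)
  rw [Int.cast_one] at s
  rw [Int.cast_neg, Int.cast_one] at r
  have hm : 0 < sech 0 * (2 * Real.pi) := mul_pos (sech_pos 0) Real.two_pi_pos
  -- A null vector pairs to zero with (0, tanh, -tanh), and this pairing is the difference of the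
  -- zeroth trace coefficients.
  have hPU : ∀ U, (∀ W, (yCatenoid c).indexForm U W = 0) →
      (catFace c 1).coefTrace 0 (upperPart U) = (catFace c (-1)).coefTrace 0 (lowerPart U) :=
    fun U hU => (sub_eq_zero.1 ((hP U).symm.trans ((indexForm_comm P U).trans (hU P)))).symm
  have key := null_space_of_coefficients (B := (yCatenoid c).indexForm)
    (fun k => ((catFace c 1).coefTrace k).comp upperPart)
    (fun k => ((catFace c (-1)).coefTrace k).comp lowerPart) hm cu su ru cl sl rl hN hS hR hPU
    fun U h h0 hQ => eq_zero_of_indexForm hc h h0 hQ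
  exact ⟨N, S, R, key.1, key.2, n.linear_combination s r⟩

theorem isJacobi_iff {U : (yCatenoid c).formDomain} {a b d : ℝ} : IsJacobi U a b d ↔
    (∀ᵐ p ∂(yCatenoid c 0).param, TripleJunction.fn U 0 p = -a) ∧
    (∀ᵐ p ∂(yCatenoid c 1).param, TripleJunction.fn U 1 p = a * Real.tanh (p.1 + T₀) +
      (b * Real.cos p.2 + d * Real.sin p.2) / Real.cosh (p.1 + T₀)) ∧
    (∀ᵐ p ∂(yCatenoid c 2).param, TripleJunction.fn U 2 p = a * Real.tanh (p.1 + T₀) -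
      (b * Real.cos p.2 + d * Real.sin p.2) / Real.cosh (p.1 + T₀)) :=
  and_congr (ae_fn_zero_iff (f := fun _ => -a)).symm
    (and_congr ae_fn_one_iff.symm ae_fn_two_iff.symm)

/-- The null space of the index form has dimension three and consists of the explicit triples. -/
theorem null_space (hc : 0 < c) : nullity (yCatenoid c).indexForm = 3 ∧
    ∀ U, (∀ W, (yCatenoid c).indexForm U W = 0) ↔ ∃ a b d : ℝ, IsJacobi U a b d := by
  obtain ⟨N, S, R, hN, hnull, hJ⟩ := exists_null_basis hc
  refine ⟨nullity_eq_three hN hnull, fun U => (hnull U).trans ⟨?_, ?_⟩⟩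
  · rintro ⟨a, b, d, rfl⟩
    exact ⟨a, b + d, b - d, hJ a b d⟩
  · rintro ⟨a, b, d, h⟩
    -- This inverts the change of basis between cos, sin and `cas 1`, `cas (-1)`.
    have h' := hJ a ((b + d) / 2) ((b - d) / 2)
    rw [show (b + d) / 2 + (b - d) / 2 = b by ring, show (b + d) / 2 - (b - d) / 2 = d by ring]
      at h'
    exact ⟨a, (b + d) / 2, (b - d) / 2, h.eq hc h'⟩

theorem exists_negative (hc : 0 < c) : ∃ U : (yCatenoid c).formDomain,
    (∀ᵐ p ∂(yCatenoid c 0).param, TripleJunction.fn U 0 p = 0) ∧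
    (∀ᵐ p ∂(yCatenoid c 1).param, TripleJunction.fn U 1 p = Real.tanh (p.1 + T₀)) ∧
    (∀ᵐ p ∂(yCatenoid c 2).param, TripleJunction.fn U 2 p = -Real.tanh (p.1 + T₀)) ∧
    (yCatenoid c).indexForm U U < 0 := by
  obtain ⟨P, p0, p1, p2, -, hPP⟩ := exists_pair_tanh hc
  exact ⟨P, (ae_fn_zero_iff (f := fun _ => 0)).2 p0, ae_fn_one_iff.2 p1, ae_fn_two_iff.2 p2, hPP⟩

/-- The index form has index one, also on the compactly supported elements. -/
theorem index_yCatenoid (hc : 0 < c) : index (yCatenoid c).indexForm = 1 ∧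
    index ((yCatenoid c).indexForm.restrict (yCatenoid c).compactDomain) = 1 := by
  obtain ⟨P, -, -, -, hP, hPP⟩ := exists_pair_tanh hc
  obtain ⟨X, hX, hXX⟩ := exists_compact_neg hc
  have hl : ∀ U, (yCatenoid c).indexForm P U = 0 → 0 ≤ (yCatenoid c).indexForm U U := fun U hU =>
    indexForm_nonneg hc (sub_eq_zero.1 ((hP U).symm.trans hU)).symm
  -- For compact supports the bounding functional is still the pairing with `P`. Only its
  -- restriction is used, so `P` need not be compactly supported; the negative direction is `X`.
  exact ⟨index_eq_one _ hl hPP, index_eq_one (v₀ := ⟨X, hX⟩)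
    (((yCatenoid c).indexForm P).comp (yCatenoid c).compactDomain.subtype)
    (fun U hU => hl U hU) hXX⟩

end Triple

end YSurface

end

theorem theorem4p3 (c : ℝ) (hc : 0 < c) :
    YSurface.index (YSurface.yCatenoid c).indexForm = 1 ∧
    YSurface.index ((YSurface.yCatenoid c).indexForm.restrict (YSurface.yCatenoid c).compactDomain) = 1 ∧
    YSurface.nullity (YSurface.yCatenoid c).indexForm = 3 ∧
    (∃ U : (YSurface.yCatenoid c).formDomain,
      (∀ᵐ p ∂((YSurface.yCatenoid c) 0).param, YSurface.TripleJunction.fn U 0 p = 0) ∧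
      (∀ᵐ p ∂((YSurface.yCatenoid c) 1).param, YSurface.TripleJunction.fn U 1 p = Real.tanh (p.1 + YSurface.T₀)) ∧
      (∀ᵐ p ∂((YSurface.yCatenoid c) 2).param, YSurface.TripleJunction.fn U 2 p = -Real.tanh (p.1 + YSurface.T₀)) ∧
      (YSurface.yCatenoid c).indexForm U U < 0) ∧
    (∀ U : (YSurface.yCatenoid c).formDomain,
      (∀ W : (YSurface.yCatenoid c).formDomain, (YSurface.yCatenoid c).indexForm U W = 0) ↔
      ∃ a b d : ℝ,
        (∀ᵐ p ∂((YSurface.yCatenoid c) 0).param, YSurface.TripleJunction.fn U 0 p = -a) ∧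
        (∀ᵐ p ∂((YSurface.yCatenoid c) 1).param, YSurface.TripleJunction.fn U 1 p =
          a * Real.tanh (p.1 + YSurface.T₀) +
            (b * Real.cos p.2 + d * Real.sin p.2) / Real.cosh (p.1 + YSurface.T₀)) ∧
        (∀ᵐ p ∂((YSurface.yCatenoid c) 2).param, YSurface.TripleJunction.fn U 2 p =
          a * Real.tanh (p.1 + YSurface.T₀) -
            (b * Real.cos p.2 + d * Real.sin p.2) / Real.cosh (p.1 + YSurface.T₀))) := by
  refine ⟨(YSurface.index_yCatenoid hc).1, (YSurface.index_yCatenoid hc).2,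
    (YSurface.null_space hc).1, YSurface.exists_negative hc, fun U => ?_⟩
  refine ((YSurface.null_space hc).2 U).trans ?_
  exact exists_congr fun a => exists_congr fun b => exists_congr fun d => YSurface.isJacobi_iff
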